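/- Conventions. A polynomial is non-negative if it takes non-negative values on all tuples of natural numbers. A maximal monomial of $P\in\mathbb{Z}[X_1,\dots,X_k]$ is a monomial (with its nonzero coefficient) of the decomposition of $P$ that is maximal for divisibility (over $\mathbb{Q}$) among the monomials of $P$. For a partial function $\nu\colon\{X_1,\dots,X_k\}\rightharpoonup\mathbb{N}$, $P|_\nu$ is the polynomial obtained by substituting $\nu(X_i)$ for every $X_i$ in the domain of $\nu$. $\mathsf{PolyStrNNeg}$ is the class of integer polynomials $P$ such that for every partial function $\nu$, every maximal monomial of $P|_\nu$ is non-negative. Let $\Sigma$ be a finite alphabet. An $\mathbb{N}$-rational series is a function $\Sigma^*\to\mathbb{N}$ computed by an $\mathbb{N}$-weighted automaton (finitely many states, initial, transition and final weights in $\mathbb{N}$; the value on $w$ is the sum over all runs on $w$ of the product of their weights). An $\mathbb{N}$-polyregular function is a function $f\colon\Sigma^*\to\mathbb{N}$ for which there are $d\in\mathbb{N}$, a finite monoid $M$, a morphism $\mu\colon\Sigma^*\to M$ and $\pi\colon M^{d+1}\to\mathbb{N}$ with $$f(w)=\sum_{w=u_1\cdots u_{d+1}}\pi(\mu(u_1),\dots,\mu(u_{d+1}))\qquad\text{for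 all } w\in\Sigma^*;$$ it is star-free if $M$ can be chosen aperiodic (for all $x\in M$ there is $n$ with $x^{n+1}=x^n$). A polynomial $P\in\mathbb{Z}[X_1,\dots,X_k]$ is represented by $g\colon\Sigma^*\to\mathbb{N}$ if $g$ is invariant under permutations of the letters of its input and there is $\eta\colon\{1,\dots,k\}\to\Sigma$ with $g(\eta(1)^{x_1}\cdots\eta(k)^{x_k})=P(x_1,\dots,x_k)$ for all $x\in\mathbb{N}^k$. Theorem. Let $k\in\mathbb{N}$ and $P\in\mathbb{Z}[X_1,\dots,X_k]$. The following are equivalent: 1. $P\in\mathsf{PolyStrNNeg}$; 2. $P$ is represented by an $\mathbb{N}$-rational series over some finite alphabet; 3. $P$ is represented by an $\mathbb{N}$-polyregular function over some finite alphabet; 4. $P$ is represented by a star-free $\mathbb{N}$-polyregular function over some finite alphabet. Furthermore, each of these properties is decidable, given $k$ and $P$ (as a list of coefficients with exponent vectors), and the conversions are effective, uniformly in $k$: there are computable functions that map - (1 to 4) every $P\in\mathsf{PolyStrNNeg}$ to a star-free $\mathbb{N}$-polyregular function (with its $\eta$) that represents $P$, - (4 to 3) every star-free $\mathbb{N}$-polyregular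 function (with $\eta$) that represents a polynomial $P$ to an $\mathbb{N}$-polyregular function (with its $\eta$) that represents $P$, - (3 to 2) every $\mathbb{N}$-polyregular function (with $\eta$) that represents a polynomial $P$ to an $\mathbb{N}$-weighted automaton (with its $\eta$) whose series represents $P$, - (2 to 1) every $\mathbb{N}$-weighted automaton (with $\eta$) whose series represents a polynomial $P$ to $P$ itself, which is in $\mathsf{PolyStrNNeg}$, so that, by composition, there is a conversion from each condition to each other one. Here $\mathbb{N}$-polyregular functions are given by $d$, the multiplication table of $M$, the images of the letters under $\mu$ and the table of $\pi$, and weighted automata by their tables of weights. -/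

import Mathlib

namespace NPolyreg

/-! ### Polynomials -/

section Polynomials

variable {σ : Type*}

/-- `P` takes non-negative values on all tuples of natural numbers. -/
def IsNonNegative (P : MvPolynomial σ ℤ) : Prop :=
  ∀ n : σ → ℕ, 0 ≤ MvPolynomial.eval (fun i => (n i : ℤ)) P

/-- `S` is one of the (nonzero) monomials, coefficient included, in the decomposition of `P`. -/
def IsMonomialOf (S P : MvPolynomial σ ℤ) : Prop :=
  ∃ m ∈ P.support, S = MvPolynomial.monomial m (P.coeff m)

/-- Divisibility of integer monomials, seen as polynomials with rational coefficients. -/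
def DividesOverRat (S T : MvPolynomial σ ℤ) : Prop :=
  MvPolynomial.map (Int.castRingHom ℚ) S ∣ MvPolynomial.map (Int.castRingHom ℚ) T

/-- `S` is a monomial of `P` that is maximal for the divisibility preorder among those of `P`. -/
def IsMaximalMonomial (S P : MvPolynomial σ ℤ) : Prop :=
  IsMonomialOf S P ∧ ∀ T, IsMonomialOf T P → DividesOverRat S T → DividesOverRat T S

/-- The restriction of `P` along a partial valuation `ν` (`none` means: outside the domain).
The result is kept in the same polynomial ring; the indeterminates of the domain of `ν`
do not occur in it. -/
noncomputable def restrict (P : MvPolynomial σ ℤ) (ν : σ → Option ℕ) : MvPolynomial σ ℤ :=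
  MvPolynomial.bind₁
    (fun i => match ν i with
      | none => MvPolynomial.X i
      | some n => MvPolynomial.C (n : ℤ)) P

/-- The class `PolyStrNNeg`: after any partial valuation in the natural numbers, all maximal
monomials are non-negative. -/
def IsPolyStrNNeg (P : MvPolynomial σ ℤ) : Prop :=
  ∀ ν : σ → Option ℕ, ∀ S, IsMaximalMonomial S (restrict P ν) → IsNonNegative S

end Polynomials

/-! ### Functions on words -/

section Words

variable {α : Type*}

/-- Invariance under permutations of the letters of the input word. -/
def IsCommutative {X : Type*} (f : List α → X) : Prop :=
  ∀ u v : List α, u.Perm v → f u = f v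

/-- The word `η(1)^{x₁} ⋯ η(k)^{x_k}`. -/
def dagger {k : ℕ} (η : Fin k → α) (x : Fin k → ℕ) : List α :=
  (List.ofFn fun i => List.replicate (x i) (η i)).flatten

/-- `P` is represented by the commutative function `g` through the letter assignment `η`. -/
def RepresentsVia {k : ℕ} (η : Fin k → α) (g : List α → ℕ) (P : MvPolynomial (Fin k) ℤ) : Prop :=
  IsCommutative g ∧
    ∀ x : Fin k → ℕ, (g (dagger η x) : ℤ) = MvPolynomial.eval (fun i => (x i : ℤ)) P

/-- A weighted automaton over the semiring `S`, alphabet `α` and states `Q`. -/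
structure WeightedAutomaton (S α Q : Type*) where
  init : Q → S
  trans : α → Q → Q → S
  final : Q → S

/-- The series computed by a weighted automaton: the sum over all runs on `w` of the product of
the initial weight, the weights of the transitions taken, and the final weight. -/
def WeightedAutomaton.series {S Q : Type*} [CommSemiring S] [Fintype Q] [DecidableEq Q]
    (A : WeightedAutomaton S α Q) (w : List α) : S :=
  ∑ ρ : Fin (w.length + 1) → Q,
    A.init (ρ 0) * (∏ i : Fin w.length, A.trans (w.get i) (ρ i.castSucc) (ρ i.succ)) *
      A.final (ρ (Fin.last w.length))

/-- `ℕ`-rational series. -/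
def IsNRational (f : List α → ℕ) : Prop :=
  ∃ (n : ℕ) (A : WeightedAutomaton ℕ α (Fin n)), f = A.series

theorem finite_factorizations (n : ℕ) (w : List α) :
    {u : Fin n → List α | (List.ofFn u).flatten = w}.Finite := by
  refine (Set.Finite.pi' (fun _ : Fin n => List.finite_toSet w.sublists)).subset ?_
  intro u hu i
  have h : u i ∈ List.ofFn u := by simp [List.mem_ofFn]
  have h2 := List.sublist_flatten_of_mem h
  rw [Set.mem_ofPred_eq] at hu
  rw [hu] at h2
  simpa using h2

/-- The factorizations `w = u₁ ⋯ u_n` into `n` (possibly empty) words. -/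
noncomputable def factorizations (n : ℕ) (w : List α) : Finset (Fin n → List α) :=
  (finite_factorizations n w).toFinset

/-- The function `w ↦ ∑_{w = u₁ ⋯ u_{d+1}} π(μ(u₁), …, μ(u_{d+1}))`. -/
noncomputable def polyregularFun {M : Type*} [Monoid M] {d : ℕ} (μ : FreeMonoid α →* M)
    (π : (Fin (d + 1) → M) → ℕ) (w : List α) : ℕ :=
  ∑ u ∈ factorizations (d + 1) w, π fun i => μ (FreeMonoid.ofList (u i))

/-- Aperiodic monoids. -/
def IsAperiodic (M : Type*) [Monoid M] : Prop :=
  ∀ x : M, ∃ n : ℕ, x ^ (n + 1) = x ^ n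

/-- `ℕ`-polyregular functions. -/
def IsNPolyregular (f : List α → ℕ) : Prop :=
  ∃ (d : ℕ) (M : Type) (_ : Monoid M) (_ : Finite M) (μ : FreeMonoid α →* M)
    (π : (Fin (d + 1) → M) → ℕ), f = polyregularFun μ π

/-- Star-free `ℕ`-polyregular functions. -/
def IsStarFreeNPolyregular (f : List α → ℕ) : Prop :=
  ∃ (d : ℕ) (M : Type) (_ : Monoid M) (_ : Finite M) (μ : FreeMonoid α →* M)
    (π : (Fin (d + 1) → M) → ℕ), IsAperiodic M ∧ f = polyregularFun μ π

end Words

section Represented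

variable {k : ℕ} (P : MvPolynomial (Fin k) ℤ)

/-- `P` is represented by a (commutative) `ℕ`-rational series over some finite alphabet. -/
def RepresentedByNRational : Prop :=
  ∃ (α : Type) (_ : Finite α) (η : Fin k → α) (g : List α → ℕ),
    IsNRational g ∧ RepresentsVia η g P

/-- `P` is represented by a (commutative) `ℕ`-polyregular function over some finite alphabet. -/
def RepresentedByNPolyregular : Prop :=
  ∃ (α : Type) (_ : Finite α) (η : Fin k → α) (g : List α → ℕ),
    IsNPolyregular g ∧ RepresentsVia η g P

/-- `P` is represented by a (commutative) star-free `ℕ`-polyregular function over some finite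
alphabet. -/
def RepresentedByStarFree : Prop :=
  ∃ (α : Type) (_ : Finite α) (η : Fin k → α) (g : List α → ℕ),
    IsStarFreeNPolyregular g ∧ RepresentsVia η g P

end Represented

/-! ### Finite descriptions, for the effectiveness statements -/

/-- An integer polynomial given as a list of coefficients with exponent vectors. -/
abbrev PolyCode : Type := List (ℤ × List ℕ)

/-- The polynomial in `k` indeterminates written by a code. Missing exponents count as `0`,
and exponents of index `≥ k` are ignored. -/
noncomputable def PolyCode.toPoly (c : PolyCode) (k : ℕ) : MvPolynomial (Fin k) ℤ :=
  (c.map fun t => MvPolynomial.monomial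
    (Finsupp.equivFunOnFinite.symm fun i : Fin k => t.2.getD i 0) t.1).sum

/-- An `ℕ`-weighted automaton given by tables: the number of letters, the number of states,
the initial weights, the transition matrices (indexed by the letters) and the final weights. -/
abbrev WACode : Type := ℕ × ℕ × List ℕ × List (List (List ℕ)) × List ℕ

/-- The automaton described by the tables; missing entries count as `0`. -/
def WACode.toAutomaton (c : WACode) : WeightedAutomaton ℕ (Fin c.1) (Fin c.2.1) where
  init q := c.2.2.1.getD q 0
  trans a p q := ((c.2.2.2.1.getD a []).getD p []).getD q 0
  final q := c.2.2.2.2.getD q 0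

/-- An automaton together with a letter assignment `η`, written `[η(1), …, η(k)]`. -/
abbrev WARep : Type := WACode × List ℕ

/-- The automaton represents `P` through the given letter assignment. -/
def WARep.Represents (r : WARep) {k : ℕ} (P : MvPolynomial (Fin k) ℤ) : Prop :=
  ∃ η : Fin k → Fin r.1.1, r.2 = (List.ofFn fun i => (η i : ℕ)) ∧
    RepresentsVia η r.1.toAutomaton.series P

/-- An `ℕ`-polyregular function given by tables: the number of letters, the size of the monoid,
the degree `d`, the multiplication table of the monoid, the images of the letters, and the
production function (an association list from `(d+1)`-tuples to values). -/
abbrev PolyregCode : Type := ℕ × ℕ × ℕ × List (List ℕ) × List ℕ × List (List ℕ × ℕ)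

/-- The tables describe the monoid `M` (whose elements are numbered by `e`), the morphism `μ`
and the production function `π`, where unlisted tuples have the value `0`. -/
structure PolyregCode.Describes (c : PolyregCode) {M : Type} [Monoid M] (e : M ≃ Fin c.2.1)
    (μ : FreeMonoid (Fin c.1) →* M) (π : (Fin (c.2.2.1 + 1) → M) → ℕ) : Prop where
  mul_table : ∀ x y : M, (c.2.2.2.1.getD (e x) []).getD (e y) 0 = (e (x * y) : ℕ)
  letter_table : ∀ a : Fin c.1, c.2.2.2.2.1.getD a 0 = (e (μ (FreeMonoid.of a)) : ℕ)
  production_table : ∀ x : Fin (c.2.2.1 + 1) → M,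
    (c.2.2.2.2.2.lookup (List.ofFn fun i => (e (x i) : ℕ))).getD 0 = π x

/-- Tables of an `ℕ`-polyregular function, together with a letter assignment
`[η(1), …, η(k)]`. -/
abbrev PolyregRep : Type := PolyregCode × List ℕ

/-- The tables are those of an `ℕ`-polyregular function that represents `P` through the given
letter assignment. -/
def PolyregRep.Represents (r : PolyregRep) {k : ℕ} (P : MvPolynomial (Fin k) ℤ) : Prop :=
  ∃ (M : Type) (_ : Monoid M) (e : M ≃ Fin r.1.2.1) (μ : FreeMonoid (Fin r.1.1) →* M)
    (π : (Fin (r.1.2.2.1 + 1) → M) → ℕ) (η : Fin k → Fin r.1.1),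
    r.1.Describes e μ π ∧ r.2 = (List.ofFn fun i => (η i : ℕ)) ∧
      RepresentsVia η (polyregularFun μ π) P

/-- The same, with an aperiodic monoid. -/
def PolyregRep.StarFreeRepresents (r : PolyregRep) {k : ℕ} (P : MvPolynomial (Fin k) ℤ) : Prop :=
  ∃ (M : Type) (_ : Monoid M) (e : M ≃ Fin r.1.2.1) (μ : FreeMonoid (Fin r.1.1) →* M)
    (π : (Fin (r.1.2.2.1 + 1) → M) → ℕ) (η : Fin k → Fin r.1.1),
    IsAperiodic M ∧ r.1.Describes e μ π ∧ r.2 = (List.ofFn fun i => (η i : ℕ)) ∧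
      RepresentsVia η (polyregularFun μ π) P

end NPolyreg

open NPolyreg

/-!
The proof runs around the cycle `IsPolyStrNNeg → star-free → polyregular → rational →
IsPolyStrNNeg`, with iterated forward differences (`mdiff`) as the common language: differentiating
`m i` times in each direction `i` isolates the coefficient of a maximal monomial of exponent `m`,
up to a positive factor (`mdiff_polyFun_of_maximal`).

*From a polynomial of the class to a star-free function.* A polynomial all of whose maximal
monomials are positive is absolutely monotone far from the coordinate hyperplanes
(`exists_absMono_shift`). Applied to all the restrictions of `P`, this gives a threshold `T`
(`IsPolyStrNNeg.exists_threshold`): at the points `c` of `[0, T]^k`, the differences of `P` in the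
directions of the coordinates equal to `T` are non-negative. Read a word from left to right, and
keep the numbers `c` of occurrences of the letters, capped at `T`. When a letter `a` comes with
`c a = T`, the identity `g (x + e_a) = g x + (g (x + e_a) - g x)` offers two choices: to ignore this
letter, or to start a new factor at it and to continue with the difference of `g` in the direction
`a`. Hence `P` is a sum over factorizations of the differences of `P` at capped counts, which are
non-negative, and at most `deg P` of the choices can be of the second kind (`splitSum_scanSum`). The
first letters of the factors and the capped counts are computed by the aperiodic monoid `Summary`.

*From polyregular functions to automata.* An automaton guesses a factorization and keeps the values
of the factors in its state (`factorAutomaton_series`).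

*From an automaton to the class.* Here `P x = u A₁^{x₁} ⋯ A_k^{x_k} v` with matrices over `ℕ`. By
Dickson's lemma, `A_i^K ≤ A_i^(K + N)` for some `K` and some `N > 0`; taking the differences with
steps `N`, the coefficient of a maximal monomial becomes a product of non-negative matrices
(`isPolyStrNNeg_of_matrix`).

*Effectiveness.* Thresholds are recognized by a finite check, and a polynomial outside the class has
a refutation, a negative difference that is constant on a face, which is recognized by a finite
check too; a search for one or the other always ends (`exists_computable_threshold`), which decides
the class and yields the threshold that the star-free function needs. The tables of this function
and of the automaton of a polyregular function are primitive recursive. To recover `P` from an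
automaton with `n` states, note that its exponents are less than `n` by the theorem of Cayley and
Hamilton (`RepresentsVia.exponent_lt_card`); so `P` is determined by its values at the points with
coordinates less than `n`, and a multiple of `P` is found by a search for a solution of the
interpolation problem, which exists for every automaton (`exists_interpolates`).
-/

namespace NPolyreg

/-! ### Iterated forward differences in several variables -/

open fwdDiff in
/-- Forward differences of step `N` of the powers, on the natural numbers. -/
theorem fwdDiff_natCast_pow (N j : ℕ) :
    (fwdDiff N fun x : ℕ => (x : ℤ) ^ j) =
      ∑ i ∈ Finset.range j, ((j.choose i : ℤ) * (N : ℤ) ^ (j - i)) • fun x : ℕ => (x : ℤ) ^ i := by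
  ext x
  simp only [fwdDiff, Nat.cast_add, add_pow, Finset.sum_range_succ, Nat.sub_self, pow_zero,
    Nat.choose_self, Finset.sum_apply, Pi.smul_apply, smul_eq_mul]
  simp only [mul_one, Nat.cast_one, add_sub_cancel_right]
  exact Finset.sum_congr rfl fun i _ => by ring

theorem fwdDiff_iter_natCast_pow_of_lt (N : ℕ) {j n : ℕ} (h : j < n) :
    (fwdDiff N)^[n] (fun x : ℕ => (x : ℤ) ^ j) = 0 := by
  induction n generalizing j with
  | zero => omega
  | succ n ih =>
    rw [Function.iterate_succ_apply, fwdDiff_natCast_pow, fwdDiff_iter_finsetSum]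
    refine Finset.sum_eq_zero fun i hi => ?_
    rw [fwdDiff_iter_const_smul, ih (by have := Finset.mem_range.1 hi; omega), smul_zero]

theorem fwdDiff_iter_natCast_pow_self (N n : ℕ) :
    (fwdDiff N)^[n] (fun x : ℕ => (x : ℤ) ^ n) = fun _ => (N : ℤ) ^ n * (n.factorial : ℤ) := by
  induction n with
  | zero => simp
  | succ n ih =>
    rw [Function.iterate_succ_apply, fwdDiff_natCast_pow, fwdDiff_iter_finsetSum,
      Finset.sum_range_succ, Finset.sum_eq_zero, fwdDiff_iter_const_smul, ih]
    · ext x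
      simp [Nat.factorial_succ]
      ring
    · intro i hi
      rw [fwdDiff_iter_const_smul,
        fwdDiff_iter_natCast_pow_of_lt N (Finset.mem_range.1 hi), smul_zero]

theorem fwdDiff_iter_pow_matrix {R : Type*} [Ring R] (A : R) (N n x : ℕ) :
    (fwdDiff N)^[n] (fun y : ℕ => A ^ y) x = (A ^ N - 1) ^ n * A ^ x := by
  induction n generalizing x with
  | zero => simp
  | succ n ih =>
    rw [Function.iterate_succ_apply', fwdDiff, ih, ih, ← mul_sub, add_comm x N, pow_add, pow_succ,
      mul_assoc]
    congr 1
    rw [sub_mul, one_mul]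

section Mdiff

variable {k : ℕ}

/-- The iterated forward difference of `f` along the list of directions `L`, the step in the
direction `i` being `N i`. -/
def mdiff (N : Fin k → ℕ) : List (Fin k) → ((Fin k → ℕ) → ℤ) → (Fin k → ℕ) → ℤ
  | [], f, x => f x
  | i :: L, f, x => mdiff N L f (x + Pi.single i (N i)) - mdiff N L f x

theorem mdiff_congr {N : Fin k → ℕ} {L : List (Fin k)} {f g : (Fin k → ℕ) → ℤ}
    {x x' : Fin k → ℕ} (h : ∀ z : Fin k → ℕ, (∀ i, i ∉ L → z i = 0) → f (x + z) = g (x' + z)) :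
    mdiff N L f x = mdiff N L g x' := by
  induction L generalizing x x' with
  | nil => simpa [mdiff] using h 0 fun _ _ => rfl
  | cons a L ih =>
    simp only [mdiff]
    rw [ih (x' := x' + Pi.single a (N a)), ih (x' := x')]
    · exact fun z hz => h z fun i hi => hz i fun h' => hi (List.mem_cons_of_mem _ h')
    · intro z hz
      rw [add_assoc, add_assoc]
      refine h _ fun i hi => ?_
      have : i ≠ a := fun h' => hi (h' ▸ List.mem_cons_self)
      simp [this, hz i fun h' => hi (List.mem_cons_of_mem _ h')]

theorem mdiff_cons' (N : Fin k → ℕ) (a : Fin k) (L : List (Fin k)) (f : (Fin k → ℕ) → ℤ)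
    (x : Fin k → ℕ) :
    mdiff N (a :: L) f x = mdiff N L (fun y => f (y + Pi.single a (N a)) - f y) x := by
  induction L generalizing x with
  | nil => rfl
  | cons b L ih =>
    have h1 := ih x
    have h2 := ih (x + Pi.single b (N b))
    simp only [mdiff] at h1 h2 ⊢
    rw [← h1, ← h2, add_right_comm]
    ring

theorem mdiff_append (N : Fin k → ℕ) (L M : List (Fin k)) (f : (Fin k → ℕ) → ℤ) :
    mdiff N (L ++ M) f = mdiff N L (mdiff N M f) := by
  induction L with
  | nil => rfl
  | cons a L ih =>
    ext x
    simp only [List.cons_append, mdiff, ih]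

theorem mdiff_sum {ι : Type*} (N : Fin k → ℕ) (L : List (Fin k)) (s : Finset ι)
    (f : ι → (Fin k → ℕ) → ℤ) (x : Fin k → ℕ) :
    mdiff N L (fun y => ∑ i ∈ s, f i y) x = ∑ i ∈ s, mdiff N L (f i) x := by
  induction L generalizing x with
  | nil => rfl
  | cons a L ih => simp only [mdiff, ih, Finset.sum_sub_distrib]

theorem mdiff_const_mul (N : Fin k → ℕ) (L : List (Fin k)) (c : ℤ)
    (f : (Fin k → ℕ) → ℤ) (x : Fin k → ℕ) :
    mdiff N L (fun y => c * f y) x = c * mdiff N L f x := by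
  induction L generalizing x with
  | nil => rfl
  | cons a L ih => simp only [mdiff, ih, mul_sub]

theorem mdiff_add (N : Fin k → ℕ) (L : List (Fin k)) (f g : (Fin k → ℕ) → ℤ) (x : Fin k → ℕ) :
    mdiff N L (fun y => f y + g y) x = mdiff N L f x + mdiff N L g x := by
  induction L generalizing x with
  | nil => rfl
  | cons a L ih => simp only [mdiff, ih]; ring

theorem mdiff_shift (N : Fin k → ℕ) (L : List (Fin k)) (f : (Fin k → ℕ) → ℤ) (v x : Fin k → ℕ) :
    mdiff N L (fun y => f (y + v)) x = mdiff N L f (x + v) := by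
  induction L generalizing x with
  | nil => rfl
  | cons a L ih => simp only [mdiff, ih, add_right_comm]

/-- Iterated differences of a multilinear expression in functions of one variable each: every
factor is differentiated as often as its direction occurs. -/
theorem mdiff_multilinear {E : Fin k → Type*} [∀ i, AddCommGroup (E i)]
    (Φ : MultilinearMap ℤ E ℤ) (F : ∀ i, ℕ → E i) (N : Fin k → ℕ) (L : List (Fin k))
    (x : Fin k → ℕ) :
    mdiff N L (fun y => Φ fun i => F i (y i)) x =
      Φ fun i => (fwdDiff (N i))^[L.count i] (F i) (x i) := by
  classical
  induction L generalizing x with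
  | nil => simp [mdiff]
  | cons a L ih =>
    simp only [mdiff, ih]
    set G : ∀ i, ℕ → E i := fun i => (fwdDiff (N i))^[L.count i] (F i) with hG
    have h1 : (fun i => G i ((x + Pi.single a (N a) : Fin k → ℕ) i)) =
        Function.update (fun i => G i (x i)) a (G a (x a + N a)) := by
      ext i
      by_cases h : i = a
      · subst h; simp
      · simp [h]
    have h2 : (fun i => G i (x i)) = Function.update (fun i => G i (x i)) a (G a (x a)) := by simp
    change Φ (fun i => G i ((x + Pi.single a (N a) : Fin k → ℕ) i)) - Φ (fun i => G i (x i)) = _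
    rw [h1]
    nth_rewrite 2 [h2]
    rw [← Φ.map_update_sub]
    congr 1
    ext i
    by_cases h : i = a
    · subst h
      simp only [Function.update_self, List.count_cons_self, Function.iterate_succ_apply']
      simp [hG, fwdDiff]
    · rw [Function.update_of_ne h, List.count_cons_of_ne (Ne.symm h)]

/-- The iterated difference of a monomial function. -/
theorem mdiff_monomial (N : Fin k → ℕ) (L : List (Fin k)) (m : Fin k → ℕ) (x : Fin k → ℕ) :
    mdiff N L (fun y => ∏ i, (y i : ℤ) ^ m i) x =
      ∏ i, (fwdDiff (N i))^[L.count i] (fun t : ℕ => (t : ℤ) ^ m i) (x i) := by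
  have := mdiff_multilinear (MultilinearMap.mkPiAlgebra ℤ (Fin k) ℤ)
    (fun i (t : ℕ) => (t : ℤ) ^ m i) N L x
  simpa using this

theorem mdiff_monomial_eq_zero (N : Fin k → ℕ) {L : List (Fin k)} {m : Fin k → ℕ} {i : Fin k}
    (h : m i < L.count i) (x : Fin k → ℕ) :
    mdiff N L (fun y => ∏ i, (y i : ℤ) ^ m i) x = 0 := by
  rw [mdiff_monomial]
  refine Finset.prod_eq_zero (Finset.mem_univ i) ?_
  rw [fwdDiff_iter_natCast_pow_of_lt _ h]
  rfl

theorem mdiff_monomial_self (N : Fin k → ℕ) {L : List (Fin k)} {m : Fin k → ℕ}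
    (h : ∀ i, L.count i = m i) (x : Fin k → ℕ) :
    mdiff N L (fun y => ∏ i, (y i : ℤ) ^ m i) x =
      ∏ i, ((N i : ℤ) ^ m i * ((m i).factorial : ℤ)) := by
  rw [mdiff_monomial]
  refine Finset.prod_congr rfl fun i _ => ?_
  rw [h i, fwdDiff_iter_natCast_pow_self]

/-- The list of directions in which `i` occurs `m i` times. -/
noncomputable def directions (m : Fin k → ℕ) : List (Fin k) :=
  (List.finRange k).flatMap fun i => List.replicate (m i) i

theorem count_directions (m : Fin k → ℕ) (i : Fin k) : (directions m).count i = m i := by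
  classical
  rw [directions, List.count_flatMap]
  simp only [Function.comp_def, List.count_replicate]
  rw [List.sum_map_eq_nsmul_single i]
  · simp [List.nodup_finRange, List.count_eq_one_of_mem]
  · intro j hj _
    simp [hj]

/-- The function on tuples of natural numbers given by an integer polynomial. -/
noncomputable def polyFun (P : MvPolynomial (Fin k) ℤ) (x : Fin k → ℕ) : ℤ :=
  MvPolynomial.eval (fun i => (x i : ℤ)) P

theorem polyFun_eq_sum (P : MvPolynomial (Fin k) ℤ) :
    polyFun P = fun x => ∑ m ∈ P.support, P.coeff m * ∏ i, (x i : ℤ) ^ m i := by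
  ext x
  rw [polyFun, MvPolynomial.eval_eq']

theorem mdiff_polyFun (P : MvPolynomial (Fin k) ℤ) (N : Fin k → ℕ) (L : List (Fin k))
    (x : Fin k → ℕ) :
    mdiff N L (polyFun P) x =
      ∑ m ∈ P.support, P.coeff m * mdiff N L (fun y => ∏ i, (y i : ℤ) ^ m i) x := by
  rw [polyFun_eq_sum, mdiff_sum]
  simp only [mdiff_const_mul]

/-- If `m` is maximal among the exponents of `P`, then differentiating `m i` times in each
direction `i` isolates the coefficient of `m`. -/
theorem mdiff_polyFun_of_maximal {P : MvPolynomial (Fin k) ℤ} {m : Fin k →₀ ℕ}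
    (hm : Maximal (· ∈ P.support) m) (N : Fin k → ℕ) (x : Fin k → ℕ) :
    mdiff N (directions m) (polyFun P) x =
      P.coeff m * ∏ i, ((N i : ℤ) ^ m i * ((m i).factorial : ℤ)) := by
  rw [mdiff_polyFun, Finset.sum_eq_single m, mdiff_monomial_self N (count_directions _)]
  · intro m' hm' hne
    have : ¬ m ≤ m' := fun h => hne (le_antisymm (hm.2 hm' h) h)
    rw [Finsupp.le_def] at this
    push Not at this
    obtain ⟨i, hi⟩ := this
    rw [mdiff_monomial_eq_zero N (i := i) (by rwa [count_directions]), mul_zero]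
  · intro h
    exact absurd hm.1 h

/-- More differences than the degree give zero. -/
theorem mdiff_polyFun_eq_zero {P : MvPolynomial (Fin k) ℤ} {d : ℕ}
    (hd : ∀ m ∈ P.support, ∑ i, m i ≤ d) (N : Fin k → ℕ) {L : List (Fin k)} (hL : d < L.length)
    (x : Fin k → ℕ) : mdiff N L (polyFun P) x = 0 := by
  rw [mdiff_polyFun]
  refine Finset.sum_eq_zero fun m hm => ?_
  have h1 : ∑ i, L.count i = L.length := by
    have := Multiset.sum_count_eq_card (s := (Finset.univ : Finset (Fin k)))
      (m := (L : Multiset (Fin k))) (fun a _ => Finset.mem_univ a)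
    simpa using this
  have : ∃ i, m i < L.count i := by
    by_contra! h
    have := Finset.sum_le_sum fun i (_ : i ∈ Finset.univ) => h i
    have := hd m hm
    omega
  obtain ⟨i, hi⟩ := this
  rw [mdiff_monomial_eq_zero N hi, mul_zero]

end Mdiff

/-! ### Absolutely monotone functions and thresholds -/

section Threshold

variable {k : ℕ}

/-- Functions all of whose iterated forward differences (with unit steps) are non-negative. -/
def AbsMono (f : (Fin k → ℕ) → ℤ) : Prop := ∀ L x, 0 ≤ mdiff 1 L f x

theorem AbsMono.add {f g : (Fin k → ℕ) → ℤ} (hf : AbsMono f) (hg : AbsMono g) :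
    AbsMono fun x => f x + g x := fun L x => by
  rw [mdiff_add]
  exact add_nonneg (hf L x) (hg L x)

theorem AbsMono.const {c : ℤ} (hc : 0 ≤ c) : AbsMono fun _ : Fin k → ℕ => c := by
  intro L x
  cases L with
  | nil => exact hc
  | cons a L =>
    rw [mdiff]
    rw [mdiff_congr (f := fun _ => c) (g := fun _ => c) (x' := x) fun _ _ => rfl, sub_self]

theorem AbsMono.sum {ι : Type*} {s : Finset ι} {f : ι → (Fin k → ℕ) → ℤ}
    (hf : ∀ i ∈ s, AbsMono (f i)) : AbsMono fun x => ∑ i ∈ s, f i x := fun L x => by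
  rw [mdiff_sum]
  exact Finset.sum_nonneg fun i hi => hf i hi L x

theorem AbsMono.shift {f : (Fin k → ℕ) → ℤ} (hf : AbsMono f) (v : Fin k → ℕ) :
    AbsMono fun x => f (x + v) := fun L x => by
  rw [mdiff_shift]
  exact hf L _

theorem AbsMono.mul {f g : (Fin k → ℕ) → ℤ} (hf : AbsMono f) (hg : AbsMono g) :
    AbsMono fun x => f x * g x := by
  intro L
  induction L generalizing f g with
  | nil => exact fun x => mul_nonneg (hf [] x) (hg [] x)
  | cons a L ih =>
    intro x
    set e : Fin k → ℕ := Pi.single a 1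
    have hf' : AbsMono fun y => f (y + e) - f y := fun M y => by
      have := hf (a :: M) y
      rwa [mdiff_cons'] at this
    have hg' : AbsMono fun y => g (y + e) - g y := fun M y => by
      have := hg (a :: M) y
      rwa [mdiff_cons'] at this
    rw [mdiff_cons']
    -- the Leibniz rule
    have : (fun y : Fin k → ℕ => f (y + e) * g (y + e) - f y * g y) =
        fun y => (f (y + e) - f y) * g (y + e) + f y * (g (y + e) - g y) := by
      ext y
      ring
    change 0 ≤ mdiff 1 L (fun y : Fin k → ℕ => f (y + e) * g (y + e) - f y * g y) x
    rw [this, mdiff_add]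
    exact add_nonneg (ih hf' (hg.shift e) x) (ih hf hg' x)

theorem AbsMono.const_mul {f : (Fin k → ℕ) → ℤ} (hf : AbsMono f) {c : ℤ} (hc : 0 ≤ c) :
    AbsMono fun x => c * f x := (AbsMono.const hc).mul hf

theorem AbsMono.coord (i : Fin k) : AbsMono fun x : Fin k → ℕ => (x i : ℤ) := by
  intro L x
  cases L with
  | nil => exact Int.natCast_nonneg _
  | cons a L =>
    rw [mdiff_cons']
    have : (fun y : Fin k → ℕ =>
        (((y + (Pi.single a ((1 : Fin k → ℕ) a) : Fin k → ℕ)) i : ℕ) : ℤ) - (y i : ℤ)) =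
        fun _ => (((Pi.single a 1 : Fin k → ℕ) i : ℕ) : ℤ) := by
      ext y
      simp
    rw [this]
    exact AbsMono.const (Int.natCast_nonneg _) L x

theorem AbsMono.mul_sub {f g : (Fin k → ℕ) → ℤ} {a b : ℤ} (ha : 0 ≤ a) (hb : 0 ≤ b)
    (hf : AbsMono fun x => f x - a) (hg : AbsMono fun x => g x - b) :
    AbsMono fun x => f x * g x - a * b := by
  have : (fun x => f x * g x - a * b) =
      fun x => (f x - a) * (g x - b) + (a * (g x - b) + b * (f x - a)) := by
    ext x
    ring
  rw [this]
  exact (hf.mul hg).add ((hg.const_mul ha).add (hf.const_mul hb))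

/-- The monomial of exponent `m` in the indeterminates translated by `K`. -/
def shiftedMonomial (K : ℕ) (m : Fin k → ℕ) (x : Fin k → ℕ) : ℤ := ∏ i, ((x i : ℤ) + K) ^ m i

theorem shiftedMonomial_absMono_sub (K : ℕ) (m : Fin k → ℕ) :
    AbsMono fun x => shiftedMonomial K m x - ∏ i, (K : ℤ) ^ m i := by
  have hpow : ∀ (i : Fin k) (n : ℕ),
      AbsMono fun x : Fin k → ℕ => ((x i : ℤ) + K) ^ n - (K : ℤ) ^ n := by
    intro i n
    induction n with
    | zero => simpa using AbsMono.const (k := k) le_rfl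
    | succ n ih =>
      simp only [pow_succ]
      refine AbsMono.mul_sub (by positivity) (by positivity) ih ?_
      simpa using AbsMono.coord i
  unfold shiftedMonomial
  induction (Finset.univ : Finset (Fin k)) using Finset.induction_on with
  | empty => simpa using AbsMono.const (k := k) le_rfl
  | insert i s hi ih =>
    simp only [Finset.prod_insert hi]
    exact AbsMono.mul_sub (by positivity) (Finset.prod_nonneg fun _ _ => by positivity)
      (hpow i _) ih

theorem shiftedMonomial_absMono (K : ℕ) (m : Fin k → ℕ) : AbsMono (shiftedMonomial K m) := by
  have h := (shiftedMonomial_absMono_sub K m).add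
    (AbsMono.const (c := ∏ i, (K : ℤ) ^ m i) (Finset.prod_nonneg fun _ _ => by positivity))
  simpa using h

theorem shiftedMonomial_absMono_sub_of_ne_zero {K : ℕ} (hK : 1 ≤ K) {m : Fin k → ℕ}
    {i : Fin k} (hi : m i ≠ 0) : AbsMono fun x => shiftedMonomial K m x - K := by
  have hle : (K : ℤ) ≤ ∏ i, (K : ℤ) ^ m i := by
    rw [Finset.prod_pow_eq_pow_sum]
    refine le_self_pow₀ (by exact_mod_cast hK) ?_
    have := Finset.single_le_sum (f := m) (fun _ _ => Nat.zero_le _) (Finset.mem_univ i)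
    omega
  have h := (shiftedMonomial_absMono_sub K m).add
    (AbsMono.const (c := ∏ i, (K : ℤ) ^ m i - K) (by linarith))
  simpa using h

/-- A polynomial whose maximal monomials are all positive is absolutely monotone far enough from
the coordinate hyperplanes: every other monomial strictly divides a maximal one, which outweighs
it. -/
theorem exists_absMono_shift {Q : MvPolynomial (Fin k) ℤ}
    (hQ : ∀ m, Maximal (· ∈ Q.support) m → 0 < Q.coeff m) :
    ∃ K : ℕ, AbsMono fun x => polyFun Q fun i => x i + K := by
  classical
  set S := Q.support
  set n := S.card
  have hmax : ∀ m ∈ S, ∃ M, m ≤ M ∧ Maximal (· ∈ S) M := fun m hm => S.exists_le_maximal hm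
  set top := S.filter fun m => Maximal (· ∈ S) m
  set K : ℕ := 1 + n * ∑ m ∈ S, (Q.coeff m).natAbs with hKdef
  refine ⟨K, ?_⟩
  have hbound : ∀ m ∈ S, 0 ≤ (K : ℤ) + n * Q.coeff m := by
    intro m hm
    have h1 : (Q.coeff m).natAbs ≤ ∑ m ∈ S, (Q.coeff m).natAbs :=
      Finset.single_le_sum (f := fun m => (Q.coeff m).natAbs) (fun _ _ => Nat.zero_le _) hm
    have h2 : n * (Q.coeff m).natAbs ≤ K := by
      rw [hKdef]
      have := Nat.mul_le_mul_left n h1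
      omega
    have h3 : (n : ℤ) * |Q.coeff m| ≤ K := by
      rw [Int.abs_eq_natAbs]
      exact_mod_cast h2
    have h4 : (n : ℤ) * (-|Q.coeff m|) ≤ n * Q.coeff m :=
      mul_le_mul_of_nonneg_left (neg_abs_le _) (Int.natCast_nonneg _)
    linarith
  have htop : ∀ M ∈ top, AbsMono fun x => Q.coeff M * shiftedMonomial K M x := fun M hM =>
    (shiftedMonomial_absMono K M).const_mul (hQ M (Finset.mem_filter.1 hM).2).le
  -- after multiplication by the number of monomials, each of them gets its own copy of the sum of
  -- the maximal ones
  have key : AbsMono fun x => (n : ℤ) * polyFun Q fun i => x i + K := by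
    have hrw : (fun x => (n : ℤ) * polyFun Q fun i => x i + K) = fun x => ∑ m ∈ S,
        (∑ M ∈ top, Q.coeff M * shiftedMonomial K M x +
          if m ∈ top then 0 else (n : ℤ) * Q.coeff m * shiftedMonomial K m x) := by
      ext x
      rw [polyFun_eq_sum, Finset.sum_add_distrib, Finset.sum_const, nsmul_eq_mul]
      have h1 : ∑ m ∈ S, Q.coeff m * ∏ i, ((x i + K : ℕ) : ℤ) ^ m i =
          ∑ m ∈ top, Q.coeff m * shiftedMonomial K m x +
            ∑ m ∈ S, if m ∈ top then 0 else Q.coeff m * shiftedMonomial K m x := by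
        have h2 : ∑ m ∈ top, Q.coeff m * shiftedMonomial K m x =
            ∑ m ∈ S, if m ∈ top then Q.coeff m * shiftedMonomial K m x else 0 := by
          rw [← Finset.sum_filter]
          refine Finset.sum_congr ?_ fun _ _ => rfl
          ext m
          simp [top]
        rw [h2, ← Finset.sum_add_distrib]
        refine Finset.sum_congr rfl fun m _ => ?_
        split_ifs <;> simp [shiftedMonomial]
      change (n : ℤ) * ∑ m ∈ S, Q.coeff m * ∏ i, ((x i + K : ℕ) : ℤ) ^ m i = _
      rw [h1, mul_add, Finset.mul_sum (s := S)]
      congr 1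
      refine Finset.sum_congr rfl fun m _ => ?_
      split_ifs <;> ring
    rw [hrw]
    refine AbsMono.sum fun m hm => ?_
    by_cases hmt : m ∈ top
    · simp only [hmt, if_true, add_zero]
      exact AbsMono.sum htop
    · simp only [hmt, if_false]
      obtain ⟨M, hle, hM⟩ := hmax m hm
      have hMt : M ∈ top := Finset.mem_filter.2 ⟨hM.1, hM⟩
      have hne : m ≠ M := fun h => hmt (h ▸ hMt)
      obtain ⟨i, hi⟩ : ∃ i, m i ≠ M i := by
        by_contra! h
        exact hne (Finsupp.ext h)
      have hc : 1 ≤ Q.coeff M := hQ M hM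
      have hsplit : (fun x => ∑ M ∈ top, Q.coeff M * shiftedMonomial K M x +
            (n : ℤ) * Q.coeff m * shiftedMonomial K m x) =
          fun x => ∑ M ∈ top.erase M, Q.coeff M * shiftedMonomial K M x +
            shiftedMonomial K m x * (Q.coeff M * (shiftedMonomial K (⇑(M - m)) x - K) +
              (Q.coeff M * K + n * Q.coeff m)) := by
        ext x
        rw [← Finset.add_sum_erase _ _ hMt]
        have : shiftedMonomial K M x = shiftedMonomial K m x * shiftedMonomial K (⇑(M - m)) x := by
          rw [shiftedMonomial, shiftedMonomial, shiftedMonomial, ← Finset.prod_mul_distrib]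
          refine Finset.prod_congr rfl fun j _ => ?_
          rw [← pow_add, Finsupp.coe_tsub, Pi.sub_apply, Nat.add_sub_cancel' (hle j)]
        rw [this]
        ring
      rw [hsplit]
      refine (AbsMono.sum fun M' hM' => htop M' (Finset.mem_of_mem_erase hM')).add
        ((shiftedMonomial_absMono K m).mul (AbsMono.add (AbsMono.const_mul ?_ (by linarith))
          (AbsMono.const ?_)))
      · refine shiftedMonomial_absMono_sub_of_ne_zero (by omega) (i := i) ?_
        have := hle i
        rw [Finsupp.coe_tsub, Pi.sub_apply]
        omega
      · have := hbound m hm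
        nlinarith [Int.natCast_nonneg K]
  intro L x
  have h := key L x
  rw [mdiff_const_mul] at h
  rcases Nat.eq_zero_or_pos n with h0 | h0
  · have : S = ∅ := Finset.card_eq_zero.1 h0
    have hz : polyFun Q = fun _ => 0 := by
      rw [polyFun_eq_sum]
      change (fun x => ∑ m ∈ S, _) = _
      simp [this]
    simp only [hz]
    exact AbsMono.const le_rfl L x
  · exact nonneg_of_mul_nonneg_right h (by exact_mod_cast h0)

/-! ### Maximal monomials -/

theorem dividesOverRat_monomial {m m' : Fin k →₀ ℕ} {c c' : ℤ} (hc : c ≠ 0) (hc' : c' ≠ 0) :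
    DividesOverRat (MvPolynomial.monomial m c) (MvPolynomial.monomial m' c') ↔ m ≤ m' := by
  rw [DividesOverRat, MvPolynomial.map_monomial, MvPolynomial.map_monomial,
    MvPolynomial.monomial_dvd_monomial]
  have h1 : (Int.castRingHom ℚ) c ≠ 0 := by simpa using hc
  have h2 : (Int.castRingHom ℚ) c' ≠ 0 := by simpa using hc'
  constructor
  · rintro ⟨h | h, -⟩
    · exact absurd h h2
    · exact h
  · exact fun h => ⟨Or.inr h, (Ne.isUnit h1).dvd⟩

theorem isNonNegative_monomial {m : Fin k →₀ ℕ} {c : ℤ} :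
    IsNonNegative (MvPolynomial.monomial m c) ↔ 0 ≤ c := by
  constructor
  · intro h
    simpa [MvPolynomial.eval_monomial] using h fun _ => 1
  · intro h n
    rw [MvPolynomial.eval_monomial]
    exact mul_nonneg h (Finset.prod_nonneg fun _ _ => by positivity)

theorem isMaximalMonomial_iff {S P : MvPolynomial (Fin k) ℤ} :
    IsMaximalMonomial S P ↔
      ∃ m, Maximal (· ∈ P.support) m ∧ S = MvPolynomial.monomial m (P.coeff m) := by
  constructor
  · rintro ⟨⟨m, hm, rfl⟩, h⟩
    refine ⟨m, ⟨hm, fun m' hm' hle => ?_⟩, rfl⟩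
    have h0 := MvPolynomial.mem_support_iff.1 hm
    have h0' := MvPolynomial.mem_support_iff.1 hm'
    exact (dividesOverRat_monomial h0' h0).1
      (h _ ⟨m', hm', rfl⟩ ((dividesOverRat_monomial h0 h0').2 hle))
  · rintro ⟨m, hm, rfl⟩
    refine ⟨⟨m, hm.1, rfl⟩, ?_⟩
    rintro T ⟨m', hm', rfl⟩ h
    have h0 := MvPolynomial.mem_support_iff.1 hm.1
    have h0' := MvPolynomial.mem_support_iff.1 hm'
    exact (dividesOverRat_monomial h0' h0).2 (hm.2 hm' ((dividesOverRat_monomial h0 h0').1 h))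

theorem isPolyStrNNeg_iff {P : MvPolynomial (Fin k) ℤ} :
    IsPolyStrNNeg P ↔ ∀ ν : Fin k → Option ℕ, ∀ m,
      Maximal (· ∈ (restrict P ν).support) m → 0 < (restrict P ν).coeff m := by
  constructor
  · intro h ν m hm
    have h1 := isNonNegative_monomial.1 (h ν _ (isMaximalMonomial_iff.2 ⟨m, hm, rfl⟩))
    exact lt_of_le_of_ne h1 (Ne.symm (MvPolynomial.mem_support_iff.1 hm.1))
  · intro h ν S hS
    obtain ⟨m, hm, rfl⟩ := isMaximalMonomial_iff.1 hS
    exact isNonNegative_monomial.2 (h ν m hm).le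

theorem polyFun_restrict (P : MvPolynomial (Fin k) ℤ) (ν : Fin k → Option ℕ) (x : Fin k → ℕ) :
    polyFun (restrict P ν) x = polyFun P fun i => (ν i).getD (x i) := by
  rw [polyFun, restrict, MvPolynomial.eval, MvPolynomial.eval₂Hom_bind₁, polyFun,
    MvPolynomial.eval]
  congr 2
  ext i
  cases h : ν i <;> simp

/-! ### The threshold criterion -/

/-- `T` is a threshold for `P` if at every point of the box `[0, T]^k`, the differences of `P` in
the directions of the coordinates equal to `T` are non-negative. -/
def IsThreshold (P : MvPolynomial (Fin k) ℤ) (T : ℕ) : Prop :=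
  ∀ c : Fin k → ℕ, (∀ i, c i ≤ T) → ∀ L : List (Fin k), (∀ i ∈ L, c i = T) →
    0 ≤ mdiff 1 L (polyFun P) c

/-- On each face, where the coordinates outside `U` are frozen, the differences of a polynomial of
the class `PolyStrNNeg` are non-negative far enough. -/
theorem IsPolyStrNNeg.exists_face_bound {P : MvPolynomial (Fin k) ℤ} (hP : IsPolyStrNNeg P)
    (U : Finset (Fin k)) (ν : Fin k → ℕ) :
    ∃ K : ℕ, ∀ x : Fin k → ℕ, (∀ i ∉ U, x i = ν i) → (∀ i ∈ U, K ≤ x i) →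
      ∀ L : List (Fin k), (∀ i ∈ L, i ∈ U) → 0 ≤ mdiff 1 L (polyFun P) x := by
  classical
  set ν' : Fin k → Option ℕ := fun i => if i ∈ U then none else some (ν i)
  obtain ⟨K, hK⟩ := exists_absMono_shift (isPolyStrNNeg_iff.1 hP ν')
  refine ⟨K, fun x hx hxK L hL => ?_⟩
  have h := hK L fun i => if i ∈ U then x i - K else 0
  convert h using 1
  refine mdiff_congr fun z hz => ?_
  rw [polyFun_restrict]
  congr 1
  ext i
  by_cases hi : i ∈ U
  · have := hxK i hi
    simp [ν', hi]
    omega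
  · simp [ν', hi, hx i hi, hz i fun h => hi (hL i h)]

/-- Every polynomial of the class has a threshold. By induction on the set `U` of coordinates that
are not frozen: a point with all the coordinates of `U` large is covered by `exists_face_bound`, and
each of the finitely many other values of a coordinate is frozen in turn. -/
theorem IsPolyStrNNeg.exists_threshold {P : MvPolynomial (Fin k) ℤ} (hP : IsPolyStrNNeg P) :
    ∃ T, IsThreshold P T := by
  classical
  suffices H : ∀ (U : Finset (Fin k)) (ν : Fin k → ℕ), ∃ T₀ : ℕ, ∀ T, T₀ ≤ T →
      ∀ c : Fin k → ℕ, (∀ i ∉ U, c i = ν i) → (∀ i ∈ U, c i ≤ T) →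
        ∀ L : List (Fin k), (∀ i ∈ L, i ∈ U ∧ c i = T) → 0 ≤ mdiff 1 L (polyFun P) c by
    obtain ⟨T, hT⟩ := H Finset.univ 0
    exact ⟨T, fun c hc L hL => hT T le_rfl c (by simp) (fun i _ => hc i) L
      fun i hi => ⟨Finset.mem_univ i, hL i hi⟩⟩
  intro U
  induction U using Finset.strongInduction with
  | H U ih =>
    intro ν
    obtain ⟨K, hK⟩ := hP.exists_face_bound U ν
    -- points with a coordinate `i` equal to some `j < K` lie on a smaller face
    choose! B hB using fun (i : Fin k) (hi : i ∈ U) (j : ℕ) =>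
      ih (U.erase i) (Finset.erase_ssubset hi) (Function.update ν i j)
    refine ⟨K + ∑ i ∈ U, ∑ j ∈ Finset.range K, B i j, fun T hT c hc hcT L hL => ?_⟩
    by_cases hall : ∀ i ∈ U, K ≤ c i
    · exact hK c hc hall L fun i hi => (hL i hi).1
    · push Not at hall
      obtain ⟨i, hi, hlt⟩ := hall
      have h1 : B i (c i) ≤ ∑ j ∈ Finset.range K, B i j :=
        Finset.single_le_sum (f := B i) (fun _ _ => Nat.zero_le _) (Finset.mem_range.2 hlt)
      have h2 : ∑ j ∈ Finset.range K, B i j ≤ ∑ i ∈ U, ∑ j ∈ Finset.range K, B i j :=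
        Finset.single_le_sum (f := fun i => ∑ j ∈ Finset.range K, B i j)
          (fun _ _ => Nat.zero_le _) hi
      refine hB i hi (c i) T (by omega) c ?_ (fun j hj => hcT j (Finset.mem_of_mem_erase hj)) L ?_
      · intro j hj
        by_cases hji : j = i
        · subst hji; simp
        · rw [Function.update_of_ne hji]
          exact hc j fun h => hj (Finset.mem_erase.2 ⟨hji, h⟩)
      · intro j hj
        obtain ⟨h3, h4⟩ := hL j hj
        refine ⟨Finset.mem_erase.2 ⟨?_, h3⟩, h4⟩
        rintro rfl
        omega

end Threshold

/-! ### Refutations of membership in the class -/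

section Refutation

variable {k : ℕ}

theorem mdiff_const (N : Fin k → ℕ) {L : List (Fin k)} (hL : L ≠ []) (c : ℤ) (x : Fin k → ℕ) :
    mdiff N L (fun _ => c) x = 0 := by
  cases L with
  | nil => exact absurd rfl hL
  | cons a L =>
    rw [mdiff, mdiff_congr (f := fun _ => c) (g := fun _ => c) (x' := x) fun _ _ => rfl, sub_self]

theorem mdiff_eq_zero_of_mem {N : Fin k → ℕ} {L : List (Fin k)} {i : Fin k} (hi : i ∈ L)
    {f : (Fin k → ℕ) → ℤ} (hf : ∀ y, f (y + Pi.single i (N i)) = f y) (x : Fin k → ℕ) :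
    mdiff N L f x = 0 := by
  induction L generalizing x with
  | nil => simp at hi
  | cons a L ih =>
    rw [mdiff]
    rcases eq_or_ne i a with rfl | h
    · rw [← mdiff_shift]
      simp only [hf, sub_self]
    · have hi' : i ∈ L := (List.mem_cons.1 hi).resolve_left h
      rw [ih hi', ih hi', sub_self]

/-- If all the differences of `g` in directions of `U` vanish at a point, then `g` is constant on
the corresponding face. -/
theorem eq_of_mdiff_eq_zero {U : Finset (Fin k)} {g : (Fin k → ℕ) → ℤ} {x : Fin k → ℕ}
    (h : ∀ M : List (Fin k), M ≠ [] → (∀ i ∈ M, i ∈ U) → mdiff 1 M g x = 0)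
    {y : Fin k → ℕ} (hy : ∀ i ∉ U, y i = 0) : g (x + y) = g x := by
  classical
  suffices H : ∀ (n : ℕ) (y : Fin k → ℕ), ∑ i, y i = n → (∀ i ∉ U, y i = 0) →
      (∀ M : List (Fin k), M ≠ [] → (∀ i ∈ M, i ∈ U) → mdiff 1 M g (x + y) = 0) ∧
        g (x + y) = g x from (H _ y rfl hy).2
  intro n
  induction n with
  | zero =>
    intro y hy _
    have : y = 0 := funext fun i => (Finset.sum_eq_zero_iff.1 hy) i (Finset.mem_univ i)
    subst this
    exact ⟨by simpa using h, by simp⟩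
  | succ n ih =>
    intro y hy hU
    obtain ⟨i, hi⟩ : ∃ i, y i ≠ 0 := by
      by_contra! h0
      simp [h0] at hy
    have hiU : i ∈ U := by
      by_contra h0
      exact hi (hU i h0)
    obtain ⟨z, rfl⟩ : ∃ z : Fin k → ℕ, y = z + Pi.single i 1 := by
      refine ⟨Function.update y i (y i - 1), funext fun j => ?_⟩
      rcases eq_or_ne j i with rfl | hj
      · simp; omega
      · simp [hj]
    obtain ⟨h1, h2⟩ := ih z (by simpa [Finset.sum_add_distrib] using hy) fun j hj => by
      have := hU j hj
      simp only [Pi.add_apply] at this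
      omega
    rw [← add_assoc]
    refine ⟨fun M hM hMU => ?_, ?_⟩
    · have h3 := h1 (i :: M) (by simp) (by simpa using ⟨hiU, hMU⟩)
      rw [mdiff, h1 M hM hMU, sub_zero] at h3
      exact h3
    · have h3 := h1 [i] (by simp) (by simpa using hiU)
      simp only [mdiff] at h3
      rw [← h2]
      exact sub_eq_zero.1 h3

/-- A refutation of membership of `P` in `PolyStrNNeg`: on the face through `x` with free
coordinates in `U`, the iterated difference of `P` along `L` is constant and negative. -/
def IsRefutation (P : MvPolynomial (Fin k) ℤ) (x : Fin k → ℕ) (U : Finset (Fin k))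
    (L : List (Fin k)) : Prop :=
  (∀ i ∈ L, i ∈ U) ∧ mdiff 1 L (polyFun P) x < 0 ∧
    ∀ M : List (Fin k), M ≠ [] → (∀ i ∈ M, i ∈ U) → mdiff 1 (M ++ L) (polyFun P) x = 0

/-- A refutation contradicts the bound on its face, where the difference is constant. -/
theorem IsRefutation.not_isPolyStrNNeg {P : MvPolynomial (Fin k) ℤ} {x : Fin k → ℕ}
    {U : Finset (Fin k)} {L : List (Fin k)} (h : IsRefutation P x U L) : ¬ IsPolyStrNNeg P := by
  classical
  intro hP
  obtain ⟨h1, h2, h3⟩ := h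
  obtain ⟨K, hK⟩ := hP.exists_face_bound U x
  have h4 := hK (x + fun i => if i ∈ U then K else 0) (fun i hi => by simp [hi])
    (fun i hi => by simp [hi]) L h1
  rw [eq_of_mdiff_eq_zero (g := mdiff 1 L (polyFun P)) (U := U)] at h4
  · omega
  · intro M hM hMU
    rw [← mdiff_append]
    exact h3 M hM hMU
  · intro i hi
    simp [hi]

/-- A negative maximal monomial of a restriction of `P` gives a refutation: the difference that
isolates its coefficient is constant on the face of the restriction. -/
theorem exists_isRefutation {P : MvPolynomial (Fin k) ℤ} (hP : ¬ IsPolyStrNNeg P) :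
    ∃ x U L, IsRefutation P x U L := by
  classical
  rw [isPolyStrNNeg_iff] at hP
  push Not at hP
  obtain ⟨ν, m, hm, hle⟩ := hP
  set Q := restrict P ν with hQ
  have hneg : Q.coeff m < 0 := lt_of_le_of_ne hle (MvPolynomial.mem_support_iff.1 hm.1)
  have hconst : mdiff 1 (directions m) (polyFun Q) =
      fun _ => Q.coeff m * ∏ i, ((m i).factorial : ℤ) := by
    ext x
    rw [mdiff_polyFun_of_maximal hm]
    simp
  have hprod : Q.coeff m * ∏ i, ((m i).factorial : ℤ) < 0 :=
    mul_neg_of_neg_of_pos hneg (Finset.prod_pos fun i _ => by exact_mod_cast Nat.factorial_pos _)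
  have hLU : ∀ i ∈ directions m, ν i = none := by
    intro i hi
    by_contra hν
    have := mdiff_eq_zero_of_mem (N := 1) hi (f := polyFun Q) (fun y => by
      rw [hQ, polyFun_restrict, polyFun_restrict]
      congr 1
      ext j
      rcases eq_or_ne j i with rfl | hj
      · obtain ⟨n, hn⟩ := Option.ne_none_iff_exists'.1 hν
        simp [hn]
      · simp [hj]) 0
    rw [hconst] at this
    exact hprod.ne this
  set x : Fin k → ℕ := fun i => (ν i).getD 0
  set U : Finset (Fin k) := Finset.univ.filter fun i => ν i = none
  have hface : ∀ L : List (Fin k), (∀ i ∈ L, i ∈ U) →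
      mdiff 1 L (polyFun P) x = mdiff 1 L (polyFun Q) x := by
    intro L hL
    refine mdiff_congr fun z hz => ?_
    rw [hQ, polyFun_restrict]
    congr 1
    ext i
    cases hi : ν i with
    | none => simp [x, hi]
    | some n =>
      have : z i = 0 := hz i fun h => by simpa [U, hi] using hL i h
      simp [x, hi, this]
  have hLU' : ∀ i ∈ directions m, i ∈ U := fun i hi => by simpa [U] using hLU i hi
  refine ⟨x, U, directions m, hLU', ?_, fun M hM hMU => ?_⟩
  · rw [hface _ hLU', hconst]
    exact hprod
  · rw [hface, mdiff_append, hconst, mdiff_const 1 hM]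
    intro i hi
    rcases List.mem_append.1 hi with h | h
    · exact hMU i h
    · exact hLU' i h

end Refutation

/-! ### Weighted automata and matrices -/

section Automata

variable {α S Q : Type*}

/-- The weight of `w` when the automaton is started in a given state. -/
def WeightedAutomaton.val [CommSemiring S] [Fintype Q] (A : WeightedAutomaton S α Q) :
    List α → Q → S
  | [], q => A.final q
  | a :: w, q => ∑ q', A.trans a q q' * A.val w q'

theorem sum_fin_cons [AddCommMonoid S] [Fintype Q] [DecidableEq Q] (n : ℕ)
    (f : (Fin (n + 1) → Q) → S) :
    ∑ ρ, f ρ = ∑ q, ∑ ρ : Fin n → Q, f (Fin.cons q ρ) := by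
  rw [← (Fin.consEquiv fun _ : Fin (n + 1) => Q).sum_comp, Fintype.sum_prod_type]
  rfl

theorem WeightedAutomaton.sum_runs_eq_val [CommSemiring S] [Fintype Q] [DecidableEq Q]
    (A : WeightedAutomaton S α Q) (w : List α) (p : Q) :
    ∑ ρ : Fin w.length → Q,
      (∏ i : Fin w.length, A.trans (w.get i) ((Fin.cons p ρ : Fin (w.length + 1) → Q) i.castSucc)
        ((Fin.cons p ρ : Fin (w.length + 1) → Q) i.succ)) *
      A.final ((Fin.cons p ρ : Fin (w.length + 1) → Q) (Fin.last w.length)) = A.val w p := by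
  induction w generalizing p with
  | nil => simp [WeightedAutomaton.val]
  | cons a w ih =>
    rw [WeightedAutomaton.val]
    refine (sum_fin_cons w.length _).trans (Finset.sum_congr rfl fun q _ => ?_)
    rw [← ih q, Finset.mul_sum]
    refine Finset.sum_congr rfl fun ρ _ => ?_
    rw [← mul_assoc]
    congr 1
    exact Fin.prod_univ_succ (n := w.length) _

theorem WeightedAutomaton.series_eq_val [CommSemiring S] [Fintype Q] [DecidableEq Q]
    (A : WeightedAutomaton S α Q) (w : List α) : A.series w = ∑ q, A.init q * A.val w q := by
  rw [WeightedAutomaton.series, sum_fin_cons]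
  refine Finset.sum_congr rfl fun q _ => ?_
  rw [← A.sum_runs_eq_val, Finset.mul_sum]
  refine Finset.sum_congr rfl fun ρ _ => ?_
  rw [← mul_assoc]
  rfl

theorem WeightedAutomaton.val_eq_mulVec [CommSemiring S] [Fintype Q] [DecidableEq Q]
    (A : WeightedAutomaton S α Q) (w : List α) :
    A.val w = (w.map fun a => (Matrix.of (A.trans a) : Matrix Q Q S)).prod.mulVec A.final := by
  induction w with
  | nil => simp [WeightedAutomaton.val]
  | cons a w ih =>
    ext q
    rw [List.map_cons, List.prod_cons, ← Matrix.mulVec_mulVec, ← ih]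
    rfl

/-- Renaming the states does not change the weights. -/
theorem WeightedAutomaton.val_equiv [CommSemiring S] {Q' : Type*} [Fintype Q] [Fintype Q']
    (e : Q' ≃ Q) (A : WeightedAutomaton S α Q) (B : WeightedAutomaton S α Q')
    (ht : ∀ a p q, B.trans a p q = A.trans a (e p) (e q)) (hf : ∀ p, B.final p = A.final (e p))
    (w : List α) (p : Q') : B.val w p = A.val w (e p) := by
  induction w generalizing p with
  | nil => exact hf p
  | cons a w ih =>
    simp only [WeightedAutomaton.val, ht, ih]
    exact e.sum_comp fun q => A.trans a (e p) q * A.val w q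

theorem WeightedAutomaton.series_equiv [CommSemiring S] {Q' : Type*} [Fintype Q] [Fintype Q']
    [DecidableEq Q] [DecidableEq Q']
    (e : Q' ≃ Q) (A : WeightedAutomaton S α Q) (B : WeightedAutomaton S α Q')
    (hi : ∀ p, B.init p = A.init (e p))
    (ht : ∀ a p q, B.trans a p q = A.trans a (e p) (e q)) (hf : ∀ p, B.final p = A.final (e p)) :
    B.series = A.series := by
  ext w
  simp only [series_eq_val, hi, val_equiv e A B ht hf]
  exact e.sum_comp fun q => A.init q * A.val w q

theorem prod_map_dagger {k : ℕ} {R : Type*} [Monoid R] (η : Fin k → α) (f : α → R)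
    (x : Fin k → ℕ) :
    ((dagger η x).map f).prod = (List.ofFn fun i => f (η i) ^ x i).prod := by
  rw [dagger, List.map_flatten, List.prod_flatten, List.map_ofFn, List.map_ofFn]
  congr 2
  ext i
  simp

/-! ### Polynomials given by products of matrices -/

/-- The linear form `B ↦ u B v` on matrices. -/
def sandwich [Fintype Q] (u v : Q → ℤ) : Matrix Q Q ℤ →ₗ[ℤ] ℤ where
  toFun B := ∑ p, u p * B.mulVec v p
  map_add' B C := by simp [Matrix.add_mulVec, mul_add, Finset.sum_add_distrib]
  map_smul' c B := by
    simp only [Matrix.smul_mulVec, Pi.smul_apply, smul_eq_mul, RingHom.id_apply, Finset.mul_sum]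
    exact Finset.sum_congr rfl fun _ _ => by ring

/-- The multilinear form `(B₁, …, B_k) ↦ u B₁ ⋯ B_k v` on matrices. -/
def sandwichProd [Fintype Q] [DecidableEq Q] (k : ℕ) (u v : Q → ℤ) :
    MultilinearMap ℤ (fun _ : Fin k => Matrix Q Q ℤ) ℤ :=
  (sandwich u v).compMultilinearMap (MultilinearMap.mkPiAlgebraFin ℤ k (Matrix Q Q ℤ))

theorem sandwichProd_apply [Fintype Q] [DecidableEq Q] {k : ℕ} (u v : Q → ℤ)
    (B : Fin k → Matrix Q Q ℤ) :
    sandwichProd k u v B = ∑ p, u p * (List.ofFn B).prod.mulVec v p := rfl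

/-- The matrices over `ℤ` with non-negative entries. -/
def nonnegMatrices (Q : Type*) [Fintype Q] [DecidableEq Q] : Submonoid (Matrix Q Q ℤ) where
  carrier := {B | ∀ p q, 0 ≤ B p q}
  one_mem' p q := by
    rw [Matrix.one_apply]
    split_ifs <;> simp
  mul_mem' {B C} hB hC p q := Finset.sum_nonneg fun r _ => mul_nonneg (hB p r) (hC r q)

theorem sandwichProd_nonneg [Fintype Q] [DecidableEq Q] {k : ℕ} {u v : Q → ℤ}
    (hu : ∀ p, 0 ≤ u p) (hv : ∀ p, 0 ≤ v p) {B : Fin k → Matrix Q Q ℤ}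
    (hB : ∀ i, B i ∈ nonnegMatrices Q) : 0 ≤ sandwichProd k u v B := by
  have h : (List.ofFn B).prod ∈ nonnegMatrices Q :=
    Submonoid.list_prod_mem _ fun C hC => by
      obtain ⟨i, rfl⟩ := List.mem_ofFn.1 hC
      exact hB i
  rw [sandwichProd_apply]
  exact Finset.sum_nonneg fun p _ => mul_nonneg (hu p)
    (Finset.sum_nonneg fun q _ => mul_nonneg (h p q) (hv q))

/-- By Dickson's lemma, some power of a matrix over `ℕ` is dominated by a later one. -/
theorem exists_pow_le_pow [Fintype Q] [DecidableEq Q] (A : Matrix Q Q ℕ) :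
    ∃ K N : ℕ, 0 < N ∧ ∀ p q, (A ^ K) p q ≤ (A ^ (K + N)) p q := by
  have h : WellQuasiOrdered (α := Q → Q → ℕ) (· ≤ ·) := wellQuasiOrdered_le
  obtain ⟨i, j, hij, hle⟩ := h fun n => fun p q => (A ^ n) p q
  refine ⟨i, j - i, by omega, fun p q => ?_⟩
  rw [Nat.add_sub_cancel' hij.le]
  exact hle p q

variable {k : ℕ}

/-- A polynomial of the form `x ↦ u A₁^{x₁} ⋯ A_k^{x_k} v`, with weights in `ℕ`, is in
`PolyStrNNeg`. The coefficient of a maximal monomial of exponent `m` is, up to a positive factor,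
an iterated difference of the polynomial. With steps `N i` and base point `m i * K i` such that
`A i ^ K i ≤ A i ^ (K i + N i)`, the same difference is computed on the matrices as a product of
non-negative ones, `((A i ^ N i - 1) * A i ^ K i) ^ m i`. -/
theorem isPolyStrNNeg_of_matrix [Fintype Q] [DecidableEq Q] {P : MvPolynomial (Fin k) ℤ}
    {u v : Q → ℤ} (hu : ∀ p, 0 ≤ u p) (hv : ∀ p, 0 ≤ v p) (A : Fin k → Matrix Q Q ℕ)
    (hP : ∀ x, polyFun P x =
      sandwichProd k u v fun i => ((Nat.castRingHom ℤ).mapMatrix (A i)) ^ x i) :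
    IsPolyStrNNeg P := by
  classical
  rw [isPolyStrNNeg_iff]
  intro ν m hm
  choose K N hN hKN using fun i => exists_pow_le_pow (A i)
  set B : Fin k → Matrix Q Q ℤ := fun i => (Nat.castRingHom ℤ).mapMatrix (A i) with hB
  have hBpow : ∀ i n p q, (B i ^ n) p q = ((A i ^ n) p q : ℤ) := by
    intro i n p q
    rw [hB, ← map_pow]
    rfl
  have hBn : ∀ i n, B i ^ n ∈ nonnegMatrices Q := fun i n p q => by
    rw [hBpow]
    exact Int.natCast_nonneg _
  set F : Fin k → ℕ → Matrix Q Q ℤ := fun i t => B i ^ (ν i).getD t with hF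
  have hres : polyFun (restrict P ν) = fun x => sandwichProd k u v fun i => F i (x i) := by
    ext x
    rw [polyFun_restrict, hP]
  have h1 := mdiff_polyFun_of_maximal hm N fun i => m i * K i
  rw [hres, mdiff_multilinear] at h1
  have hpos : 0 < ∏ i, ((N i : ℤ) ^ m i * ((m i).factorial : ℤ)) :=
    Finset.prod_pos fun i _ => mul_pos (pow_pos (by exact_mod_cast hN i) _)
      (by exact_mod_cast Nat.factorial_pos _)
  have h2 : 0 ≤ sandwichProd k u v fun i =>
      (fwdDiff (N i))^[(directions m).count i] (F i) (m i * K i) := by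
    refine sandwichProd_nonneg hu hv fun i => ?_
    rw [count_directions]
    cases hν : ν i with
    | none =>
      have : F i = fun t => B i ^ t := by
        ext t
        simp [hF, hν]
      rw [this, fwdDiff_iter_pow_matrix, Nat.mul_comm, pow_mul, ← Commute.mul_pow]
      · refine pow_mem (fun p q => ?_) _
        rw [sub_mul, one_mul, ← pow_add, add_comm, Matrix.sub_apply, hBpow, hBpow, sub_nonneg]
        exact_mod_cast hKN i p q
      · exact ((Commute.refl (B i)).pow_pow _ _).sub_left (Commute.one_left _)
    | some n =>
      have : F i = fun _ => B i ^ n := by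
        ext t
        simp [hF, hν]
      rw [this]
      cases m i with
      | zero => exact hBn i n
      | succ j =>
        have h0 : fwdDiff (N i) (fun _ : ℕ => B i ^ n) = fun _ => 0 := fwdDiff_const _ _
        have h0' : ∀ j, (fwdDiff (N i))^[j] (fun _ : ℕ => (0 : Matrix Q Q ℤ)) = fun _ => 0 := by
          intro j
          induction j with
          | zero => rfl
          | succ j ih => rw [Function.iterate_succ_apply, fwdDiff_const, ih]
        rw [Function.iterate_succ_apply, h0, h0']
        exact fun p q => le_rfl
  rw [h1] at h2
  exact lt_of_le_of_ne (nonneg_of_mul_nonneg_left h2 hpos)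
    (Ne.symm (MvPolynomial.mem_support_iff.1 hm.1))

/-- A polynomial of the form `x ↦ u A₁^{x₁} ⋯ A_k^{x_k} v` has degree less than the size of the
matrices in each indeterminate, by the theorem of Cayley and Hamilton applied to `A i - 1`. -/
theorem exponent_lt_card_of_matrix [Fintype Q] [DecidableEq Q] {P : MvPolynomial (Fin k) ℤ}
    {u v : Q → ℤ} (A : Fin k → Matrix Q Q ℤ)
    (hP : ∀ x, polyFun P x = sandwichProd k u v fun i => A i ^ x i)
    {m : Fin k →₀ ℕ} (hm : m ∈ P.support) (i : Fin k) : m i < Fintype.card Q := by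
  classical
  by_contra! hcard
  obtain ⟨M, hmM, hM⟩ := P.support.exists_le_maximal hm
  have hMi : Fintype.card Q ≤ M i := hcard.trans (hmM i)
  set B : Matrix Q Q ℤ := A i - 1
  set base : Fin k → Matrix Q Q ℤ := fun l => (A l - 1) ^ M l
  set ψ : Matrix Q Q ℤ →ₗ[ℤ] ℤ := (sandwichProd k u v).toLinearMap base i
  have hψ : ∀ j, ψ (B ^ j) = mdiff 1 (directions (Function.update M i j)) (polyFun P) 0 := by
    intro j
    have hPf : polyFun P = fun x => sandwichProd k u v fun i => A i ^ x i := funext hP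
    rw [hPf]
    have := mdiff_multilinear (sandwichProd k u v) (fun i t => A i ^ t) 1
      (directions (Function.update M i j)) 0
    rw [this]
    simp only [fwdDiff_iter_pow_matrix, count_directions, Pi.one_apply, pow_one, Pi.zero_apply,
      pow_zero, mul_one, ψ, MultilinearMap.toLinearMap_apply]
    congr 1
    ext l : 1
    rcases eq_or_ne l i with rfl | hl
    · simp [B]
    · simp [hl, base]
  have hψM : ψ (B ^ M i) ≠ 0 := by
    rw [hψ, Function.update_eq_self, mdiff_polyFun_of_maximal hM]
    refine mul_ne_zero (MvPolynomial.mem_support_iff.1 hM.1)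
      (Finset.prod_ne_zero_iff.2 fun l _ => ?_)
    simp [Nat.factorial_ne_zero]
  have hψgt : ∀ j, M i < j → ψ (B ^ j) = 0 := by
    intro j hj
    rw [hψ, mdiff_polyFun]
    refine Finset.sum_eq_zero fun m' hm' => ?_
    obtain ⟨l, hl⟩ : ∃ l, m' l < (directions (Function.update M i j)).count l := by
      by_contra! h
      simp only [count_directions] at h
      have hle : M ≤ m' := by
        intro l
        have := h l
        rcases eq_or_ne l i with rfl | hl
        · simp only [Function.update_self] at this
          omega
        · rwa [Function.update_of_ne hl] at this
      have h1 := h i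
      have h2 := hM.2 hm' hle i
      simp only [Function.update_self] at h1
      omega
    rw [mdiff_monomial_eq_zero _ hl, mul_zero]
  -- the relation given by the characteristic polynomial, multiplied by a power of `B` that brings
  -- its trailing term to the exponent `M i`
  set χ := B.charpoly
  have hχ : χ ≠ 0 := (Matrix.charpoly_monic B).ne_zero
  set r := χ.natTrailingDegree
  have hr : r ≤ M i := by
    refine le_trans (Polynomial.natTrailingDegree_le_natDegree χ) ?_
    rwa [Matrix.charpoly_natDegree_eq_dim]
  have h0 : ψ (B ^ (M i - r) * Polynomial.aeval B χ) = 0 := by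
    rw [Matrix.aeval_self_charpoly, mul_zero, map_zero]
  rw [Polynomial.aeval_eq_sum_range, Finset.mul_sum, map_sum, Finset.sum_eq_single r] at h0
  · rw [mul_smul_comm, ← pow_add, map_smul, Nat.sub_add_cancel hr, smul_eq_mul] at h0
    rcases mul_eq_zero.1 h0 with h | h
    · exact hχ (Polynomial.trailingCoeff_eq_zero.1 h)
    · exact hψM h
  · intro j _ hj
    rw [mul_smul_comm, ← pow_add, map_smul, smul_eq_mul]
    rcases lt_or_gt_of_ne hj with h | h
    · rw [Polynomial.coeff_eq_zero_of_lt_natTrailingDegree h, zero_mul]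
    · rw [hψgt _ (by omega), mul_zero]
  · intro h
    exact absurd (Finset.mem_range.2
      (Nat.lt_succ_of_le (Polynomial.natTrailingDegree_le_natDegree χ))) h

theorem polyFun_eq_sandwichProd [Fintype Q] [DecidableEq Q] (A : WeightedAutomaton ℕ α Q)
    {η : Fin k → α} {P : MvPolynomial (Fin k) ℤ} (h : RepresentsVia η A.series P)
    (x : Fin k → ℕ) :
    polyFun P x = sandwichProd k (fun q => (A.init q : ℤ)) (fun q => (A.final q : ℤ)) fun i =>
      ((Nat.castRingHom ℤ).mapMatrix (Matrix.of (A.trans (η i)))) ^ x i := by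
  rw [polyFun, ← h.2 x, A.series_eq_val, A.val_eq_mulVec, prod_map_dagger, sandwichProd_apply]
  push_cast
  refine Finset.sum_congr rfl fun q _ => ?_
  congr 1
  have h1 : (List.ofFn fun i =>
      ((Nat.castRingHom ℤ).mapMatrix (Matrix.of (A.trans (η i)) : Matrix Q Q ℕ)) ^ x i).prod =
      (Nat.castRingHom ℤ).mapMatrix
        (List.ofFn fun i => (Matrix.of (A.trans (η i)) : Matrix Q Q ℕ) ^ x i).prod := by
    rw [map_list_prod, List.map_ofFn]
    congr 2
    ext i : 1
    exact (map_pow _ _ _).symm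
  rw [h1]
  simp [Matrix.mulVec, dotProduct]

theorem RepresentsVia.isPolyStrNNeg [Fintype Q] [DecidableEq Q] {A : WeightedAutomaton ℕ α Q}
    {η : Fin k → α} {P : MvPolynomial (Fin k) ℤ} (h : RepresentsVia η A.series P) :
    IsPolyStrNNeg P :=
  isPolyStrNNeg_of_matrix (fun _ => Int.natCast_nonneg _) (fun _ => Int.natCast_nonneg _) _
    (polyFun_eq_sandwichProd A h)

theorem RepresentsVia.exponent_lt_card [Fintype Q] [DecidableEq Q] {A : WeightedAutomaton ℕ α Q}
    {η : Fin k → α} {P : MvPolynomial (Fin k) ℤ} (h : RepresentsVia η A.series P)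
    {m : Fin k →₀ ℕ} (hm : m ∈ P.support) (i : Fin k) : m i < Fintype.card Q :=
  exponent_lt_card_of_matrix _ (polyFun_eq_sandwichProd A h) hm i

end Automata

/-! ### Sums over factorizations -/

section Factorizations

variable {α : Type*}

/-- The sum of `ψ p q` over the factorizations `w = p ++ q`. -/
def splitSum (ψ : List α → List α → ℕ) : List α → ℕ
  | [] => ψ [] []
  | a :: w => ψ [] (a :: w) + splitSum (fun p q => ψ (a :: p) q) w

/-- The sum of `φ [u₁, …, u_n]` over the factorizations `w = u₁ ⋯ u_n`, computed factor by
factor. -/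
def facSum : ℕ → (List (List α) → ℕ) → List α → ℕ
  | 0, φ, [] => φ []
  | 0, _, _ :: _ => 0
  | n + 1, φ, w => splitSum (fun p q => facSum n (fun l => φ (p :: l)) q) w

/-- The list of the factorizations of a word into two words. -/
def splits : List α → List (List α × List α)
  | [] => [([], [])]
  | a :: w => ([], a :: w) :: (splits w).map fun s => (a :: s.1, s.2)

/-- The list of the factorizations of a word into `n` words. -/
def facList : ℕ → List α → List (List (List α))
  | 0, [] => [[]]
  | 0, _ :: _ => []
  | n + 1, w => (splits w).flatMap fun s => (facList n s.2).map (s.1 :: ·)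

theorem mem_splits {w : List α} {s : List α × List α} : s ∈ splits w ↔ s.1 ++ s.2 = w := by
  induction w generalizing s with
  | nil => simp [splits, Prod.ext_iff]
  | cons a w ih =>
    obtain ⟨p, q⟩ := s
    simp only [splits, List.mem_cons, List.mem_map, ih]
    cases p with
    | nil => simp
    | cons b p =>
      simp only [Prod.mk.injEq, List.cons_append, List.cons.injEq, Prod.exists]
      constructor
      · rintro (h | ⟨_, _, h, ⟨rfl, rfl⟩, rfl⟩)
        · exact absurd h.1 (by simp)
        · exact ⟨rfl, h⟩
      · rintro ⟨rfl, h⟩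
        exact Or.inr ⟨p, q, h, ⟨rfl, rfl⟩, rfl⟩

theorem nodup_splits (w : List α) : (splits w).Nodup := by
  induction w with
  | nil => simp [splits]
  | cons a w ih =>
    rw [splits, List.nodup_cons]
    refine ⟨by simp, ih.map ?_⟩
    rintro ⟨p, q⟩ ⟨p', q'⟩ h
    simpa using h

theorem mem_facList {n : ℕ} {w : List α} {l : List (List α)} :
    l ∈ facList n w ↔ l.length = n ∧ l.flatten = w := by
  induction n generalizing w l with
  | zero => cases w <;> cases l <;> simp [facList]
  | succ n ih =>
    simp only [facList, List.mem_flatMap, List.mem_map, mem_splits, ih]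
    constructor
    · rintro ⟨s, rfl, l, ⟨rfl, h⟩, rfl⟩
      simp [h]
    · rintro ⟨h1, h2⟩
      cases l with
      | nil => simp at h1
      | cons p l => exact ⟨(p, l.flatten), by simpa using h2, l, ⟨by simpa using h1, rfl⟩, rfl⟩

theorem nodup_facList (n : ℕ) (w : List α) : (facList n w).Nodup := by
  induction n generalizing w with
  | zero => cases w <;> simp [facList]
  | succ n ih =>
    rw [facList, List.nodup_flatMap]
    refine ⟨fun s _ => (ih s.2).map fun _ _ h => (List.cons.inj h).2,
      (nodup_splits w).imp_of_mem ?_⟩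
    intro s s' hs hs' hne l hl hl'
    obtain ⟨m, -, rfl⟩ := List.mem_map.1 hl
    obtain ⟨m', -, h⟩ := List.mem_map.1 hl'
    have h1 : s'.1 = s.1 := (List.cons.inj h).1
    rw [mem_splits] at hs hs'
    have h2 : s'.2 = s.2 := by
      rw [← hs, h1] at hs'
      exact List.append_cancel_left hs'
    exact hne (Prod.ext h1.symm h2.symm)

theorem splitSum_eq (ψ : List α → List α → ℕ) (w : List α) :
    splitSum ψ w = ((splits w).map fun s => ψ s.1 s.2).sum := by
  induction w generalizing ψ with
  | nil => simp [splitSum, splits]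
  | cons a w ih => simp [splitSum, splits, ih, Function.comp_def]

theorem facSum_eq (n : ℕ) (φ : List (List α) → ℕ) (w : List α) :
    facSum n φ w = ((facList n w).map φ).sum := by
  induction n generalizing φ w with
  | zero => cases w <;> simp [facSum, facList]
  | succ n ih =>
    rw [facSum, facList, splitSum_eq, List.map_flatMap, List.flatMap_def, List.sum_flatten,
      List.map_map]
    congr 1
    refine List.map_congr_left fun s _ => ?_
    rw [ih, Function.comp_apply, List.map_map]
    rfl

theorem sum_factorizations (n : ℕ) (φ : List (List α) → ℕ) (w : List α) :
    ∑ u ∈ factorizations n w, φ (List.ofFn u) = facSum n φ w := by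
  classical
  rw [facSum_eq, ← List.sum_toFinset _ (nodup_facList n w)]
  refine Finset.sum_bij (fun u _ => List.ofFn u) ?_ ?_ ?_ fun _ _ => rfl
  · intro u hu
    simp only [factorizations, Set.Finite.mem_toFinset, Set.mem_ofPred_eq] at hu
    simpa [mem_facList] using hu
  · intro u _ u' _ h
    exact List.ofFn_injective h
  · intro l hl
    rw [List.mem_toFinset, mem_facList] at hl
    obtain ⟨rfl, h⟩ := hl
    refine ⟨l.get, ?_, List.ofFn_get l⟩
    simpa [factorizations, List.ofFn_get] using h

theorem splitSum_congr {ψ ψ' : List α → List α → ℕ} (h : ∀ p q, ψ p q = ψ' p q) (w : List α) :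
    splitSum ψ w = splitSum ψ' w := by
  rw [show ψ = ψ' from funext fun p => funext fun q => h p q]

theorem splitSum_zero (w : List α) : splitSum (fun _ _ => 0) w = 0 := by
  induction w with
  | nil => rfl
  | cons a w ih => rw [splitSum, ih]

theorem facSum_nil (n : ℕ) (φ : List (List α) → ℕ) :
    facSum n φ [] = φ (List.replicate n []) := by
  induction n generalizing φ with
  | zero => rfl
  | succ n ih => simp [facSum, splitSum, ih, List.replicate_succ]

/-- The first letter of a nonempty word is either in a later factor, or at the front of the
first one. -/
theorem facSum_succ_cons (n : ℕ) (φ : List (List α) → ℕ) (a : α) (w : List α) :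
    facSum (n + 1) φ (a :: w) = facSum n (fun l => φ ([] :: l)) (a :: w) +
      facSum (n + 1) (fun l => φ ((a :: l.headI) :: l.tail)) w := rfl

/-! ### From polyregular functions to weighted automata -/

variable {M : Type*} [Monoid M] {d : ℕ}

theorem getD_ofFn {β : Type*} {n : ℕ} (u : Fin n → β) (i : Fin n) (b : β) :
    (List.ofFn u).getD i b = u i := by
  simp [List.getD_eq_getElem?_getD]

theorem polyregularFun_eq_facSum (μ : FreeMonoid α →* M) (π : (Fin (d + 1) → M) → ℕ) (w : List α) :
    polyregularFun μ π w =
      facSum (d + 1) (fun l => π fun i => μ (FreeMonoid.ofList (l.getD i []))) w := by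
  rw [← sum_factorizations, polyregularFun]
  simp only [getD_ofFn]

/-- The tuple `t` after multiplication on the right of its components of index at least `j` by the
images of the words in `l`. -/
def extendFrom (μ : FreeMonoid α →* M) (j : ℕ) (t : Fin (d + 1) → M) (l : List (List α)) :
    Fin (d + 1) → M :=
  fun i => if (i : ℕ) < j then t i else t i * μ (FreeMonoid.ofList (l.getD (i - j) []))

/-- The tuple `t` after reading the letter `a` in the factor `j`. -/
def readLetter (μ : FreeMonoid α →* M) (a : α) (j : Fin (d + 1)) (t : Fin (d + 1) → M) :
    Fin (d + 1) → M :=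
  Function.update t j (t j * μ (FreeMonoid.of a))

/-- The first letter `a` of the word belongs to a factor `j'`, and the factors of index from `j` to
`j' - 1` are empty. -/
theorem facSum_extendFrom_cons (μ : FreeMonoid α →* M) (π : (Fin (d + 1) → M) → ℕ)
    (t : Fin (d + 1) → M) (a : α) (w : List α) {e j : ℕ} (hj : j + e = d + 1) :
    facSum e (fun l => π (extendFrom μ j t l)) (a :: w) = ∑ j' : Fin (d + 1), if j ≤ j' then
      facSum (d + 1 - j') (fun l => π (extendFrom μ j' (readLetter μ a j' t) l)) w else 0 := by
  induction e generalizing j with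
  | zero =>
    rw [facSum, Finset.sum_eq_zero]
    intro j' _
    rw [if_neg (by omega)]
  | succ e ih =>
    rw [facSum_succ_cons]
    have h1 : (fun l : List (List α) => π (extendFrom μ j t ([] :: l))) =
        fun l => π (extendFrom μ (j + 1) t l) := by
      ext l
      congr 1
      ext i
      simp only [extendFrom]
      rcases lt_trichotomy (i : ℕ) j with h | h | h
      · rw [if_pos h, if_pos (by omega)]
      · rw [if_neg (by omega), if_pos (by omega), h, Nat.sub_self]
        change t i * μ (FreeMonoid.ofList []) = t i
        rw [show (FreeMonoid.ofList ([] : List α)) = 1 from rfl, map_one, mul_one]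
      · rw [if_neg (by omega), if_neg (by omega),
          show (i : ℕ) - j = (i - (j + 1)) + 1 by omega, List.getD_cons_succ]
    rw [h1, ih (by omega)]
    set J : Fin (d + 1) := ⟨j, by omega⟩
    have h2 : (fun l : List (List α) => π (extendFrom μ j t ((a :: l.headI) :: l.tail))) =
        fun l => π (extendFrom μ j (readLetter μ a J t) l) := by
      ext l
      congr 1
      ext i
      simp only [extendFrom]
      rcases lt_trichotomy (i : ℕ) j with h | h | h
      · have hne : i ≠ J := fun h' => by simp [h', J] at h
        rw [if_pos h, if_pos h, readLetter, Function.update_of_ne hne]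
      · have he : i = J := Fin.ext h
        subst he
        rw [if_neg (by omega), if_neg (by omega), readLetter, Function.update_self, mul_assoc,
          ← map_mul]
        congr 2
        cases l with
        | nil => simp [J]; rfl
        | cons p l => simp [J]
      · have hne : i ≠ J := fun h' => by simp [h', J] at h
        rw [if_neg (by omega), if_neg (by omega), readLetter, Function.update_of_ne hne,
          show (i : ℕ) - j = (i - (j + 1)) + 1 by omega, List.getD_cons_succ]
        cases l <;> simp
    rw [h2]
    have h3 : ∀ j' : Fin (d + 1), (if j ≤ j' then
        facSum (d + 1 - j') (fun l => π (extendFrom μ j' (readLetter μ a j' t) l)) w else 0) =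
        (if j + 1 ≤ j' then
        facSum (d + 1 - j') (fun l => π (extendFrom μ j' (readLetter μ a j' t) l)) w else 0) +
        if j' = J then facSum (d + 1 - j') (fun l => π (extendFrom μ j' (readLetter μ a j' t) l)) w
          else 0 := by
      intro j'
      rcases lt_trichotomy (j' : ℕ) j with h | h | h
      · have hne : j' ≠ J := fun h' => by simp [h', J] at h
        rw [if_neg (by omega), if_neg (by omega), if_neg hne]
      · have he : j' = J := Fin.ext h
        rw [if_pos (by omega), if_neg (by omega), if_pos he, zero_add]
      · have hne : j' ≠ J := fun h' => by simp [h', J] at h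
        rw [if_pos (by omega), if_pos (by omega), if_neg hne, add_zero]
    simp_rw [h3]
    rw [Finset.sum_add_distrib, Finset.sum_ite_eq' Finset.univ J, if_pos (Finset.mem_univ J)]
    rw [show d + 1 - (J : ℕ) = e + 1 by simp only [J]; omega]

open Classical in
/-- The automaton of a polyregular function. A run guesses a factorization of the word: its state
records the index of the current factor and the images of the factors read so far. -/
noncomputable def factorAutomaton (μ : FreeMonoid α →* M) (π : (Fin (d + 1) → M) → ℕ) :
    WeightedAutomaton ℕ α (Fin (d + 1) × (Fin (d + 1) → M)) where
  init s := if s.1 = 0 ∧ s.2 = 1 then 1 else 0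
  trans a s s' := if s.1 ≤ s'.1 ∧ s'.2 = readLetter μ a s'.1 s.2 then 1 else 0
  final s := π s.2

/-- The runs from the state `(j, t)` on `w` correspond to the ways of distributing `w` over the
factors of index at least `j`, with the values `t` of the factors read so far. -/
theorem factorAutomaton_val [Fintype M] (μ : FreeMonoid α →* M) (π : (Fin (d + 1) → M) → ℕ)
    (w : List α) (j : Fin (d + 1)) (t : Fin (d + 1) → M) :
    (factorAutomaton μ π).val w (j, t) =
      facSum (d + 1 - j) (fun l => π (extendFrom μ j t l)) w := by
  classical
  induction w generalizing j t with
  | nil =>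
    rw [facSum_nil, WeightedAutomaton.val]
    change π t = _
    congr 1
    ext i
    have : ∀ m n : ℕ, (List.replicate m ([] : List α)).getD n [] = [] := fun m n => by
      rw [List.getD_eq_getElem?_getD, List.getElem?_replicate]
      split_ifs <;> rfl
    rw [extendFrom, this, show (FreeMonoid.ofList ([] : List α)) = 1 from rfl, map_one,
      mul_one, ite_self]
  | cons a w ih =>
    rw [facSum_extendFrom_cons μ π t a w (by omega), WeightedAutomaton.val,
      Fintype.sum_prod_type]
    refine Finset.sum_congr rfl fun j' _ => ?_
    have htrans : ∀ t', (factorAutomaton μ π).trans a (j, t) (j', t') =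
      if j ≤ j' ∧ t' = readLetter μ a j' t then 1 else 0 := fun _ => rfl
    simp only [ih, htrans, ite_mul, one_mul, zero_mul]
    by_cases h : j ≤ j'
    · have h' : (j : ℕ) ≤ j' := h
      simp only [h, true_and, if_pos h', Finset.sum_ite_eq', Finset.mem_univ, if_true]
    · have h' : ¬ (j : ℕ) ≤ j' := h
      simp [h, h']

theorem factorAutomaton_series [Fintype M] [DecidableEq M] (μ : FreeMonoid α →* M)
    (π : (Fin (d + 1) → M) → ℕ) : (factorAutomaton μ π).series = polyregularFun μ π := by
  ext w
  rw [WeightedAutomaton.series_eq_val, polyregularFun_eq_facSum, Finset.sum_eq_single (0, 1)]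
  · rw [factorAutomaton_val, show (factorAutomaton μ π).init (0, 1) = 1 from if_pos ⟨rfl, rfl⟩,
      one_mul]
    congr 1
    ext l
    congr 1
    ext i
    simp [extendFrom]
  · rintro ⟨j, t⟩ _ hne
    have : ¬ (j = 0 ∧ t = 1) := fun h => hne (Prod.ext h.1 h.2)
    simp [factorAutomaton, this]
  · simp

theorem IsNPolyregular.isNRational {f : List α → ℕ} (hf : IsNPolyregular f) : IsNRational f := by
  classical
  obtain ⟨d, M, _, hfin, μ, π, rfl⟩ := hf
  have := Fintype.ofFinite M
  set Q := Fin (d + 1) × (Fin (d + 1) → M)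
  let e : Fin (Fintype.card Q) ≃ Q := (Fintype.equivFin Q).symm
  let A := factorAutomaton μ π
  refine ⟨Fintype.card Q, ⟨fun p => A.init (e p), fun a p q => A.trans a (e p) (e q),
    fun p => A.final (e p)⟩, ?_⟩
  rw [← factorAutomaton_series]
  exact (WeightedAutomaton.series_equiv e A _ (fun _ => rfl) (fun _ _ _ => rfl) fun _ => rfl).symm

end Factorizations

/-! ### Star-free functions with a prescribed polynomial -/

section StarFree

variable {k : ℕ}

/-- What the star-free function sees of a word over `Fin k`: its first letter, and the number of
occurrences of each letter, capped at `T`. -/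
@[ext]
structure Summary (k T : ℕ) where
  head : Option (Fin k)
  count : Fin k → Fin (T + 1)

/-- The smaller of a number and `T`, as an element of `Fin (T + 1)`. -/
def cap (T n : ℕ) : Fin (T + 1) := ⟨min n T, by omega⟩

theorem cap_val (T n : ℕ) : (cap T n : ℕ) = min n T := rfl

variable {T : ℕ}

instance : Mul (Summary k T) :=
  ⟨fun s t => ⟨s.head.or t.head, fun i => cap T (s.count i + t.count i)⟩⟩

instance : One (Summary k T) := ⟨⟨none, fun _ => 0⟩⟩

theorem Summary.mul_head (s t : Summary k T) : (s * t).head = s.head.or t.head := rfl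

theorem Summary.mul_count (s t : Summary k T) (i : Fin k) :
    ((s * t).count i : ℕ) = min ((s.count i : ℕ) + t.count i) T := rfl

theorem Summary.one_head : (1 : Summary k T).head = none := rfl

theorem Summary.one_count (i : Fin k) : ((1 : Summary k T).count i : ℕ) = 0 := rfl

theorem Summary.ext_val {s t : Summary k T} (h : s.head = t.head)
    (h' : ∀ i, (s.count i : ℕ) = t.count i) : s = t :=
  Summary.ext h (funext fun i => Fin.ext (h' i))

instance : Monoid (Summary k T) where
  mul_assoc s t u := Summary.ext_val (by simp [Summary.mul_head, Option.or_assoc]) fun i => by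
    simp only [Summary.mul_count]
    omega
  one_mul s := Summary.ext_val (by simp [Summary.mul_head, Summary.one_head]) fun i => by
    have := (s.count i).2
    simp only [Summary.mul_count, Summary.one_count]
    omega
  mul_one s := Summary.ext_val (by simp [Summary.mul_head, Summary.one_head]) fun i => by
    have := (s.count i).2
    simp only [Summary.mul_count, Summary.one_count]
    omega

instance : Finite (Summary k T) :=
  Finite.of_injective (fun s : Summary k T => (s.head, s.count)) fun _ _ h =>
    Summary.ext (congrArg Prod.fst h) (congrArg Prod.snd h)

theorem Summary.pow_count (s : Summary k T) (n : ℕ) (i : Fin k) :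
    ((s ^ n).count i : ℕ) = min (n * s.count i) T := by
  induction n with
  | zero => simp [Summary.one_count]
  | succ n ih =>
    rw [pow_succ, Summary.mul_count, ih, Nat.succ_mul]
    omega

theorem Summary.pow_succ_head (s : Summary k T) (n : ℕ) : (s ^ (n + 1)).head = s.head := by
  induction n with
  | zero => simp
  | succ n ih => rw [pow_succ, Summary.mul_head, ih, Option.or_self]

theorem isAperiodic_summary : IsAperiodic (Summary k T) := by
  intro s
  refine ⟨T + 1, Summary.ext_val (by rw [Summary.pow_succ_head, Summary.pow_succ_head]) fun i => ?_⟩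
  rw [Summary.pow_count, Summary.pow_count]
  rcases Nat.eq_zero_or_pos (s.count i : ℕ) with h | h
  · simp [h]
  · have h1 : T + 1 ≤ (T + 1) * (s.count i : ℕ) := Nat.le_mul_of_pos_right _ h
    have h2 : T + 1 + 1 ≤ (T + 1 + 1) * (s.count i : ℕ) := Nat.le_mul_of_pos_right _ h
    omega

/-- The summary of a one-letter word. -/
def letterSummary (k T : ℕ) (a : Fin k) : Summary k T :=
  ⟨some a, fun i => if i = a then cap T 1 else 0⟩

/-- The morphism that maps a word to its summary. -/
def summary (k T : ℕ) : FreeMonoid (Fin k) →* Summary k T :=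
  FreeMonoid.lift (letterSummary k T)

theorem summary_nil : summary k T (FreeMonoid.ofList []) = 1 := rfl

theorem summary_cons (a : Fin k) (w : List (Fin k)) :
    summary k T (FreeMonoid.ofList (a :: w)) =
      letterSummary k T a * summary k T (FreeMonoid.ofList w) := by
  rw [FreeMonoid.ofList_cons, map_mul, summary, FreeMonoid.lift_eval_of]

theorem summary_cons_head (a : Fin k) (w : List (Fin k)) :
    (summary k T (FreeMonoid.ofList (a :: w))).head = some a := by
  rw [summary_cons, Summary.mul_head]
  rfl

theorem summary_count (w : List (Fin k)) (i : Fin k) :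
    ((summary k T (FreeMonoid.ofList w)).count i : ℕ) = min (w.count i) T := by
  induction w with
  | nil => simp [Summary.one_count]
  | cons a w ih =>
    rw [summary_cons, Summary.mul_count, ih, List.count_cons]
    simp only [letterSummary, beq_iff_eq]
    rcases eq_or_ne a i with rfl | h
    · simp [cap_val]
      omega
    · simp [h, h.symm]

/-- The state of a scan of the sequence of summaries of the factors of a factorization: a phase,
the capped number of occurrences of each letter in the factors read so far, and the list of the
first letters of these factors, except for the factor at the beginning. The phases are `0`: only
nonempty factors since the factor at the beginning; `1`: an empty factor was read; `2`: the
factorization is rejected; `3`: nothing was read. -/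
abbrev ScanState (k : ℕ) : Type := ℕ × (Fin k → ℕ) × List (Fin k)

/-- The effect of a factor on the state of the scan. A nonempty factor is accepted if its first
letter has already occurred `T` times and if no empty factor was skipped: the empty factors only
fill up the factorization, and have to come last in order not to be counted several times. -/
def scanStep (s : ScanState k) (t : Summary k T) : ScanState k :=
  if s.1 = 3 then (0, fun i => t.count i, [])
  else match t.head with
    | none => (max s.1 1, s.2)
    | some a => if s.1 = 0 ∧ s.2.1 a = T then
        (0, fun i => min (s.2.1 i + t.count i) T, a :: s.2.2) else (2, s.2)

/-- The value at the end of a scan: an iterated difference of `P`. -/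
noncomputable def scanValue (P : MvPolynomial (Fin k) ℤ) (s : ScanState k) : ℕ :=
  if s.1 = 2 then 0 else (mdiff 1 s.2.2 (polyFun P) s.2.1).toNat

/-- The production function of the star-free function of the polynomial `P`. -/
noncomputable def scanProduction (P : MvPolynomial (Fin k) ℤ) (T N : ℕ)
    (t : Fin (N + 1) → Summary k T) : ℕ :=
  scanValue P ((List.ofFn t).foldl scanStep (3, 0, []))

/-- The sum of the values of the scans, from a given state, of the factorizations of `w` into `n`
factors. -/
noncomputable def scanSum (P : MvPolynomial (Fin k) ℤ) (T n : ℕ) (s : ScanState k)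
    (w : List (Fin k)) : ℕ :=
  facSum n (fun l => scanValue P
    ((l.map fun u => summary k T (FreeMonoid.ofList u)).foldl scanStep s)) w

variable {P : MvPolynomial (Fin k) ℤ}

theorem scanSum_succ (n : ℕ) (s : ScanState k) (w : List (Fin k)) :
    scanSum P T (n + 1) s w =
      splitSum (fun p q => scanSum P T n (scanStep s (summary k T (FreeMonoid.ofList p))) q) w :=
  rfl

theorem scanStep_cons (s : ScanState k) (hs : s.1 ≠ 3) (a : Fin k) (p : List (Fin k)) :
    scanStep s (summary k T (FreeMonoid.ofList (a :: p))) = if s.1 = 0 ∧ s.2.1 a = T then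
      (0, fun i => min (s.2.1 i + (a :: p).count i) T, a :: s.2.2) else (2, s.2) := by
  have h : ∀ i, min (s.2.1 i + min ((a :: p).count i) T) T =
      min (s.2.1 i + (a :: p).count i) T := fun i => by omega
  rw [scanStep, if_neg hs, summary_cons_head]
  simp only [summary_count, h]

theorem scanSum_rejected (n : ℕ) (s : (Fin k → ℕ) × List (Fin k)) (w : List (Fin k)) :
    scanSum P T n (2, s) w = 0 := by
  induction n generalizing w with
  | zero => cases w <;> simp [scanSum, facSum, scanValue]
  | succ n ih =>
    rw [scanSum_succ, splitSum_congr (ψ' := fun _ _ => 0), splitSum_zero]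
    intro p q
    have : scanStep (2, s) (summary k T (FreeMonoid.ofList p)) = (2, s) := by
      cases p with
      | nil => rfl
      | cons a p => rw [scanStep_cons _ (by simp), if_neg (by simp)]
    rw [this, ih]

theorem scanSum_nil (n : ℕ) {s : ScanState k} (hs : s.1 ≤ 1) :
    scanSum P T n s [] = (mdiff 1 s.2.2 (polyFun P) s.2.1).toNat := by
  rw [scanSum, facSum_nil]
  induction n generalizing s with
  | zero =>
    simp only [List.replicate_zero, List.map_nil, List.foldl_nil, scanValue]
    rw [if_neg (by omega)]
  | succ n ih =>
    have h : scanStep s (summary k T (FreeMonoid.ofList [])) = (max s.1 1, s.2) := by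
      rw [scanStep, if_neg (by omega), summary_nil]
    rw [List.replicate_succ, List.map_cons, List.foldl_cons, h, ih (by simpa using hs)]

theorem scanSum_skipped (n : ℕ) (s : (Fin k → ℕ) × List (Fin k)) (a : Fin k) (w : List (Fin k)) :
    scanSum P T n (1, s) (a :: w) = 0 := by
  induction n with
  | zero => rfl
  | succ n ih =>
    have h : scanStep (1, s) (summary k T (FreeMonoid.ofList [])) = (1, s) := rfl
    rw [scanSum_succ, splitSum, h, ih, zero_add, splitSum_congr (ψ' := fun _ _ => 0), splitSum_zero]
    intro p q
    have : scanStep (1, s) (summary k T (FreeMonoid.ofList (a :: p))) = (2, s) := by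
      rw [scanStep_cons _ (by simp), if_neg (by simp)]
    rw [this, scanSum_rejected]

/-- The heart of the construction. Suppose that the letters read so far are counted by `c`, up to
the cap, and that the factors chosen so far start with the letters of `L`. Then the sum over the
ways to choose a prefix `p` of `w` as the remainder of the current factor, and a factorization of
the rest, is the iterated difference of `P` along `L` at `c + |w|`. Reading a letter `a` either
extends the current factor, or, if `c a = T`, starts a new one; this is the identity
`g (x + e_a) = g x + (g (x + e_a) - g x)`. -/
theorem splitSum_scanSum {N : ℕ} (hN : ∀ m ∈ P.support, ∑ i, m i ≤ N) (hT : IsThreshold P T)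
    (w : List (Fin k)) (n : ℕ) (c : Fin k → ℕ) (L : List (Fin k)) (hc : ∀ i, c i ≤ T)
    (hL : ∀ i ∈ L, c i = T) (hn : N ≤ n + L.length) :
    (splitSum (fun p q => scanSum P T n (0, fun i => min (c i + p.count i) T, L) q) w : ℤ) =
      mdiff 1 L (polyFun P) fun i => c i + w.count i := by
  induction w generalizing n c L with
  | nil =>
    have h1 : (fun i => min (c i + ([] : List (Fin k)).count i) T) = c := by
      ext i
      simpa using hc i
    rw [splitSum, scanSum_nil n (by simp), h1]
    simp only [List.count_nil, add_zero]
    exact Int.toNat_of_nonneg (hT c hc L hL)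
  | cons a w ih =>
    -- the counts after reading `a`
    set c' : Fin k → ℕ := fun i => min (c i + (Pi.single a 1 : Fin k → ℕ) i) T with hc'
    have hsingle : ∀ i, (a :: w).count i = w.count i + (Pi.single a 1 : Fin k → ℕ) i := by
      intro i
      rw [List.count_cons]
      rcases eq_or_ne a i with rfl | h
      · simp
      · simp [h]
    have hcount : ∀ (p : List (Fin k)) i,
        min (c i + (a :: p).count i) T = min (c' i + p.count i) T := by
      intro p i
      have : (a :: p).count i = p.count i + (Pi.single a 1 : Fin k → ℕ) i := by
        rw [List.count_cons]
        rcases eq_or_ne a i with rfl | h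
        · simp
        · simp [h]
      rw [this, hc']
      simp only
      omega
    have hc'T : ∀ i, c' i ≤ T := fun i => min_le_right _ _
    have hc'L : ∀ i ∈ L, c' i = T := fun i hi => by
      have := hL i hi
      simp only [hc']
      omega
    rw [splitSum]
    simp only [List.count_nil, add_zero, hcount]
    push_cast
    rw [ih n c' L hc'T hc'L hn]
    have hcc : (fun i => min (c i) T) = c := by
      ext i
      simpa using hc i
    rw [hcc]
    by_cases haT : c a = T
    · have hcc' : c' = c := by
        ext i
        have := hc i
        rcases eq_or_ne i a with rfl | h
        · simp [hc', haT]
        · simpa [hc', h] using this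
      have hstep : mdiff 1 (a :: L) (polyFun P) (fun i => c i + w.count i) =
          mdiff 1 L (polyFun P) (fun i => c i + (a :: w).count i) -
            mdiff 1 L (polyFun P) (fun i => c i + w.count i) := by
        rw [mdiff]
        congr 2
        ext i
        simp only [Pi.add_apply, hsingle, Pi.one_apply]
        omega
      rw [hcc']
      cases n with
      | zero =>
        have h0 : scanSum P T 0 (0, c, L) (a :: w) = 0 := rfl
        have h1 : mdiff 1 (a :: L) (polyFun P) (fun i => c i + w.count i) = 0 :=
          mdiff_polyFun_eq_zero hN 1 (by simp only [List.length_cons]; omega) _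
        rw [h0]
        push_cast
        linarith
      | succ n =>
        have h1 := ih n c (a :: L) hc (by simpa using ⟨haT, hL⟩)
          (by simp only [List.length_cons]; omega)
        rw [hstep] at h1
        have h2 : scanSum P T (n + 1) (0, c, L) (a :: w) =
            splitSum (fun p q =>
              scanSum P T n (0, fun i => min (c i + p.count i) T, a :: L) q) w := by
          have h3 : scanStep (0, c, L) (summary k T (FreeMonoid.ofList [])) = (1, c, L) := rfl
          rw [scanSum_succ, splitSum, h3, scanSum_skipped, zero_add]
          refine splitSum_congr (fun p q => ?_) w
          congr 1
          rw [scanStep_cons _ (by simp), if_pos ⟨rfl, haT⟩]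
          simp only [hcount, hcc']
        rw [h2, h1]
        ring
    · have h0 : scanSum P T n (0, c, L) (a :: w) = 0 := by
        cases n with
        | zero => rfl
        | succ n =>
          have h3 : scanStep (0, c, L) (summary k T (FreeMonoid.ofList [])) = (1, c, L) := rfl
          rw [scanSum_succ, splitSum, h3, scanSum_skipped, zero_add,
            splitSum_congr (ψ' := fun _ _ => 0), splitSum_zero]
          intro p q
          have : scanStep (0, c, L) (summary k T (FreeMonoid.ofList (a :: p))) = (2, c, L) := by
            rw [scanStep_cons _ (by simp), if_neg (by simpa using haT)]
          rw [this, scanSum_rejected]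
      rw [h0]
      push_cast
      rw [zero_add]
      congr 1
      ext i
      have := hc i
      rw [hsingle]
      rcases eq_or_ne i a with rfl | h
      · simp only [hc', Pi.single_eq_same]
        omega
      · simp only [hc', Pi.single_eq_of_ne h]
        omega

theorem polyregularFun_scanProduction {N : ℕ} (hN : ∀ m ∈ P.support, ∑ i, m i ≤ N)
    (hT : IsThreshold P T) (w : List (Fin k)) :
    (polyregularFun (summary k T) (scanProduction P T N) w : ℤ) = polyFun P fun i => w.count i := by
  have h1 : polyregularFun (summary k T) (scanProduction P T N) w =
      scanSum P T (N + 1) (3, 0, []) w := by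
    rw [polyregularFun, scanSum, ← sum_factorizations]
    refine Finset.sum_congr rfl fun u _ => ?_
    rw [scanProduction, List.map_ofFn]
    rfl
  have h2 := splitSum_scanSum hN hT w N 0 [] (fun _ => Nat.zero_le _) (by simp) (by simp)
  rw [h1, scanSum_succ]
  simp only [Pi.zero_apply, zero_add] at h2
  rw [mdiff] at h2
  rw [← h2]
  congr 1
  refine splitSum_congr (fun p q => ?_) w
  congr 1
  simp only [scanStep, if_true, summary_count]

theorem count_dagger_id (x : Fin k → ℕ) (i : Fin k) : (dagger id x).count i = x i := by
  rw [dagger, List.count_flatten, List.map_ofFn, List.sum_ofFn, Finset.sum_eq_single i]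
  · simp
  · intro j _ hj
    simp [List.count_replicate, hj]
  · simp

theorem representsVia_scanProduction {N : ℕ} (hN : ∀ m ∈ P.support, ∑ i, m i ≤ N)
    (hT : IsThreshold P T) :
    RepresentsVia id (polyregularFun (summary k T) (scanProduction P T N)) P := by
  constructor
  · intro u v huv
    have h1 := polyregularFun_scanProduction hN hT u
    rw [show (fun i => u.count i) = fun i => v.count i from funext fun i => huv.count_eq i,
      ← polyregularFun_scanProduction hN hT v] at h1
    exact_mod_cast h1
  · intro x
    rw [polyregularFun_scanProduction hN hT]
    simp only [count_dagger_id]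
    rfl

end StarFree

/-! ### Primitive recursive functions on lists and integers -/

-- The following lemmas are stated in compositional form, for the tactic `fun_prop`.
attribute [fun_prop] Primrec
attribute [fun_prop] PrimrecPred
attribute [fun_prop] Primrec.id Primrec.const Primrec.comp Primrec.pair

section PrimrecTools

variable {α β γ σ : Type*} [Primcodable α] [Primcodable β] [Primcodable γ] [Primcodable σ]

@[fun_prop] theorem primrec_fst {f : α → β × γ} (hf : Primrec f) : Primrec fun a => (f a).1 :=
  Primrec.fst.comp hf

@[fun_prop] theorem primrec_snd {f : α → β × γ} (hf : Primrec f) : Primrec fun a => (f a).2 :=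
  Primrec.snd.comp hf

@[fun_prop] theorem primrec_nat_add {f g : α → ℕ} (hf : Primrec f) (hg : Primrec g) :
    Primrec fun a => f a + g a := Primrec.nat_add.comp hf hg

@[fun_prop] theorem primrec_nat_sub {f g : α → ℕ} (hf : Primrec f) (hg : Primrec g) :
    Primrec fun a => f a - g a := Primrec.nat_sub.comp hf hg

@[fun_prop] theorem primrec_nat_mul {f g : α → ℕ} (hf : Primrec f) (hg : Primrec g) :
    Primrec fun a => f a * g a := Primrec.nat_mul.comp hf hg

@[fun_prop] theorem primrec_nat_div {f g : α → ℕ} (hf : Primrec f) (hg : Primrec g) :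
    Primrec fun a => f a / g a := Primrec.nat_div.comp hf hg

@[fun_prop] theorem primrec_nat_mod {f g : α → ℕ} (hf : Primrec f) (hg : Primrec g) :
    Primrec fun a => f a % g a := Primrec.nat_mod.comp hf hg

@[fun_prop] theorem primrec_nat_pow {f g : α → ℕ} (hf : Primrec f) (hg : Primrec g) :
    Primrec fun a => f a ^ g a := (Primrec₂.unpaired'.1 Nat.Primrec.pow).comp hf hg

@[fun_prop] theorem primrec_nat_max {f g : α → ℕ} (hf : Primrec f) (hg : Primrec g) :
    Primrec fun a => max (f a) (g a) := Primrec.nat_max.comp hf hg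

@[fun_prop] theorem primrec_nat_min {f g : α → ℕ} (hf : Primrec f) (hg : Primrec g) :
    Primrec fun a => min (f a) (g a) := Primrec.nat_min.comp hf hg

@[fun_prop] theorem primrec_ite {c : α → Prop} [DecidablePred c] {f g : α → σ}
    (hc : PrimrecPred c) (hf : Primrec f) (hg : Primrec g) :
    Primrec fun a => if c a then f a else g a := Primrec.ite hc hf hg

@[fun_prop] theorem primrecPred_eq {f g : α → β} (hf : Primrec f) (hg : Primrec g) :
    PrimrecPred fun a => f a = g a := Primrec.eq.comp hf hg

@[fun_prop] theorem primrecPred_nat_le {f g : α → ℕ} (hf : Primrec f) (hg : Primrec g) :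
    PrimrecPred fun a => f a ≤ g a := Primrec.nat_le.comp hf hg

@[fun_prop] theorem primrecPred_nat_lt {f g : α → ℕ} (hf : Primrec f) (hg : Primrec g) :
    PrimrecPred fun a => f a < g a := Primrec.nat_lt.comp hf hg

@[fun_prop] theorem primrecPred_and {p q : α → Prop} (hp : PrimrecPred p) (hq : PrimrecPred q) :
    PrimrecPred fun a => p a ∧ q a := hp.and hq

@[fun_prop] theorem primrecPred_or {p q : α → Prop} (hp : PrimrecPred p) (hq : PrimrecPred q) :
    PrimrecPred fun a => p a ∨ q a := hp.or hq

@[fun_prop] theorem primrecPred_not {p : α → Prop} (hp : PrimrecPred p) :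
    PrimrecPred fun a => ¬ p a := hp.not

@[fun_prop] theorem primrecPred_imp {p q : α → Prop} (hp : PrimrecPred p) (hq : PrimrecPred q) :
    PrimrecPred fun a => p a → q a := (hp.not.or hq).of_eq fun _ => imp_iff_not_or.symm

@[fun_prop] theorem primrecPred_forall_mem {f : α → List β} {p : α → β → Prop} (hf : Primrec f)
    (hp : PrimrecPred fun x : α × β => p x.1 x.2) : PrimrecPred fun a => ∀ b ∈ f a, p a b := by
  have h : PrimrecRel fun (b : β) (a : α) => p a b :=
    PrimrecPred.primrecRel (p := fun x : β × α => p x.2 x.1)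
      (hp.comp (Primrec.pair Primrec.snd Primrec.fst))
  exact PrimrecRel.comp h.forall_mem_list hf Primrec.id

@[fun_prop] theorem primrecPred_mem {f : α → β} {g : α → List β} (hf : Primrec f)
    (hg : Primrec g) : PrimrecPred fun a => f a ∈ g a := by
  have h : PrimrecPred fun a => ¬ ∀ b ∈ g a, ¬ b = f a := by fun_prop
  exact h.of_eq fun a => by simp

@[fun_prop] theorem primrec_list_map {f : α → List β} {g : α → β → σ} (hf : Primrec f)
    (hg : Primrec fun p : α × β => g p.1 p.2) : Primrec fun a => (f a).map (g a) :=
  Primrec.list_map hf hg.to₂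

@[fun_prop] theorem primrec_list_flatMap {f : α → List β} {g : α → β → List σ} (hf : Primrec f)
    (hg : Primrec fun p : α × β => g p.1 p.2) : Primrec fun a => (f a).flatMap (g a) :=
  Primrec.list_flatMap hf hg.to₂

@[fun_prop] theorem primrec_list_foldl {f : α → List β} {g : α → σ} {h : α → σ → β → σ}
    (hf : Primrec f) (hg : Primrec g) (hh : Primrec fun p : α × σ × β => h p.1 p.2.1 p.2.2) :
    Primrec fun a => (f a).foldl (h a) (g a) :=
  Primrec.list_foldl (h := fun a s => h a s.1 s.2) hf hg hh.to₂

@[fun_prop] theorem primrec_list_foldr {f : α → List β} {g : α → σ} {h : α → β → σ → σ}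
    (hf : Primrec f) (hg : Primrec g) (hh : Primrec fun p : α × β × σ => h p.1 p.2.1 p.2.2) :
    Primrec fun a => (f a).foldr (h a) (g a) :=
  Primrec.list_foldr (h := fun a s => h a s.1 s.2) hf hg hh.to₂

@[fun_prop] theorem primrec_list_range {f : α → ℕ} (hf : Primrec f) :
    Primrec fun a => List.range (f a) := Primrec.list_range.comp hf

@[fun_prop] theorem primrec_list_length {f : α → List β} (hf : Primrec f) :
    Primrec fun a => (f a).length := Primrec.list_length.comp hf

@[fun_prop] theorem primrec_list_tail {f : α → List β} (hf : Primrec f) :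
    Primrec fun a => (f a).tail := Primrec.list_tail.comp hf

@[fun_prop] theorem primrec_list_append {f g : α → List β} (hf : Primrec f) (hg : Primrec g) :
    Primrec fun a => f a ++ g a := Primrec.list_append.comp hf hg

@[fun_prop] theorem primrec_list_cons {f : α → β} {g : α → List β} (hf : Primrec f)
    (hg : Primrec g) : Primrec fun a => f a :: g a := Primrec.list_cons.comp hf hg

@[fun_prop] theorem primrec_list_getD {f : α → List β} {g : α → ℕ} {d : β} (hf : Primrec f)
    (hg : Primrec g) : Primrec fun a => (f a).getD (g a) d := (Primrec.list_getD d).comp hf hg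

@[fun_prop] theorem primrec_list_idxOf [BEq β] [LawfulBEq β] {f : α → List β} {g : α → β}
    (hf : Primrec f) (hg : Primrec g) : Primrec fun a => (f a).idxOf (g a) := by
  classical
  have h : (inferInstance : BEq β) = instBEqOfDecidableEq := lawful_beq_subsingleton _ _
  subst h
  exact Primrec.list_idxOf.comp hg hf

@[fun_prop] theorem primrec_list_lookup [BEq β] [LawfulBEq β] {f : α → List (β × γ)}
    {g : α → β} (hf : Primrec f) (hg : Primrec g) : Primrec fun a => (f a).lookup (g a) := by
  classical
  have h : (inferInstance : BEq β) = instBEqOfDecidableEq := lawful_beq_subsingleton _ _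
  subst h
  exact Primrec.listLookup.comp hg hf

@[fun_prop] theorem primrec_option_getD {f : α → Option β} {d : β} (hf : Primrec f) :
    Primrec fun a => (f a).getD d := Primrec.option_getD.comp hf (Primrec.const d)

@[fun_prop] theorem primrec_list_sum_nat {f : α → List ℕ} (hf : Primrec f) :
    Primrec fun a => (f a).sum := by
  have : (fun a => (f a).sum) = fun a => (f a).foldr (fun x y => x + y) 0 := by
    ext a
    rw [List.sum]
  rw [this]
  fun_prop

@[fun_prop] theorem primrec_list_prod_nat {f : α → List ℕ} (hf : Primrec f) :
    Primrec fun a => (f a).prod := by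
  have : (fun a => (f a).prod) = fun a => (f a).foldr (fun x y => x * y) 1 := by
    ext a
    rw [List.prod]
  rw [this]
  fun_prop

/-! Integers are coded by natural numbers: `n` by `2 n` and `-(n + 1)` by `2 n + 1`. -/

@[fun_prop] theorem primrec_int_toNat {f : α → ℤ} (hf : Primrec f) :
    Primrec fun a => (f a).toNat := by
  have : (fun z : ℤ => z.toNat) =
      fun z => if Encodable.encode z % 2 = 0 then Encodable.encode z / 2 else 0 := by
    ext z
    cases z with
    | ofNat n =>
      change n = if (2 * n) % 2 = 0 then (2 * n) / 2 else 0
      rw [if_pos (by omega)]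
      omega
    | negSucc n =>
      change 0 = if (2 * n + 1) % 2 = 0 then (2 * n + 1) / 2 else 0
      rw [if_neg (by omega)]
  have h : Primrec fun z : ℤ => z.toNat := by
    rw [this]
    have := Primrec.encode (α := ℤ)
    fun_prop
  exact h.comp hf

@[fun_prop] theorem primrec_int_neg_toNat {f : α → ℤ} (hf : Primrec f) :
    Primrec fun a => (-f a).toNat := by
  have : (fun z : ℤ => (-z).toNat) =
      fun z => if Encodable.encode z % 2 = 0 then 0 else Encodable.encode z / 2 + 1 := by
    ext z
    cases z with
    | ofNat n =>
      change (-(n : ℤ)).toNat = if (2 * n) % 2 = 0 then 0 else (2 * n) / 2 + 1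
      rw [if_pos (by omega)]
      omega
    | negSucc n =>
      change (-(Int.negSucc n)).toNat =
        if (2 * n + 1) % 2 = 0 then 0 else (2 * n + 1) / 2 + 1
      rw [if_neg (by omega)]
      omega
  have h : Primrec fun z : ℤ => (-z).toNat := by
    rw [this]
    have := Primrec.encode (α := ℤ)
    fun_prop
  exact h.comp hf

@[fun_prop] theorem primrec_natCast_sub {f g : α → ℕ} (hf : Primrec f) (hg : Primrec g) :
    Primrec fun a => (f a : ℤ) - (g a : ℤ) := by
  refine Primrec.encode_iff.1 ?_
  have : (fun a => Encodable.encode ((f a : ℤ) - (g a : ℤ))) =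
      fun a => if g a ≤ f a then 2 * (f a - g a) else 2 * (g a - f a - 1) + 1 := by
    ext a
    split_ifs with h
    · obtain ⟨n, hn⟩ := Nat.exists_eq_add_of_le h
      rw [hn, show ((g a + n : ℕ) : ℤ) - (g a : ℤ) = Int.ofNat n by simp]
      change 2 * n = _
      omega
    · obtain ⟨n, hn⟩ := Nat.exists_eq_add_of_lt (not_le.1 h)
      rw [hn, show (f a : ℤ) - ((f a + n + 1 : ℕ) : ℤ) = Int.negSucc n by
        rw [Int.negSucc_eq]; push_cast; ring]
      change 2 * n + 1 = _
      omega
  rw [this]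
  fun_prop

@[fun_prop] theorem primrec_natCast {f : α → ℕ} (hf : Primrec f) :
    Primrec fun a => (f a : ℤ) := by
  have h := primrec_natCast_sub hf (Primrec.const 0)
  simpa using h

@[fun_prop] theorem primrec_int_add {f g : α → ℤ} (hf : Primrec f) (hg : Primrec g) :
    Primrec fun a => f a + g a := by
  have : (fun a => f a + g a) = fun a => (((f a).toNat + (g a).toNat : ℕ) : ℤ) -
      (((-f a).toNat + (-g a).toNat : ℕ) : ℤ) := by
    ext a
    omega
  rw [this]
  fun_prop

@[fun_prop] theorem primrec_int_sub {f g : α → ℤ} (hf : Primrec f) (hg : Primrec g) :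
    Primrec fun a => f a - g a := by
  have : (fun a => f a - g a) = fun a => (((f a).toNat + (-g a).toNat : ℕ) : ℤ) -
      (((-f a).toNat + (g a).toNat : ℕ) : ℤ) := by
    ext a
    omega
  rw [this]
  fun_prop

@[fun_prop] theorem primrec_int_mul {f g : α → ℤ} (hf : Primrec f) (hg : Primrec g) :
    Primrec fun a => f a * g a := by
  have : (fun a => f a * g a) = fun a =>
      (((f a).toNat * (g a).toNat + (-f a).toNat * (-g a).toNat : ℕ) : ℤ) -
      (((f a).toNat * (-g a).toNat + (-f a).toNat * (g a).toNat : ℕ) : ℤ) := by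
    ext a
    have h1 : f a = ((f a).toNat : ℤ) - ((-f a).toNat : ℤ) := by omega
    have h2 : g a = ((g a).toNat : ℤ) - ((-g a).toNat : ℤ) := by omega
    simp only [Nat.cast_add, Nat.cast_mul]
    conv_lhs => rw [h1, h2]
    ring
  rw [this]
  fun_prop

@[fun_prop] theorem primrec_list_sum_int {f : α → List ℤ} (hf : Primrec f) :
    Primrec fun a => (f a).sum := by
  have : (fun a => (f a).sum) = fun a => (f a).foldr (fun x y => x + y) 0 := by
    ext a
    rw [List.sum]
  rw [this]
  fun_prop

@[fun_prop] theorem primrecPred_int_le {f g : α → ℤ} (hf : Primrec f) (hg : Primrec g) :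
    PrimrecPred fun a => f a ≤ g a := by
  have h : PrimrecPred fun a => (f a - g a).toNat = 0 := by fun_prop
  exact h.of_eq fun a => by omega

@[fun_prop] theorem primrecPred_int_lt {f g : α → ℤ} (hf : Primrec f) (hg : Primrec g) :
    PrimrecPred fun a => f a < g a := by
  have h : PrimrecPred fun a => ¬ g a ≤ f a := by fun_prop
  exact h.of_eq fun a => not_le

/-! ### Computable search -/

/-- A total relation that is primitive recursive has a computable choice function. -/
theorem exists_computable_choice {R : α → β → Prop} (hR : PrimrecPred fun p : α × β => R p.1 p.2)
    (htot : ∀ a, ∃ b, R a b) : ∃ f : α → β, Computable f ∧ ∀ a, R a (f a) := by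
  classical
  let s : α → ℕ → Option β := fun a n =>
    (Encodable.decode (α := β) n).bind fun b => if R a b then some b else none
  have hs : Computable₂ s := by
    refine Primrec.to_comp (Primrec.option_bind (Primrec.decode.comp Primrec.snd) ?_)
    have h1 : Primrec fun p : (α × ℕ) × β => (p.1.1, p.2) := by fun_prop
    exact Primrec.to₂ (Primrec.ite (hR.comp h1) (Primrec.option_some.comp Primrec.snd)
      (Primrec.const none))
  have hmem : ∀ a n b, b ∈ s a n → R a b := by
    intro a n b h
    obtain ⟨b', -, h'⟩ := Option.bind_eq_some_iff.1 h
    split_ifs at h' with hab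
    · obtain rfl : b' = b := by simpa using h'
      exact hab
  have hdom : ∀ a, (Nat.rfindOpt (s a)).Dom := by
    intro a
    obtain ⟨b, hb⟩ := htot a
    refine Nat.rfindOpt_dom.2 ⟨Encodable.encode b, b, ?_⟩
    simp [s, hb]
  refine ⟨fun a => (Nat.rfindOpt (s a)).get (hdom a),
    (Partrec.rfindOpt hs).of_eq_tot fun a => Part.get_mem _, fun a => ?_⟩
  obtain ⟨n, hn⟩ := Nat.rfindOpt_spec (Part.get_mem (hdom a))
  exact hmem a n _ hn

/-! ### Enumerations of codes -/

/-- The lists of length `n` of numbers less than `b`. -/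
def grid (n b : ℕ) : List (List ℕ) :=
  Nat.rec [[]] (fun _ G => (List.range b).flatMap fun x => G.map (x :: ·)) n

@[fun_prop] theorem primrec_grid {f g : α → ℕ} (hf : Primrec f) (hg : Primrec g) :
    Primrec fun a => grid (f a) (g a) := by
  have h : Primrec fun p : α × ℕ × List (List ℕ) =>
      (List.range (g p.1)).flatMap fun x => p.2.2.map (x :: ·) := by fun_prop
  exact Primrec.nat_rec' hf (Primrec.const [[]]) h.to₂

theorem grid_succ (n b : ℕ) :
    grid (n + 1) b = (List.range b).flatMap fun x => (grid n b).map (x :: ·) := rfl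

theorem mem_grid {n b : ℕ} {l : List ℕ} : l ∈ grid n b ↔ l.length = n ∧ ∀ x ∈ l, x < b := by
  induction n generalizing l with
  | zero =>
    constructor
    · intro h
      have : l = [] := by simpa [grid] using h
      simp [this]
    · intro h
      simp [grid, List.length_eq_zero_iff.1 h.1]
  | succ n ih =>
    cases l with
    | nil => simp [grid_succ]
    | cons y l =>
      simp only [grid_succ, List.mem_flatMap, List.mem_range, List.mem_map, ih, List.length_cons,
        List.mem_cons, forall_eq_or_imp, List.cons.injEq]
      constructor
      · rintro ⟨x, hx, l', ⟨h1, h2⟩, rfl, rfl⟩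
        exact ⟨by omega, hx, h2⟩
      · rintro ⟨h1, h2, h3⟩
        exact ⟨y, h2, l, ⟨by omega, h3⟩, rfl, rfl⟩

theorem nodup_flatMap_cons {L : List ℕ} (hL : L.Nodup) {G : List (List ℕ)} (hG : G.Nodup) :
    (L.flatMap fun x => G.map (x :: ·)).Nodup := by
  rw [List.nodup_flatMap]
  refine ⟨fun x _ => hG.map fun _ _ h => (List.cons.inj h).2, hL.imp ?_⟩
  intro x y hne l hl hl'
  obtain ⟨m, -, rfl⟩ := List.mem_map.1 hl
  obtain ⟨m', -, h⟩ := List.mem_map.1 hl'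
  exact hne (List.cons.inj h).1.symm

theorem nodup_grid (n b : ℕ) : (grid n b).Nodup := by
  induction n with
  | zero => simp [grid]
  | succ n ih => exact nodup_flatMap_cons List.nodup_range ih

theorem ofFn_mem_grid {n b : ℕ} {x : Fin n → ℕ} : List.ofFn x ∈ grid n b ↔ ∀ i, x i < b := by
  simp [mem_grid, List.mem_ofFn]

theorem exists_ofFn {β : Type*} {n : ℕ} {l : List β} (hl : l.length = n) :
    ∃ x : Fin n → β, l = List.ofFn x := by
  subst hl
  exact ⟨l.get, (List.ofFn_get l).symm⟩

theorem exists_map_val {n : ℕ} {l : List ℕ} (hl : ∀ x ∈ l, x < n) :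
    ∃ L : List (Fin n), l = L.map Fin.val := by
  induction l with
  | nil => exact ⟨[], rfl⟩
  | cons x l ih =>
    obtain ⟨L, hL⟩ := ih fun y hy => hl y (List.mem_cons_of_mem _ hy)
    exact ⟨⟨x, hl x List.mem_cons_self⟩ :: L, congrArg (x :: ·) hL⟩

theorem map_range_eq_ofFn {β : Type*} (n : ℕ) (f : ℕ → β) :
    (List.range n).map f = List.ofFn fun i : Fin n => f i := by
  refine List.ext_getElem (by simp) fun i _ _ => by simp

theorem getD_map_of_lt {β γ : Type*} {l : List β} {i : ℕ} (hi : i < l.length) (f : β → γ) (b : β)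
    (c : γ) : (l.map f).getD i c = f (l.getD i b) := by
  simp [List.getD_eq_getElem?_getD, hi]

theorem lookup_map_self {β γ : Type*} [BEq β] [LawfulBEq β] {l : List β} {b : β} (hb : b ∈ l)
    (f : β → γ) :
    (l.map fun x => (x, f x)).lookup b = some (f b) := by
  induction l with
  | nil => simp at hb
  | cons x l ih =>
    classical
    rw [List.map_cons, List.lookup_cons]
    by_cases h : b = x
    · simp [h]
    · rw [beq_false_of_ne h]
      exact ih ((List.mem_cons.1 hb).resolve_left h)

/-- A list without repetitions of the codes of the elements of a type numbers these elements. -/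
theorem exists_numbering {β S : Type*} [BEq β] [LawfulBEq β] {E : List β} (hE : E.Nodup)
    (enc : S → β) (hinj : Function.Injective enc) (hmem : ∀ b, b ∈ E ↔ b ∈ Set.range enc) :
    ∃ e : S ≃ Fin E.length, ∀ s, (e s : ℕ) = E.idxOf (enc s) ∧ ∀ b, E.getD (e s) b = enc s := by
  have hlt : ∀ s, E.idxOf (enc s) < E.length := fun s =>
    List.idxOf_lt_length_iff.2 ((hmem _).2 ⟨s, rfl⟩)
  have hbij : Function.Bijective fun s => (⟨E.idxOf (enc s), hlt s⟩ : Fin E.length) := by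
    refine ⟨fun s t h => hinj ?_, fun i => ?_⟩
    · have h' : E.idxOf (enc s) = E.idxOf (enc t) := congrArg Fin.val h
      exact (List.idxOf_inj ((hmem _).2 ⟨s, rfl⟩)).1 h'
    · obtain ⟨s, hs⟩ := (hmem _).1 (List.getElem_mem i.2)
      refine ⟨s, Fin.ext ?_⟩
      simp only [hs]
      exact hE.idxOf_getElem _ i.2
  refine ⟨Equiv.ofBijective _ hbij, fun s => ⟨rfl, fun b => ?_⟩⟩
  simp only [Equiv.ofBijective_apply]
  rw [List.getD_eq_getElem _ _ (hlt s), List.getElem_idxOf]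

end PrimrecTools

/-! ### Computing with codes of polynomials -/

section Codes

variable {k : ℕ}

/-- The value at `x` of the polynomial in `k` indeterminates written by a code. -/
def evalCode (k : ℕ) (c : PolyCode) (x : List ℕ) : ℤ :=
  (c.map fun t =>
    t.1 * ((((List.range k).map fun i => x.getD i 0 ^ t.2.getD i 0).prod : ℕ) : ℤ)).sum

theorem evalCode_ofFn (c : PolyCode) (x : Fin k → ℕ) :
    evalCode k c (List.ofFn x) = polyFun (c.toPoly k) x := by
  rw [polyFun, PolyCode.toPoly, map_list_sum, List.map_map, evalCode]
  congr 1
  refine List.map_congr_left fun t _ => ?_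
  rw [Function.comp_apply, MvPolynomial.eval_monomial, map_range_eq_ofFn, List.prod_ofFn,
    Finsupp.prod_fintype _ _ fun i => pow_zero _]
  simp only [getD_ofFn]
  push_cast
  rfl

theorem exists_toPoly_eq (P : MvPolynomial (Fin k) ℤ) : ∃ c : PolyCode, c.toPoly k = P := by
  refine ⟨P.support.toList.map fun m => (P.coeff m, List.ofFn m), ?_⟩
  rw [PolyCode.toPoly, List.map_map]
  conv_rhs => rw [P.as_sum, ← Finset.sum_map_toList]
  congr 1
  refine List.map_congr_left fun m _ => ?_
  have : (Finsupp.equivFunOnFinite.symm fun i : Fin k => (List.ofFn m).getD i 0) = m :=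
    Finsupp.ext fun i => getD_ofFn m i 0
  rw [Function.comp_apply, this]

/-- A bound for the total degree of the polynomial written by a code. -/
def degBound (k : ℕ) (c : PolyCode) : ℕ :=
  (c.map fun t => ((List.range k).map fun i => t.2.getD i 0).sum).sum

theorem sum_le_degBound (c : PolyCode) {m : Fin k →₀ ℕ} (hm : m ∈ (c.toPoly k).support) :
    ∑ i, m i ≤ degBound k c := by
  classical
  induction c with
  | nil => simp [PolyCode.toPoly] at hm
  | cons t c ih =>
    have h1 : PolyCode.toPoly (t :: c) k = MvPolynomial.monomial
        (Finsupp.equivFunOnFinite.symm fun i : Fin k => t.2.getD i 0) t.1 +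
          PolyCode.toPoly c k := by
      simp [PolyCode.toPoly]
    have h2 : degBound k (t :: c) =
        ((List.range k).map fun i => t.2.getD i 0).sum + degBound k c := by
      simp [degBound]
    rw [h1] at hm
    rw [h2]
    rcases Finset.mem_union.1 (MvPolynomial.support_add hm) with h | h
    · have h3 := MvPolynomial.support_monomial_subset h
      rw [Finset.mem_singleton] at h3
      subst h3
      rw [map_range_eq_ofFn, List.sum_ofFn]
      exact Nat.le_add_right _ _
    · exact (ih h).trans (Nat.le_add_left _ _)

/-- The point `x` translated by one in the direction `i`. -/
def addUnit (i : ℕ) (x : List ℕ) : List ℕ :=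
  (List.range x.length).map fun j => x.getD j 0 + if j = i then 1 else 0

theorem addUnit_ofFn (i : Fin k) (x : Fin k → ℕ) :
    addUnit i (List.ofFn x) = List.ofFn (x + Pi.single i 1) := by
  rw [addUnit, List.length_ofFn, map_range_eq_ofFn]
  congr 1
  ext j
  simp only [getD_ofFn, Pi.add_apply, Pi.single_apply, Fin.ext_iff]

/-- The points at which a function is evaluated with sign `+`, respectively `-`, in its iterated
difference along `L` at `x`. -/
def diffPoints (L x : List ℕ) : List (List ℕ) × List (List ℕ) :=
  L.foldl (fun s i =>
    (s.1.map (fun y => addUnit i y) ++ s.2, s.2.map (fun y => addUnit i y) ++ s.1)) ([x], [])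

/-- The iterated difference along `L` at `x` of the polynomial written by a code. -/
def diffEval (k : ℕ) (c : PolyCode) (L x : List ℕ) : ℤ :=
  ((diffPoints L x).1.map fun y => evalCode k c y).sum -
    ((diffPoints L x).2.map fun y => evalCode k c y).sum

theorem diffEval_eq_mdiff (c : PolyCode) (L : List (Fin k)) (x : Fin k → ℕ) :
    diffEval k c (L.map Fin.val) (List.ofFn x) = mdiff 1 L (polyFun (c.toPoly k)) x := by
  set f := polyFun (c.toPoly k) with hf
  suffices H : ∀ S : List (Fin k → ℕ) × List (Fin k → ℕ), ∀ S' : List (List ℕ) × List (List ℕ),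
      S' = (L.map Fin.val).foldl (fun s i => (s.1.map (fun y => addUnit i y) ++ s.2,
        s.2.map (fun y => addUnit i y) ++ s.1)) (S.1.map List.ofFn, S.2.map List.ofFn) →
      (S'.1.map fun y => evalCode k c y).sum - (S'.2.map fun y => evalCode k c y).sum =
        (S.1.map (mdiff 1 L f)).sum - (S.2.map (mdiff 1 L f)).sum by
    refine (H ([x], []) _ rfl).trans ?_
    simp
  induction L with
  | nil =>
    rintro S S' rfl
    simp only [List.map_nil, List.foldl_nil, List.map_map, Function.comp_def, evalCode_ofFn, mdiff]
    rfl
  | cons a L ih =>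
    rintro S S' rfl
    have hshift : ∀ U : List (Fin k → ℕ), (U.map List.ofFn).map (fun y => addUnit a y) =
        (U.map fun y : Fin k → ℕ => y + Pi.single a 1).map List.ofFn := by
      intro U
      simp only [List.map_map, Function.comp_def, addUnit_ofFn]
    rw [List.map_cons, List.foldl_cons,
      ih ((S.1.map fun y : Fin k → ℕ => y + Pi.single a 1) ++ S.2,
        (S.2.map fun y : Fin k → ℕ => y + Pi.single a 1) ++ S.1) _
        (by simp only [List.map_append, hshift])]
    have hsum : ∀ U : List (Fin k → ℕ), (U.map (mdiff 1 (a :: L) f)).sum =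
        ((U.map fun y : Fin k → ℕ => y + Pi.single a 1).map (mdiff 1 L f)).sum -
          (U.map (mdiff 1 L f)).sum := by
      intro U
      induction U with
      | nil => rfl
      | cons u U ihU =>
        rw [List.map_cons, List.sum_cons, ihU, mdiff]
        simp only [List.map_cons, List.sum_cons, Pi.one_apply]
        ring
    simp only [List.map_append, List.sum_append, hsum]
    ring

/-! ### Deciding membership in the class -/

/-- The finite part of the statement that `T` is a threshold, for the polynomial in `p.1`
indeterminates with code `p.2`. -/
def CheckThreshold (p : ℕ × PolyCode) (T : ℕ) : Prop :=
  ∀ x ∈ grid p.1 (T + 1), ∀ n ∈ List.range (degBound p.1 p.2 + 1), ∀ L ∈ grid n p.1,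
    (∀ i ∈ L, x.getD i 0 = T) → 0 ≤ diffEval p.1 p.2 L x

theorem checkThreshold_iff {c : PolyCode} {T : ℕ} :
    CheckThreshold (k, c) T ↔ IsThreshold (c.toPoly k) T := by
  constructor
  · intro h x hx L hL
    rcases Nat.lt_or_ge (degBound k c) L.length with hlt | hle
    · exact (mdiff_polyFun_eq_zero (fun m hm => sum_le_degBound c hm) 1 hlt x).ge
    · rw [← diffEval_eq_mdiff]
      refine h _ (ofFn_mem_grid.2 fun i => Nat.lt_succ_of_le (hx i)) L.length
        (List.mem_range.2 (Nat.lt_succ_of_le hle)) _ (mem_grid.2 ⟨by simp, ?_⟩) ?_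
      · simp
      · simpa [-List.getD_eq_getElem?_getD, getD_ofFn] using hL
  · intro h x hx n _ L hL hLT
    obtain ⟨hlen, hxT⟩ := mem_grid.1 hx
    obtain ⟨x, rfl⟩ := exists_ofFn hlen
    obtain ⟨L, rfl⟩ := exists_map_val (mem_grid.1 hL).2
    change 0 ≤ diffEval k c _ _
    rw [diffEval_eq_mdiff]
    refine h x (fun i => Nat.le_of_lt_succ (ofFn_mem_grid.1 hx i)) L fun i hi => ?_
    have := hLT i (List.mem_map_of_mem hi)
    rwa [getD_ofFn] at this

/-- The finite part of the statement that `r = (x, U, L)` is a refutation, for the polynomial in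
`p.1` indeterminates with code `p.2`. -/
def CheckRefutation (p : ℕ × PolyCode) (r : List ℕ × List ℕ × List ℕ) : Prop :=
  r.1.length = p.1 ∧ (∀ i ∈ r.2.2, i < p.1 ∧ i ∈ r.2.1) ∧
    diffEval p.1 p.2 r.2.2 r.1 < 0 ∧
    ∀ n ∈ List.range (degBound p.1 p.2 + 1), ∀ M ∈ grid (n + 1) p.1,
      (∀ i ∈ M, i ∈ r.2.1) → diffEval p.1 p.2 (M ++ r.2.2) r.1 = 0

theorem CheckRefutation.not_isPolyStrNNeg {c : PolyCode} {r : List ℕ × List ℕ × List ℕ}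
    (h : CheckRefutation (k, c) r) : ¬ IsPolyStrNNeg (c.toPoly k) := by
  obtain ⟨x, U, L⟩ := r
  obtain ⟨hlen, hL, hneg, hzero⟩ := h
  obtain ⟨x, rfl⟩ := exists_ofFn hlen
  obtain ⟨L, rfl⟩ := exists_map_val fun i hi => (hL i hi).1
  simp only at hL hneg hzero
  have hU : IsRefutation (c.toPoly k) x (Finset.univ.filter fun i : Fin k => (i : ℕ) ∈ U) L := by
    refine ⟨fun i hi => ?_, ?_, fun M hM hMU => ?_⟩
    · simpa using (hL i (List.mem_map_of_mem hi)).2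
    · rwa [← diffEval_eq_mdiff]
    · rcases Nat.lt_or_ge (degBound k c) (M ++ L).length with hlt | hle
      · exact mdiff_polyFun_eq_zero (fun m hm => sum_le_degBound c hm) 1 hlt x
      · rw [← diffEval_eq_mdiff, List.map_append]
        rw [List.length_append] at hle
        have hpos : M.length ≠ 0 := by simpa using hM
        refine hzero (M.length - 1) (List.mem_range.2 (by omega)) _ (mem_grid.2 ⟨?_, ?_⟩) ?_
        · rw [List.length_map]
          omega
        · simp
        · intro i hi
          obtain ⟨j, hj, rfl⟩ := List.mem_map.1 hi
          simpa using hMU j hj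
  exact hU.not_isPolyStrNNeg

theorem exists_checkRefutation {c : PolyCode} (h : ¬ IsPolyStrNNeg (c.toPoly k)) :
    ∃ r, CheckRefutation (k, c) r := by
  obtain ⟨x, U, L, hL, hneg, hzero⟩ := exists_isRefutation h
  have hU : ∀ i : Fin k, (i : ℕ) ∈ U.toList.map Fin.val ↔ i ∈ U := by
    intro i
    simp [Fin.val_inj]
  refine ⟨(List.ofFn x, U.toList.map Fin.val, L.map Fin.val), by simp, ?_, ?_, ?_⟩
  · intro i hi
    obtain ⟨j, hj, rfl⟩ := List.mem_map.1 hi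
    exact ⟨j.2, (hU j).2 (hL j hj)⟩
  · change diffEval k c _ _ < 0
    rwa [diffEval_eq_mdiff]
  · intro n _ M hM hMU
    obtain ⟨M, rfl⟩ := exists_map_val (mem_grid.1 hM).2
    change diffEval k c _ _ = 0
    rw [← List.map_append, diffEval_eq_mdiff]
    refine hzero M ?_ fun i hi => ?_
    · rintro rfl
      simpa using (mem_grid.1 hM).1
    · exact (hU i).1 (hMU i (List.mem_map_of_mem hi))

section

variable {α : Type*} [Primcodable α]

@[fun_prop] theorem primrec_evalCode {f : α → ℕ} {g : α → PolyCode} {h : α → List ℕ}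
    (hf : Primrec f) (hg : Primrec g) (hh : Primrec h) :
    Primrec fun a => evalCode (f a) (g a) (h a) := by
  unfold evalCode
  fun_prop

@[fun_prop] theorem primrec_degBound {f : α → ℕ} {g : α → PolyCode}
    (hf : Primrec f) (hg : Primrec g) : Primrec fun a => degBound (f a) (g a) := by
  unfold degBound
  fun_prop

@[fun_prop] theorem primrec_addUnit {f : α → ℕ} {g : α → List ℕ}
    (hf : Primrec f) (hg : Primrec g) : Primrec fun a => addUnit (f a) (g a) := by
  unfold addUnit
  fun_prop

@[fun_prop] theorem primrec_diffPoints {f g : α → List ℕ}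
    (hf : Primrec f) (hg : Primrec g) : Primrec fun a => diffPoints (f a) (g a) := by
  unfold diffPoints
  fun_prop

@[fun_prop] theorem primrec_diffEval {f : α → ℕ} {g : α → PolyCode} {h h' : α → List ℕ}
    (hf : Primrec f) (hg : Primrec g) (hh : Primrec h) (hh' : Primrec h') :
    Primrec fun a => diffEval (f a) (g a) (h a) (h' a) := by
  unfold diffEval
  fun_prop

@[fun_prop] theorem primrecPred_checkThreshold {f : α → ℕ × PolyCode} {g : α → ℕ}
    (hf : Primrec f) (hg : Primrec g) : PrimrecPred fun a => CheckThreshold (f a) (g a) := by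
  unfold CheckThreshold
  fun_prop

@[fun_prop] theorem primrecPred_checkRefutation {f : α → ℕ × PolyCode}
    {g : α → List ℕ × List ℕ × List ℕ} (hf : Primrec f) (hg : Primrec g) :
    PrimrecPred fun a => CheckRefutation (f a) (g a) := by
  unfold CheckRefutation
  fun_prop

end

end Codes

/-! ### Tables of the star-free function of a polynomial -/

section StarFreeTables

variable {k T : ℕ}

/-- The code of a summary: its first letter, shifted by one so that `0` stands for the absence of
letters, followed by the counts. -/
def encodeSummary (s : Summary k T) : List ℕ :=
  (match s.head with
    | none => 0
    | some a => (a : ℕ) + 1) :: List.ofFn fun i => (s.count i : ℕ)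

/-- The list of the codes of all summaries. -/
def summaryList (k T : ℕ) : List (List ℕ) :=
  (List.range (k + 1)).flatMap fun h => (grid k (T + 1)).map (h :: ·)

/-- The product of summaries, on codes. -/
def mulSummary (k T : ℕ) (x y : List ℕ) : List ℕ :=
  (if x.getD 0 0 = 0 then y.getD 0 0 else x.getD 0 0) ::
    (List.range k).map fun i => min (x.getD (i + 1) 0 + y.getD (i + 1) 0) T

/-- The code of the summary of a letter. -/
def letterCode (k T a : ℕ) : List ℕ :=
  (a + 1) :: (List.range k).map fun i => if i = a then min 1 T else 0

theorem encodeSummary_head (s : Summary k T) : (encodeSummary s).getD 0 0 =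
    match s.head with
    | none => 0
    | some a => (a : ℕ) + 1 := rfl

theorem encodeSummary_count (s : Summary k T) (i : Fin k) :
    (encodeSummary s).getD (i + 1) 0 = s.count i := by
  rw [encodeSummary, List.getD_cons_succ, getD_ofFn]

theorem encodeSummary_injective : Function.Injective (encodeSummary (k := k) (T := T)) := by
  intro s t h
  obtain ⟨h1, h2⟩ := List.cons.inj h
  refine Summary.ext_val ?_ fun i => congrFun (List.ofFn_injective h2) i
  cases hs : s.head <;> cases ht : t.head <;> simp [hs, ht, Fin.ext_iff] at h1 ⊢
  exact h1

theorem mem_summaryList {x : List ℕ} :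
    x ∈ summaryList k T ↔ x ∈ Set.range (encodeSummary (k := k) (T := T)) := by
  simp only [summaryList, List.mem_flatMap, List.mem_range, List.mem_map, Set.mem_range]
  constructor
  · rintro ⟨h, hh, l, hl, rfl⟩
    obtain ⟨c, rfl⟩ := exists_ofFn (mem_grid.1 hl).1
    rw [ofFn_mem_grid] at hl
    cases h with
    | zero => exact ⟨⟨none, fun i => ⟨c i, hl i⟩⟩, rfl⟩
    | succ a => exact ⟨⟨some ⟨a, by omega⟩, fun i => ⟨c i, hl i⟩⟩, rfl⟩
  · rintro ⟨s, rfl⟩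
    refine ⟨_, ?_, _, ofFn_mem_grid.2 fun i => (s.count i).2, rfl⟩
    cases s.head with
    | none => simp
    | some a =>
      have := a.2
      simp

theorem nodup_summaryList (k T : ℕ) : (summaryList k T).Nodup :=
  nodup_flatMap_cons List.nodup_range (nodup_grid _ _)

theorem mulSummary_encode (s t : Summary k T) :
    mulSummary k T (encodeSummary s) (encodeSummary t) = encodeSummary (s * t) := by
  rw [mulSummary, encodeSummary_head, encodeSummary_head, map_range_eq_ofFn]
  conv_rhs => rw [encodeSummary]
  congr 1
  · rw [Summary.mul_head]
    cases hs : s.head <;> simp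
  · congr 1
    ext i
    rw [encodeSummary_count, encodeSummary_count, Summary.mul_count]

theorem letterCode_eq (a : Fin k) : letterCode k T a = encodeSummary (letterSummary k T a) := by
  rw [letterCode, encodeSummary, map_range_eq_ofFn]
  congr 2
  ext i
  simp only [letterSummary, Fin.ext_iff]
  split_ifs <;> rfl

/-- The scan of a factorization, on codes. -/
def scanStepCode (k T : ℕ) (s : ℕ × List ℕ × List ℕ) (x : List ℕ) : ℕ × List ℕ × List ℕ :=
  if s.1 = 3 then (0, x.tail, [])
  else if x.getD 0 0 = 0 then (max s.1 1, s.2)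
  else if s.1 = 0 ∧ s.2.1.getD (x.getD 0 0 - 1) 0 = T then
    (0, (List.range k).map fun i => min (s.2.1.getD i 0 + x.getD (i + 1) 0) T,
      (x.getD 0 0 - 1) :: s.2.2)
  else (2, s.2)

/-- The code of the state of a scan. -/
def encodeScanState (s : ScanState k) : ℕ × List ℕ × List ℕ :=
  (s.1, List.ofFn s.2.1, s.2.2.map Fin.val)

theorem scanStepCode_encode (s : ScanState k) (t : Summary k T) :
    scanStepCode k T (encodeScanState s) (encodeSummary t) = encodeScanState (scanStep s t) := by
  rw [scanStepCode, scanStep, encodeSummary_head]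
  by_cases h3 : s.1 = 3
  · rw [if_pos (show (encodeScanState s).1 = 3 from h3), if_pos h3]
    rfl
  · rw [if_neg (show ¬ (encodeScanState s).1 = 3 from h3), if_neg h3]
    cases ht : t.head with
    | none => rfl
    | some a =>
      have hget : (encodeScanState s).2.1.getD ((a : ℕ) + 1 - 1) 0 = s.2.1 a :=
        getD_ofFn s.2.1 a 0
      simp only [hget]
      rw [if_neg (Nat.succ_ne_zero _)]
      by_cases h : s.1 = 0 ∧ s.2.1 a = T
      · rw [if_pos (show (encodeScanState s).1 = 0 ∧ s.2.1 a = T from h), if_pos h]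
        simp only [encodeScanState, map_range_eq_ofFn, encodeSummary_count, getD_ofFn,
          List.map_cons, Nat.add_sub_cancel]
      · rw [if_neg (show ¬ ((encodeScanState s).1 = 0 ∧ s.2.1 a = T) from h), if_neg h]
        rfl

theorem foldl_scanStepCode (s : ScanState k) (l : List (Summary k T)) :
    (l.map encodeSummary).foldl (scanStepCode k T) (encodeScanState s) =
      encodeScanState (l.foldl scanStep s) := by
  induction l generalizing s with
  | nil => rfl
  | cons t l ih => rw [List.map_cons, List.foldl_cons, List.foldl_cons, scanStepCode_encode, ih]

/-- The value at the end of a scan, on codes. -/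
def scanValueCode (k : ℕ) (c : PolyCode) (s : ℕ × List ℕ × List ℕ) : ℕ :=
  if s.1 = 2 then 0 else (diffEval k c s.2.2 s.2.1).toNat

theorem scanValueCode_encode (c : PolyCode) (s : ScanState k) :
    scanValueCode k c (encodeScanState s) = scanValue (c.toPoly k) s := by
  rw [scanValueCode, scanValue]
  simp only [encodeScanState, diffEval_eq_mdiff]

/-- The production function of the star-free function of a polynomial, on tuples of numbers of
summaries. -/
def scanProductionCode (k : ℕ) (c : PolyCode) (T : ℕ) (l : List ℕ) : ℕ :=
  scanValueCode k c (l.foldl (fun s j => scanStepCode k T s ((summaryList k T).getD j []))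
    (3, (List.range k).map fun _ => 0, []))

/-- The tables of the star-free function of the polynomial in `p.1` indeterminates with code `p.2`,
for the threshold `T`. -/
def starFreeTables (p : ℕ × PolyCode) (T : ℕ) : PolyregRep :=
  ((p.1, (summaryList p.1 T).length, degBound p.1 p.2,
    (summaryList p.1 T).map fun x => (summaryList p.1 T).map fun y =>
      (summaryList p.1 T).idxOf (mulSummary p.1 T x y),
    (List.range p.1).map fun a => (summaryList p.1 T).idxOf (letterCode p.1 T a),
    (grid (degBound p.1 p.2 + 1) (summaryList p.1 T).length).map fun l =>
      (l, scanProductionCode p.1 p.2 T l)), List.range p.1)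

theorem starFreeTables_represents {c : PolyCode} (hT : IsThreshold (c.toPoly k) T) :
    (starFreeTables (k, c) T).StarFreeRepresents (c.toPoly k) := by
  obtain ⟨e, he⟩ := exists_numbering (nodup_summaryList k T) (encodeSummary (k := k) (T := T))
    encodeSummary_injective fun _ => mem_summaryList
  have hget : ∀ s, (summaryList k T).getD (e s) [] = encodeSummary s := fun s => (he s).2 []
  have hmul : ∀ s t : Summary k T, (((summaryList k T).map fun x => (summaryList k T).map fun y =>
      (summaryList k T).idxOf (mulSummary k T x y)).getD (e s) []).getD (e t) 0 = e (s * t) := by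
    intro s t
    rw [getD_map_of_lt (e s).2 _ [], getD_map_of_lt (e t).2 _ [], hget, hget, mulSummary_encode,
      (he (s * t)).1]
  have hletter : ∀ a : Fin k, ((List.range k).map fun a =>
      (summaryList k T).idxOf (letterCode k T a)).getD a 0 = e (letterSummary k T a) := by
    intro a
    rw [map_range_eq_ofFn, getD_ofFn, letterCode_eq, (he _).1]
  have hprod : ∀ x : Fin (degBound k c + 1) → Summary k T,
      (((grid (degBound k c + 1) (summaryList k T).length).map fun l =>
        (l, scanProductionCode k c T l)).lookup (List.ofFn fun i => (e (x i) : ℕ))).getD 0 =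
        scanProduction (c.toPoly k) T (degBound k c) x := by
    intro x
    rw [lookup_map_self (ofFn_mem_grid.2 fun i => (e (x i)).2), Option.getD_some,
      scanProductionCode, scanProduction, ← scanValueCode_encode, ← foldl_scanStepCode]
    congr 1
    have h1 : (List.ofFn fun i => (e (x i) : ℕ)) = (List.ofFn x).map fun s => (e s : ℕ) := by
      rw [List.map_ofFn]
      rfl
    rw [h1, List.foldl_map, List.foldl_map]
    simp only [hget]
    congr 1
    rw [encodeScanState, map_range_eq_ofFn]
    rfl
  refine ⟨Summary k T, inferInstance, e, summary k T,
    scanProduction (c.toPoly k) T (degBound k c), id, isAperiodic_summary,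
    ⟨hmul, hletter, hprod⟩, ?_, representsVia_scanProduction (fun m hm => sum_le_degBound c hm) hT⟩
  change List.range k = _
  conv_lhs => rw [← List.map_id (List.range k), map_range_eq_ofFn]
  rfl

section

variable {α : Type*} [Primcodable α]

@[fun_prop] theorem primrec_summaryList {f g : α → ℕ} (hf : Primrec f) (hg : Primrec g) :
    Primrec fun a => summaryList (f a) (g a) := by
  unfold summaryList
  fun_prop

@[fun_prop] theorem primrec_mulSummary {f g : α → ℕ} {h h' : α → List ℕ} (hf : Primrec f)
    (hg : Primrec g) (hh : Primrec h) (hh' : Primrec h') :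
    Primrec fun a => mulSummary (f a) (g a) (h a) (h' a) := by
  unfold mulSummary
  fun_prop

@[fun_prop] theorem primrec_letterCode {f g h : α → ℕ} (hf : Primrec f)
    (hg : Primrec g) (hh : Primrec h) : Primrec fun a => letterCode (f a) (g a) (h a) := by
  unfold letterCode
  fun_prop

@[fun_prop] theorem primrec_scanStepCode {f g : α → ℕ} {h : α → ℕ × List ℕ × List ℕ}
    {h' : α → List ℕ} (hf : Primrec f) (hg : Primrec g) (hh : Primrec h) (hh' : Primrec h') :
    Primrec fun a => scanStepCode (f a) (g a) (h a) (h' a) := by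
  unfold scanStepCode
  fun_prop

@[fun_prop] theorem primrec_scanValueCode {f : α → ℕ} {g : α → PolyCode}
    {h : α → ℕ × List ℕ × List ℕ} (hf : Primrec f) (hg : Primrec g) (hh : Primrec h) :
    Primrec fun a => scanValueCode (f a) (g a) (h a) := by
  unfold scanValueCode
  fun_prop

@[fun_prop] theorem primrec_scanProductionCode {f g : α → ℕ} {h : α → PolyCode} {h' : α → List ℕ}
    (hf : Primrec f) (hg : Primrec g) (hh : Primrec h) (hh' : Primrec h') :
    Primrec fun a => scanProductionCode (f a) (h a) (g a) (h' a) := by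
  unfold scanProductionCode
  fun_prop

theorem primrec_starFreeTables {f : α → ℕ × PolyCode} {g : α → ℕ} (hf : Primrec f)
    (hg : Primrec g) : Primrec fun a => starFreeTables (f a) (g a) := by
  unfold starFreeTables
  fun_prop

end

end StarFreeTables

/-! ### Tables of the weighted automaton of a polyregular function -/

section AutomatonTables

/-- The product of two elements of the monoid described by `c`. -/
def mulCode (c : PolyregCode) (x y : ℕ) : ℕ := (c.2.2.2.1.getD x []).getD y 0

/-- The codes of the states of the automaton of a polyregular function: the index of the current
factor, followed by the values of the factors read so far. -/
def stateList (c : PolyregCode) : List (List ℕ) :=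
  (List.range (c.2.2.1 + 1)).flatMap fun j => (grid (c.2.2.1 + 1) c.2.1).map (j :: ·)

open Classical in
/-- The initial weight of a state, on codes: all the values have to be left neutral elements. -/
noncomputable def initCode (c : PolyregCode) (s : List ℕ) : ℕ :=
  if s.getD 0 0 = 0 ∧ ∀ i ∈ List.range (c.2.2.1 + 1), ∀ y ∈ List.range c.2.1,
    mulCode c (s.getD (i + 1) 0) y = y then 1 else 0

/-- The weight of a transition, on codes. -/
def transCode (c : PolyregCode) (a : ℕ) (s s' : List ℕ) : ℕ :=
  if s.getD 0 0 ≤ s'.getD 0 0 ∧ s'.tail = (List.range (c.2.2.1 + 1)).map fun i =>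
    if i = s'.getD 0 0 then mulCode c (s.getD (i + 1) 0) (c.2.2.2.2.1.getD a 0)
    else s.getD (i + 1) 0
  then 1 else 0

/-- The tables of the automaton of a polyregular function. -/
noncomputable def automatonTables (c : PolyregCode) : WACode :=
  (c.1, (stateList c).length, (stateList c).map (initCode c),
    (List.range c.1).map fun a => (stateList c).map fun s => (stateList c).map (transCode c a s),
    (stateList c).map fun s => (c.2.2.2.2.2.lookup s.tail).getD 0)

variable {c : PolyregCode} {M : Type} (e : M ≃ Fin c.2.1)

/-- The code of a state of the automaton of a polyregular function. -/
def encodeState (s : Fin (c.2.2.1 + 1) × (Fin (c.2.2.1 + 1) → M)) : List ℕ :=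
  (s.1 : ℕ) :: List.ofFn fun i => (e (s.2 i) : ℕ)

theorem encodeState_injective : Function.Injective (encodeState e) := by
  intro s t h
  obtain ⟨h1, h2⟩ := List.cons.inj h
  refine Prod.ext (Fin.ext h1) (funext fun i => e.injective (Fin.ext ?_))
  exact congrFun (List.ofFn_injective h2) i

theorem encodeState_succ (s : Fin (c.2.2.1 + 1) × (Fin (c.2.2.1 + 1) → M))
    (i : Fin (c.2.2.1 + 1)) : (encodeState e s).getD (i + 1) 0 = e (s.2 i) := by
  rw [encodeState, List.getD_cons_succ, getD_ofFn]

theorem mem_stateList {x : List ℕ} : x ∈ stateList c ↔ x ∈ Set.range (encodeState e) := by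
  simp only [stateList, List.mem_flatMap, List.mem_range, List.mem_map, Set.mem_range]
  constructor
  · rintro ⟨j, hj, l, hl, rfl⟩
    obtain ⟨t, rfl⟩ := exists_ofFn (mem_grid.1 hl).1
    rw [ofFn_mem_grid] at hl
    refine ⟨(⟨j, hj⟩, fun i => e.symm ⟨t i, hl i⟩), ?_⟩
    simp [encodeState]
  · rintro ⟨s, rfl⟩
    exact ⟨_, s.1.2, _, ofFn_mem_grid.2 fun i => (e (s.2 i)).2, rfl⟩

variable [Monoid M]

theorem initCode_encode {μ : FreeMonoid (Fin c.1) →* M} {π : (Fin (c.2.2.1 + 1) → M) → ℕ}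
    (h : c.Describes e μ π) (s : Fin (c.2.2.1 + 1) × (Fin (c.2.2.1 + 1) → M)) :
    initCode c (encodeState e s) = (factorAutomaton μ π).init s := by
  have hiff : (∀ i ∈ List.range (c.2.2.1 + 1), ∀ y ∈ List.range c.2.1,
      mulCode c ((encodeState e s).getD (i + 1) 0) y = y) ↔ s.2 = 1 := by
    constructor
    · intro H
      ext i
      have h1 := H i (List.mem_range.2 i.2) (e 1) (List.mem_range.2 (e 1).2)
      rw [encodeState_succ, mulCode, h.mul_table, mul_one] at h1
      exact e.injective (Fin.ext h1)
    · intro h1 i hi y hy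
      rw [List.mem_range] at hi hy
      have h2 := encodeState_succ e s ⟨i, hi⟩
      simp only [h1, Pi.one_apply] at h2
      have h3 := h.mul_table 1 (e.symm ⟨y, hy⟩)
      rw [one_mul, e.apply_symm_apply] at h3
      rw [h2]
      exact h3
  have h0 : (encodeState e s).getD 0 0 = 0 ↔ s.1 = 0 := by
    rw [Fin.ext_iff]
    rfl
  simp only [initCode, factorAutomaton]
  congr 1
  rw [h0, hiff]

theorem transCode_encode {μ : FreeMonoid (Fin c.1) →* M} {π : (Fin (c.2.2.1 + 1) → M) → ℕ}
    (h : c.Describes e μ π) (a : Fin c.1) (s s' : Fin (c.2.2.1 + 1) × (Fin (c.2.2.1 + 1) → M)) :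
    transCode c a (encodeState e s) (encodeState e s') = (factorAutomaton μ π).trans a s s' := by
  have hiff : ((encodeState e s').tail = (List.range (c.2.2.1 + 1)).map fun i =>
      if i = (encodeState e s').getD 0 0 then
        mulCode c ((encodeState e s).getD (i + 1) 0) (c.2.2.2.2.1.getD a 0)
      else (encodeState e s).getD (i + 1) 0) ↔ s'.2 = readLetter μ a s'.1 s.2 := by
    have h1 : ∀ i : Fin (c.2.2.1 + 1), (if (i : ℕ) = (encodeState e s').getD 0 0 then
        mulCode c ((encodeState e s).getD (i + 1) 0) (c.2.2.2.2.1.getD a 0)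
        else (encodeState e s).getD (i + 1) 0) = e (readLetter μ a s'.1 s.2 i) := by
      intro i
      rw [encodeState_succ, h.letter_table, mulCode, h.mul_table, readLetter,
        Function.update_apply]
      have h2 : (i : ℕ) = (encodeState e s').getD 0 0 ↔ i = s'.1 := Fin.ext_iff.symm
      simp only [h2]
      split_ifs with hi
      · rw [hi]
      · rfl
    rw [map_range_eq_ofFn]
    simp only [h1]
    change List.ofFn _ = List.ofFn _ ↔ _
    rw [List.ofFn_injective.eq_iff, funext_iff, funext_iff]
    refine forall_congr' fun i => ?_
    rw [← Fin.ext_iff, e.injective.eq_iff]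
  have h0 : (encodeState e s).getD 0 0 ≤ (encodeState e s').getD 0 0 ↔ s.1 ≤ s'.1 := Iff.rfl
  simp only [transCode, factorAutomaton]
  congr 1
  rw [h0, hiff]

/-- The series of the tables is the given polyregular function. -/
theorem series_automatonTables {μ : FreeMonoid (Fin c.1) →* M}
    {π : (Fin (c.2.2.1 + 1) → M) → ℕ} (h : c.Describes e μ π) :
    (automatonTables c).toAutomaton.series = polyregularFun μ π := by
  classical
  have : Fintype M := Fintype.ofEquiv _ e.symm
  obtain ⟨f, hf⟩ := exists_numbering (E := stateList c)
    (nodup_flatMap_cons List.nodup_range (nodup_grid _ _))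
    (encodeState e) (encodeState_injective e) fun _ => mem_stateList e
  have hget : ∀ p : Fin (stateList c).length,
      (stateList c).getD p [] = encodeState e (f.symm p) := by
    intro p
    have := (hf (f.symm p)).2 []
    rwa [f.apply_symm_apply] at this
  rw [← factorAutomaton_series]
  refine WeightedAutomaton.series_equiv f.symm _ _ (fun p => ?_) (fun a p q => ?_) fun p => ?_
  · change ((stateList c).map (initCode c)).getD p 0 = (factorAutomaton μ π).init (f.symm p)
    rw [getD_map_of_lt p.2 _ [], hget, initCode_encode e h]
  · change ((((List.range c.1).map fun a => (stateList c).map fun s =>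
      (stateList c).map (transCode c a s)).getD a []).getD p []).getD q 0 = _
    have ha : ((List.range c.1).map fun a => (stateList c).map fun s =>
        (stateList c).map (transCode c a s)).getD a [] = (stateList c).map fun s =>
        (stateList c).map (transCode c a s) := by
      rw [map_range_eq_ofFn]
      exact getD_ofFn (n := c.1) _ a []
    rw [ha, getD_map_of_lt p.2 _ [], getD_map_of_lt q.2 _ [], hget, hget]
    exact transCode_encode e h a _ _
  · change ((stateList c).map fun s => (c.2.2.2.2.2.lookup s.tail).getD 0).getD p 0 =
      (factorAutomaton μ π).final (f.symm p)
    rw [getD_map_of_lt p.2 _ [], hget]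
    exact h.production_table _

theorem represents_automatonTables {r : PolyregRep} {k : ℕ} {P : MvPolynomial (Fin k) ℤ}
    (h : r.Represents P) : WARep.Represents (automatonTables r.1, r.2) P := by
  obtain ⟨M, _, e, μ, π, η, hd, hη, hrep⟩ := h
  refine ⟨η, hη, ?_⟩
  change RepresentsVia η (automatonTables r.1).toAutomaton.series P
  rwa [series_automatonTables e hd]

section

variable {α : Type*} [Primcodable α]

@[fun_prop] theorem primrec_mulCode {f : α → PolyregCode} {g h : α → ℕ} (hf : Primrec f)
    (hg : Primrec g) (hh : Primrec h) : Primrec fun a => mulCode (f a) (g a) (h a) := by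
  unfold mulCode
  fun_prop

@[fun_prop] theorem primrec_stateList {f : α → PolyregCode} (hf : Primrec f) :
    Primrec fun a => stateList (f a) := by
  unfold stateList
  fun_prop

@[fun_prop] theorem primrec_initCode {f : α → PolyregCode} {g : α → List ℕ} (hf : Primrec f)
    (hg : Primrec g) : Primrec fun a => initCode (f a) (g a) := by
  unfold initCode
  fun_prop

@[fun_prop] theorem primrec_transCode {f : α → PolyregCode} {g : α → ℕ} {h h' : α → List ℕ}
    (hf : Primrec f) (hg : Primrec g) (hh : Primrec h) (hh' : Primrec h') :
    Primrec fun a => transCode (f a) (g a) (h a) (h' a) := by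
  unfold transCode
  fun_prop

@[fun_prop] theorem primrec_automatonTables {f : α → PolyregCode} (hf : Primrec f) :
    Primrec fun a => automatonTables (f a) := by
  unfold automatonTables
  fun_prop

end

end AutomatonTables

/-! ### Interpolation of integer polynomials -/

section Interpolation

variable {k n : ℕ}

/-- A polynomial whose exponents are less than `n` is determined by its values at the points whose
coordinates are less than `n`. -/
theorem eq_zero_of_polyFun_eq_zero {P : MvPolynomial (Fin k) ℤ}
    (hP : ∀ m ∈ P.support, ∀ i, m i < n)
    (h0 : ∀ x : Fin k → ℕ, (∀ i, x i < n) → polyFun P x = 0) : P = 0 := by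
  by_contra hne
  obtain ⟨m, hm⟩ := MvPolynomial.support_nonempty.2 hne
  refine hne (MvPolynomial.eq_zero_of_eval_zero_at_prod_finset P
    (fun _ => (Finset.range n).map Nat.castEmbedding) (fun i => ?_) fun x hx => ?_)
  · rw [Finset.card_map, Finset.card_range,
      MvPolynomial.degreeOf_lt_iff ((Nat.zero_le _).trans_lt (hP m hm i))]
    exact fun m hm => hP m hm i
  · simp only [Finset.mem_map, Finset.mem_range, Nat.castEmbedding_apply] at hx
    choose y hy hyx using hx
    obtain rfl : (fun i => (y i : ℤ)) = x := funext hyx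
    exact h0 y hy

theorem eq_of_polyFun_eq {P Q : MvPolynomial (Fin k) ℤ} (hP : ∀ m ∈ P.support, ∀ i, m i < n)
    (hQ : ∀ m ∈ Q.support, ∀ i, m i < n)
    (h : ∀ x : Fin k → ℕ, (∀ i, x i < n) → polyFun P x = polyFun Q x) : P = Q := by
  classical
  refine sub_eq_zero.1 (eq_zero_of_polyFun_eq_zero (n := n) (fun m hm i => ?_) fun x hx => ?_)
  · rcases Finset.mem_union.1 (MvPolynomial.support_sub _ P Q hm) with hm | hm
    exacts [hP m hm i, hQ m hm i]
  · have h' := h x hx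
    rw [polyFun] at h' ⊢
    rw [map_sub, h', polyFun, sub_self]

/-- The polynomial with exponents less than `n` and given coefficients. -/
noncomputable def ofCoeffs (a : (Fin k → Fin n) → ℤ) : MvPolynomial (Fin k) ℤ :=
  ∑ e, MvPolynomial.monomial (Finsupp.equivFunOnFinite.symm fun i => (e i : ℕ)) (a e)

theorem polyFun_ofCoeffs (a : (Fin k → Fin n) → ℤ) (x : Fin k → ℕ) :
    polyFun (ofCoeffs a) x = ∑ e, (∏ i, (x i : ℤ) ^ (e i : ℕ)) * a e := by
  rw [polyFun, ofCoeffs, map_sum]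
  refine Finset.sum_congr rfl fun e _ => ?_
  rw [MvPolynomial.eval_monomial, Finsupp.prod_fintype _ _ fun i => pow_zero _, mul_comm]
  rfl

theorem lt_of_mem_support_ofCoeffs {a : (Fin k → Fin n) → ℤ} {m : Fin k →₀ ℕ}
    (hm : m ∈ (ofCoeffs a).support) (i : Fin k) : m i < n := by
  classical
  obtain ⟨e, -, he⟩ := Finset.mem_biUnion.1 (MvPolynomial.support_sum hm)
  have := MvPolynomial.support_monomial_subset he
  rw [Finset.mem_singleton] at this
  subst this
  exact (e i).2

theorem coeff_ofCoeffs (a : (Fin k → Fin n) → ℤ) (e : Fin k → Fin n) :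
    (ofCoeffs a).coeff (Finsupp.equivFunOnFinite.symm fun i => (e i : ℕ)) = a e := by
  classical
  rw [ofCoeffs, MvPolynomial.coeff_sum, Finset.sum_eq_single e]
  · rw [MvPolynomial.coeff_monomial, if_pos rfl]
  · intro e' _ hne
    rw [MvPolynomial.coeff_monomial, if_neg]
    intro h
    refine hne (funext fun i => Fin.ext ?_)
    exact congrFun (Finsupp.equivFunOnFinite.symm.injective h) i
  · simp

/-- A multiple of every function agrees with an integer polynomial at the points with coordinates
less than `n`: the determinant of the matrix of the values of the monomials is not zero. -/
theorem exists_interpolation (k n : ℕ) (g : (Fin k → ℕ) → ℤ) :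
    ∃ (D : ℕ) (P : MvPolynomial (Fin k) ℤ), D ≠ 0 ∧ (∀ m ∈ P.support, ∀ i, m i < n) ∧
      ∀ x : Fin k → ℕ, (∀ i, x i < n) → D * g x = polyFun P x := by
  classical
  let B : Matrix (Fin k → Fin n) (Fin k → Fin n) ℤ :=
    Matrix.of fun x e => ∏ i, ((x i : ℕ) : ℤ) ^ (e i : ℕ)
  have hB : ∀ a x, B.mulVec a x = polyFun (ofCoeffs a) fun i => (x i : ℕ) := fun a x => by
    rw [polyFun_ofCoeffs]
    rfl
  have hdet : B.det ≠ 0 := by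
    intro h
    obtain ⟨a, ha, ha0⟩ := Matrix.exists_mulVec_eq_zero_iff.2 h
    have hz : ofCoeffs a = 0 := by
      refine eq_zero_of_polyFun_eq_zero (n := n) (fun m hm i => lt_of_mem_support_ofCoeffs hm i)
        fun x hx => ?_
      rw [← hB a fun i => ⟨x i, hx i⟩, ha0]
      rfl
    refine ha (funext fun e => ?_)
    rw [← coeff_ofCoeffs a e, hz]
    rfl
  let v : (Fin k → Fin n) → ℤ := fun x => g fun i => x i
  refine ⟨(B.det * B.det).toNat, ofCoeffs (B.det • B.adjugate.mulVec v), ?_,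
    fun m hm i => lt_of_mem_support_ofCoeffs hm i, fun x hx => ?_⟩
  · have := mul_self_pos.2 hdet
    omega
  · have h1 := hB (B.det • B.adjugate.mulVec v) fun i => ⟨x i, hx i⟩
    rw [← h1, Matrix.mulVec_smul, Matrix.mulVec_mulVec, Matrix.mul_adjugate, Matrix.smul_mulVec,
      Matrix.one_mulVec, Int.toNat_of_nonneg (mul_self_nonneg _)]
    simp only [Pi.smul_apply, smul_eq_mul, v]
    ring

/-- The exponent vector written by a list. -/
noncomputable def exponents (k : ℕ) (l : List ℕ) : Fin k →₀ ℕ :=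
  Finsupp.equivFunOnFinite.symm fun i => l.getD i 0

theorem toPoly_eq (c : PolyCode) :
    c.toPoly k = (c.map fun t => MvPolynomial.monomial (exponents k t.2) t.1).sum := rfl

theorem exponents_inj {l l' : List ℕ} (hl : l.length = k) (hl' : l'.length = k) :
    exponents k l = exponents k l' ↔ l = l' := by
  refine ⟨fun h => ?_, fun h => h ▸ rfl⟩
  obtain ⟨x, rfl⟩ := exists_ofFn hl
  obtain ⟨y, rfl⟩ := exists_ofFn hl'
  congr 1
  ext i
  have := DFunLike.congr_fun h i
  simpa only [exponents, Finsupp.equivFunOnFinite_symm_apply_apply, getD_ofFn] using this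

theorem lt_of_mem_support_toPoly {c : PolyCode} (hc : c.map Prod.snd = grid k n) {m : Fin k →₀ ℕ}
    (hm : m ∈ (c.toPoly k).support) (i : Fin k) : m i < n := by
  classical
  have hmem : ∀ t ∈ c, t.2 ∈ grid k n := fun t ht => hc ▸ List.mem_map_of_mem ht
  clear hc
  induction c with
  | nil => simp [toPoly_eq] at hm
  | cons t c ih =>
    rw [toPoly_eq, List.map_cons, List.sum_cons, ← toPoly_eq] at hm
    rcases Finset.mem_union.1 (MvPolynomial.support_add hm) with h | h
    · have h3 := MvPolynomial.support_monomial_subset h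
      rw [Finset.mem_singleton] at h3
      subst h3
      obtain ⟨x, hx⟩ := exists_ofFn (mem_grid.1 (hmem t List.mem_cons_self)).1
      have h4 := hmem t List.mem_cons_self
      rw [hx, ofFn_mem_grid] at h4
      rw [hx]
      simpa only [exponents, Finsupp.equivFunOnFinite_symm_apply_apply, getD_ofFn] using h4 i
    · exact ih h fun t ht => hmem t (List.mem_cons_of_mem _ ht)

theorem coeff_toPoly_of_mem {c : PolyCode} (hnd : (c.map Prod.snd).Nodup)
    (hlen : ∀ t ∈ c, t.2.length = k) {t : ℤ × List ℕ} (ht : t ∈ c) :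
    (c.toPoly k).coeff (exponents k t.2) = t.1 := by
  classical
  have h0 : ∀ c : PolyCode, ∀ l : List ℕ, l.length = k → (∀ t ∈ c, t.2.length = k) →
      l ∉ c.map Prod.snd → (c.toPoly k).coeff (exponents k l) = 0 := by
    intro c l hl hlen hn
    induction c with
    | nil => simp [toPoly_eq]
    | cons s c ih =>
      rw [List.map_cons, List.mem_cons, not_or] at hn
      rw [toPoly_eq, List.map_cons, List.sum_cons, ← toPoly_eq, MvPolynomial.coeff_add,
        MvPolynomial.coeff_monomial, if_neg, zero_add]
      · exact ih (fun t ht => hlen t (List.mem_cons_of_mem _ ht)) hn.2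
      · rw [exponents_inj (hlen s List.mem_cons_self) hl]
        exact fun h => hn.1 h.symm
  induction c with
  | nil => simp at ht
  | cons s c ih =>
    rw [List.map_cons, List.nodup_cons] at hnd
    have hlen' : ∀ t ∈ c, t.2.length = k := fun t ht => hlen t (List.mem_cons_of_mem _ ht)
    rw [toPoly_eq, List.map_cons, List.sum_cons, ← toPoly_eq, MvPolynomial.coeff_add,
      MvPolynomial.coeff_monomial]
    rcases List.mem_cons.1 ht with rfl | ht'
    · rw [if_pos rfl, h0 c t.2 (hlen t List.mem_cons_self) hlen' hnd.1, add_zero]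
    · rw [if_neg, zero_add, ih hnd.2 hlen' ht']
      rw [exponents_inj (hlen s List.mem_cons_self) (hlen' t ht')]
      rintro h
      exact hnd.1 (h ▸ List.mem_map_of_mem ht')

/-- A polynomial with exponents less than `n` has a code that lists the exponent vectors in the
order of `grid k n`. -/
theorem exists_code_of_lt {P : MvPolynomial (Fin k) ℤ} (hP : ∀ m ∈ P.support, ∀ i, m i < n) :
    ∃ c : PolyCode, c.map Prod.snd = grid k n ∧ c.toPoly k = P := by
  let c : PolyCode := (grid k n).map fun l => (P.coeff (exponents k l), l)
  have hc : c.map Prod.snd = grid k n := by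
    rw [List.map_map]
    exact List.map_id _
  have hlen : ∀ t ∈ c, t.2.length = k := fun t ht =>
    (mem_grid.1 (hc ▸ List.mem_map_of_mem ht : t.2 ∈ grid k n)).1
  refine ⟨c, hc, ?_⟩
  ext m
  by_cases hm : ∀ i, m i < n
  · have h1 : exponents k (List.ofFn m) = m := Finsupp.ext fun i => getD_ofFn m i 0
    have h2 : (P.coeff m, List.ofFn m) ∈ c :=
      List.mem_map.2 ⟨List.ofFn m, ofFn_mem_grid.2 hm, by rw [h1]⟩
    have h3 := coeff_toPoly_of_mem (hc ▸ nodup_grid k n) hlen h2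
    rwa [h1] at h3
  · rw [MvPolynomial.notMem_support_iff.1 fun h => hm fun i => lt_of_mem_support_toPoly hc h i,
      MvPolynomial.notMem_support_iff.1 fun h => hm (hP m h)]

end Interpolation

/-! ### The polynomial represented by the tables of a weighted automaton -/

section Recovery

/-- The weights of the runs on `w`, from each of the states. -/
def valCode (c : WACode) (w : List ℕ) : List ℕ :=
  w.foldr (fun a v => (List.range c.2.1).map fun p => ((List.range c.2.1).map fun q =>
    ((c.2.2.2.1.getD a []).getD p []).getD q 0 * v.getD q 0).sum)
    ((List.range c.2.1).map fun q => c.2.2.2.2.getD q 0)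

/-- The value at `x` of the function represented through the letter assignment of `r`. -/
def valueAt (r : WARep) (x : List ℕ) : ℕ :=
  ((List.range r.1.2.1).map fun q => r.1.2.2.1.getD q 0 *
    (valCode r.1 ((List.range r.2.length).flatMap fun i =>
      (List.range (x.getD i 0)).map fun _ => r.2.getD i 0)).getD q 0).sum

theorem valCode_map_val (c : WACode) (w : List (Fin c.1)) :
    valCode c (w.map Fin.val) = List.ofFn (c.toAutomaton.val w) := by
  induction w with
  | nil =>
    change (List.range c.2.1).map (fun q => c.2.2.2.2.getD q 0) = _
    rw [map_range_eq_ofFn]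
    rfl
  | cons a w ih =>
    change (List.range c.2.1).map (fun p => ((List.range c.2.1).map fun q =>
      ((c.2.2.2.1.getD a []).getD p []).getD q 0 * (valCode c (w.map Fin.val)).getD q 0).sum) = _
    rw [ih, map_range_eq_ofFn]
    congr 1
    ext p
    rw [map_range_eq_ofFn, List.sum_ofFn]
    simp only [getD_ofFn]
    rfl

theorem dagger_map_val {k n : ℕ} (η : Fin k → Fin n) (x : Fin k → ℕ) :
    (dagger η x).map Fin.val = (List.range k).flatMap fun i =>
      (List.range ((List.ofFn x).getD i 0)).map fun _ =>
        (List.ofFn fun i => (η i : ℕ)).getD i 0 := by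
  rw [dagger, List.map_flatten, List.map_ofFn, List.flatMap, map_range_eq_ofFn]
  simp only [getD_ofFn]
  congr 2
  ext1 i
  simp

theorem valueAt_ofFn {c : WACode} {k : ℕ} {P : MvPolynomial (Fin k) ℤ} {η : Fin k → Fin c.1}
    (h : RepresentsVia η c.toAutomaton.series P) (x : Fin k → ℕ) :
    (valueAt (c, List.ofFn fun i => (η i : ℕ)) (List.ofFn x) : ℤ) = polyFun P x := by
  rw [polyFun, ← h.2, WeightedAutomaton.series_eq_val, valueAt, List.length_ofFn, ← dagger_map_val,
    valCode_map_val, map_range_eq_ofFn, List.sum_ofFn]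
  simp only [getD_ofFn]
  rfl

/-- The code `s.2` writes `s.1` times a polynomial that agrees with the function represented by `r`
at the points whose coordinates are less than the number of states. -/
def Interpolates (r : WARep) (s : ℕ × PolyCode) : Prop :=
  s.1 ≠ 0 ∧ s.2.map Prod.snd = grid r.2.length r.1.2.1 ∧
    ∀ x ∈ grid r.2.length r.1.2.1, (s.1 : ℤ) * valueAt r x = evalCode r.2.length s.2 x

theorem exists_interpolates (r : WARep) : ∃ s, Interpolates r s := by
  obtain ⟨D, P, hD, hP, h⟩ := exists_interpolation r.2.length r.1.2.1
    fun x => (valueAt r (List.ofFn x) : ℤ)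
  obtain ⟨c, hc, rfl⟩ := exists_code_of_lt hP
  refine ⟨(D, c), hD, hc, fun l hl => ?_⟩
  obtain ⟨x, rfl⟩ := exists_ofFn (mem_grid.1 hl).1
  rw [evalCode_ofFn]
  exact h x (ofFn_mem_grid.1 hl)

/-- Division of the coefficients of a code by a natural number that divides them. -/
def divideCode (s : ℕ × PolyCode) : PolyCode :=
  s.2.map fun t => (((t.1.toNat / s.1 : ℕ) : ℤ) - (((-t.1).toNat / s.1 : ℕ) : ℤ), t.2)

theorem divide_mul {D : ℕ} (hD : D ≠ 0) (z : ℤ) : (((((D : ℤ) * z).toNat / D : ℕ) : ℤ) -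
    (((-((D : ℤ) * z)).toNat / D : ℕ) : ℤ)) = z := by
  obtain ⟨n, rfl | rfl⟩ := z.eq_nat_or_neg
  · have h1 : ((D : ℤ) * n).toNat = D * n := by
      rw [← Nat.cast_mul, Int.toNat_natCast]
    have h2 : (-((D : ℤ) * n)).toNat = 0 := by
      rw [← Nat.cast_mul, Int.toNat_neg_natCast]
    rw [h1, h2, Nat.mul_div_cancel_left _ (Nat.pos_of_ne_zero hD)]
    simp
  · have h1 : ((D : ℤ) * -n).toNat = 0 := by
      rw [mul_neg, ← Nat.cast_mul, Int.toNat_neg_natCast]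
    have h2 : (-((D : ℤ) * -n)).toNat = D * n := by
      rw [mul_neg, neg_neg, ← Nat.cast_mul, Int.toNat_natCast]
    rw [h1, h2, Nat.mul_div_cancel_left _ (Nat.pos_of_ne_zero hD)]
    simp

theorem toPoly_divideCode {s : ℕ × PolyCode} (hs : s.1 ≠ 0) {k : ℕ} {P : MvPolynomial (Fin k) ℤ}
    (hnd : (s.2.map Prod.snd).Nodup) (hlen : ∀ t ∈ s.2, t.2.length = k)
    (h : s.2.toPoly k = MvPolynomial.C (s.1 : ℤ) * P) : (divideCode s).toPoly k = P := by
  have hC : MvPolynomial.C (s.1 : ℤ) ≠ (0 : MvPolynomial (Fin k) ℤ) := by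
    rw [Ne, MvPolynomial.C_eq_zero]
    exact_mod_cast hs
  refine mul_left_cancel₀ hC ?_
  rw [← h, toPoly_eq, toPoly_eq, divideCode, List.map_map, ← List.sum_map_mul_left]
  congr 1
  refine List.map_congr_left fun t ht => ?_
  have h1 := coeff_toPoly_of_mem hnd hlen ht
  rw [h, MvPolynomial.coeff_C_mul] at h1
  rw [Function.comp_apply, MvPolynomial.C_mul_monomial, ← h1, divide_mul hs]

/-- A solution of the interpolation problem is a multiple of the represented polynomial, since both
have exponents less than the number of states. -/
theorem Interpolates.toPoly_divideCode {r : WARep} {s : ℕ × PolyCode} (hs : Interpolates r s)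
    {k : ℕ} {P : MvPolynomial (Fin k) ℤ} (h : r.Represents P) : (divideCode s).toPoly k = P := by
  obtain ⟨c, l⟩ := r
  obtain ⟨η, rfl, hrep⟩ : ∃ η : Fin k → Fin c.1, l = (List.ofFn fun i => (η i : ℕ)) ∧
    RepresentsVia η c.toAutomaton.series P := h
  obtain ⟨hD, hc, hval⟩ := hs
  simp only [List.length_ofFn] at hc hval
  have hP : ∀ m ∈ P.support, ∀ i, m i < c.2.1 := fun m hm i => by
    simpa using hrep.exponent_lt_card hm i
  refine NPolyreg.toPoly_divideCode hD (hc ▸ nodup_grid _ _)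
    (fun t ht => (mem_grid.1 (hc ▸ List.mem_map_of_mem ht : t.2 ∈ grid k c.2.1)).1)
    (eq_of_polyFun_eq (n := c.2.1) (fun m hm i => lt_of_mem_support_toPoly hc hm i)
      (fun m hm i => ?_) fun x hx => ?_)
  · refine hP m (MvPolynomial.mem_support_iff.2 fun h0 => ?_) i
    rw [MvPolynomial.mem_support_iff, MvPolynomial.coeff_C_mul, h0, mul_zero] at hm
    exact hm rfl
  · have h1 := hval (List.ofFn x) (ofFn_mem_grid.2 hx)
    rw [evalCode_ofFn, valueAt_ofFn hrep] at h1
    rw [← h1, polyFun, polyFun, map_mul, MvPolynomial.eval_C]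

section

variable {α : Type*} [Primcodable α]

@[fun_prop] theorem primrec_valCode {f : α → WACode} {g : α → List ℕ} (hf : Primrec f)
    (hg : Primrec g) : Primrec fun a => valCode (f a) (g a) := by
  unfold valCode
  fun_prop

@[fun_prop] theorem primrec_valueAt {f : α → WARep} {g : α → List ℕ} (hf : Primrec f)
    (hg : Primrec g) : Primrec fun a => valueAt (f a) (g a) := by
  unfold valueAt
  fun_prop

theorem primrecPred_interpolates {f : α → WARep} {g : α → ℕ × PolyCode} (hf : Primrec f)
    (hg : Primrec g) : PrimrecPred fun a => Interpolates (f a) (g a) := by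
  unfold Interpolates
  fun_prop

theorem primrec_divideCode : Primrec divideCode := by
  unfold divideCode
  fun_prop

end

/-- A polynomial can be computed from the tables of an automaton that represents it. -/
theorem exists_computable_toPoly_eq : ∃ F : WARep → PolyCode, Computable F ∧
    ∀ (r : WARep) (k : ℕ) (P : MvPolynomial (Fin k) ℤ), r.Represents P → (F r).toPoly k = P := by
  obtain ⟨f, hf, h⟩ := exists_computable_choice (R := Interpolates)
    (primrecPred_interpolates (by fun_prop) (by fun_prop)) exists_interpolates
  exact ⟨fun r => divideCode (f r), primrec_divideCode.to_comp.comp hf,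
    fun r _ _ hr => (h r).toPoly_divideCode hr⟩

end Recovery

/-! ### Equivalence and decidability -/

section Equivalence

variable {k : ℕ}

theorem representedByStarFree_of_isThreshold {P : MvPolynomial (Fin k) ℤ} {T : ℕ}
    (hT : IsThreshold P T) : RepresentedByStarFree P := by
  obtain ⟨c, rfl⟩ := exists_toPoly_eq P
  exact ⟨Fin k, inferInstance, id, _, ⟨degBound k c, Summary k T, inferInstance, inferInstance,
    summary k T, _, isAperiodic_summary, rfl⟩,
    representsVia_scanProduction (fun _ hm => sum_le_degBound c hm) hT⟩

theorem RepresentedByStarFree.representedByNPolyregular {P : MvPolynomial (Fin k) ℤ}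
    (h : RepresentedByStarFree P) : RepresentedByNPolyregular P := by
  obtain ⟨α, hα, η, g, ⟨d, M, _, hM, μ, π, -, hg⟩, hrep⟩ := h
  exact ⟨α, hα, η, g, ⟨d, M, _, hM, μ, π, hg⟩, hrep⟩

theorem RepresentedByNPolyregular.representedByNRational {P : MvPolynomial (Fin k) ℤ}
    (h : RepresentedByNPolyregular P) : RepresentedByNRational P := by
  obtain ⟨α, hα, η, g, hg, hrep⟩ := h
  exact ⟨α, hα, η, g, hg.isNRational, hrep⟩

theorem RepresentedByNRational.isPolyStrNNeg {P : MvPolynomial (Fin k) ℤ}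
    (h : RepresentedByNRational P) : IsPolyStrNNeg P := by
  obtain ⟨α, hα, η, g, ⟨n, A, rfl⟩, hrep⟩ := h
  exact hrep.isPolyStrNNeg

theorem IsThreshold.isPolyStrNNeg {P : MvPolynomial (Fin k) ℤ} {T : ℕ} (hT : IsThreshold P T) :
    IsPolyStrNNeg P :=
  (representedByStarFree_of_isThreshold
    hT).representedByNPolyregular.representedByNRational.isPolyStrNNeg

theorem tfae_represented (P : MvPolynomial (Fin k) ℤ) :
    List.TFAE [IsPolyStrNNeg P, RepresentedByNRational P, RepresentedByNPolyregular P,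
      RepresentedByStarFree P] := by
  tfae_have 1 → 4 := fun h =>
    let ⟨_, hT⟩ := h.exists_threshold
    representedByStarFree_of_isThreshold hT
  tfae_have 4 → 3 := fun h => h.representedByNPolyregular
  tfae_have 3 → 2 := fun h => h.representedByNRational
  tfae_have 2 → 1 := fun h => h.isPolyStrNNeg
  tfae_finish

/-- A threshold of every polynomial of the class can be computed: a parallel search for a threshold
and for a refutation always ends. -/
theorem exists_computable_threshold : ∃ f : ℕ × PolyCode → ℕ, Computable f ∧
    ∀ p, CheckThreshold p (f p) ↔ IsPolyStrNNeg (p.2.toPoly p.1) := by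
  obtain ⟨f, hf, h⟩ := exists_computable_choice
    (R := fun (p : ℕ × PolyCode) (z : ℕ × (List ℕ × List ℕ × List ℕ)) =>
      CheckThreshold p z.1 ∨ CheckRefutation p z.2) (by fun_prop) fun p => by
        by_cases hp : IsPolyStrNNeg (p.2.toPoly p.1)
        · obtain ⟨T, hT⟩ := hp.exists_threshold
          exact ⟨(T, default), Or.inl (checkThreshold_iff.2 hT)⟩
        · obtain ⟨r, hr⟩ := exists_checkRefutation hp
          exact ⟨(0, r), Or.inr hr⟩
  refine ⟨fun p => (f p).1, Computable.fst.comp hf, fun p =>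
    ⟨fun hT => (checkThreshold_iff.1 hT).isPolyStrNNeg, fun hp => ?_⟩⟩
  exact (h p).resolve_right fun hr => hr.not_isPolyStrNNeg hp

theorem computablePred_isPolyStrNNeg :
    ComputablePred fun p : ℕ × PolyCode => IsPolyStrNNeg (p.2.toPoly p.1) := by
  obtain ⟨f, hf, h⟩ := exists_computable_threshold
  have hR : PrimrecPred fun q : (ℕ × PolyCode) × ℕ => CheckThreshold q.1 q.2 := by fun_prop
  have h2 : Computable fun p : ℕ × PolyCode => (p, f p) := Computable.id.pair hf
  obtain ⟨_, hdec⟩ := hR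
  refine ComputablePred.of_eq (p := fun p => CheckThreshold p (f p)) ?_ h
  exact ⟨fun p => inferInstanceAs (Decidable (CheckThreshold (p, f p).1 (p, f p).2)),
    hdec.to_comp.comp h2⟩

end Equivalence

end NPolyreg

theorem mainTheorem1 :
    -- the four conditions are equivalent
    (∀ (k : ℕ) (P : MvPolynomial (Fin k) ℤ),
      List.TFAE [IsPolyStrNNeg P, RepresentedByNRational P, RepresentedByNPolyregular P,
        RepresentedByStarFree P]) ∧
    -- they are decidable, given the number of indeterminates and the polynomial
    (ComputablePred fun p : ℕ × PolyCode => IsPolyStrNNeg (p.2.toPoly p.1)) ∧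
    (ComputablePred fun p : ℕ × PolyCode => RepresentedByNRational (p.2.toPoly p.1)) ∧
    (ComputablePred fun p : ℕ × PolyCode => RepresentedByNPolyregular (p.2.toPoly p.1)) ∧
    (ComputablePred fun p : ℕ × PolyCode => RepresentedByStarFree (p.2.toPoly p.1)) ∧
    -- conversion of a polynomial of the class to a star-free polyregular function
    (∃ F : ℕ × PolyCode → PolyregRep, Computable F ∧ ∀ (k : ℕ) (c : PolyCode),
      IsPolyStrNNeg (c.toPoly k) → (F (k, c)).StarFreeRepresents (c.toPoly k)) ∧
    -- conversion of a star-free polyregular function to a polyregular function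
    (∃ F : PolyregRep → PolyregRep, Computable F ∧
      ∀ (r : PolyregRep) (k : ℕ) (P : MvPolynomial (Fin k) ℤ),
        r.StarFreeRepresents P → (F r).Represents P) ∧
    -- conversion of a polyregular function to a weighted automaton
    (∃ F : PolyregRep → WARep, Computable F ∧
      ∀ (r : PolyregRep) (k : ℕ) (P : MvPolynomial (Fin k) ℤ),
        r.Represents P → (F r).Represents P) ∧
    -- conversion of a weighted automaton to a polynomial of the class
    (∃ F : WARep → PolyCode, Computable F ∧
      ∀ (r : WARep) (k : ℕ) (P : MvPolynomial (Fin k) ℤ),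
        r.Represents P → (F r).toPoly k = P ∧ IsPolyStrNNeg P) := by
  have hdec := computablePred_isPolyStrNNeg
  refine ⟨fun k P => tfae_represented P, hdec,
    hdec.of_eq fun p => (tfae_represented _).out 0 1,
    hdec.of_eq fun p => (tfae_represented _).out 0 2,
    hdec.of_eq fun p => (tfae_represented _).out 0 3, ?_, ?_, ?_, ?_⟩
  · obtain ⟨f, hf, h⟩ := exists_computable_threshold
    have hF : Primrec fun q : (ℕ × PolyCode) × ℕ => starFreeTables q.1 q.2 :=
      primrec_starFreeTables Primrec.fst Primrec.snd
    have hcomp : ∀ {G : (ℕ × PolyCode) × ℕ → PolyregRep}, Computable G →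
        Computable fun p => G (p, f p) := fun hG => hG.comp (Computable.id.pair hf)
    exact ⟨_, hcomp hF.to_comp, fun k c hc =>
      starFreeTables_represents (checkThreshold_iff.1 ((h (k, c)).2 hc))⟩
  · refine ⟨id, Computable.id, fun r k P h => ?_⟩
    obtain ⟨M, _, e, μ, π, η, -, h⟩ := h
    exact ⟨M, _, e, μ, π, η, h⟩
  · have hF : Primrec fun r : PolyregRep => ((automatonTables r.1, r.2) : WARep) := by fun_prop
    exact ⟨_, hF.to_comp, fun r k P h => represents_automatonTables h⟩
  · obtain ⟨F, hF, h⟩ := exists_computable_toPoly_eq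
    refine ⟨F, hF, fun r k P hr => ⟨h r k P hr, ?_⟩⟩
    obtain ⟨η, -, hrep⟩ := hr
    exact hrep.isPolyStrNNeg
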